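/- Let $k$ be an algebraically closed field of characteristic $p>0$, let $S$ and $C$ be smooth proper integral $k$-schemes of dimension $2$ and $1$ respectively, and let $\pi:S\to C$ be a $k$-morphism that is a fibration with nodal fibres: $\pi$ is proper and flat, and every geometric fibre of $\pi$ is a connected reduced curve all of whose singular (closed) points are normal crossings, that is, have completed local ring isomorphic to $K[[x,y]]/(xy)$, where $K$ is the (algebraically closed) field over which the geometric fibre is defined. (Every semistable fibration is of this kind.) For a scheme $X$ over $k$ let $F_X:X\to X$ be the absolute Frobenius morphism, and let $B^1_{X/k}$ be the $\mathcal O_X$-module $\operatorname{Im}\big(F_{X*}d: F_{X*}\mathcal O_X\to F_{X*}\Omega^1_{X/k}\big)$ of locally exact differentials. Let $S^{(p)}=S\times_{C,F_C}C$, let $W:S^{(p)}\to S$ be the first projection (the arithmetic Frobenius), let $F:S\to S^{(p)}$ be the relative Frobenius, i.e. the morphism over $C$ with $W\circ F=F_S$, and let $B^1_{S/C}$ be the $\mathcal O_{S^{(p)}}$-module $\operatorname{Im}\big(F_*d:F_*\mathcal O_S\to F_*\Omega^1_{S/C}\big)$ of relative locally exact differentials. Then there is a short exact sequence of $\mathcal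 O_S$-modules $$0\longrightarrow \pi^*B^1_{C/k}\stackrel{u}{\longrightarrow} B^1_{S/k}\stackrel{v}{\longrightarrow} W_*B^1_{S/C}\longrightarrow 0,$$ where $u$ is the pullback of forms (its adjoint $B^1_{C/k}\to\pi_*B^1_{S/k}$ sends $da$ to $d(\pi^\sharp a)$ for local sections $a$ of $\mathcal O_C$) and $v$ is the passage to relative forms (it sends $dr$ to $dr$ for local sections $r$ of $\mathcal O_S$). -/

import Mathlib

open CategoryTheory Limits AlgebraicGeometry TopologicalSpace Opposite

universe u

namespace LocallyExact

noncomputable section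

/-- The `p`-th power map of a commutative ring in which `p = 0`, as a ring homomorphism. (The zero
ring is allowed, as it occurs as the ring of sections over the empty set.) -/
def powHom (p : ℕ) [Fact p.Prime] {R : Type*} [CommRing R] (hR : (p : R) = 0) : R →+* R where
  toFun r := r ^ p
  map_one' := one_pow p
  map_mul' a b := mul_pow a b p
  map_zero' := zero_pow (Fact.out : p.Prime).ne_zero
  map_add' a b := by
    obtain ⟨r, hr⟩ := exists_add_pow_prime_eq (Fact.out : p.Prime) a b
    rw [hr, hR]
    ring

theorem natCast_eq_zero (p : ℕ) {k : Type u} [Field k] [CharP k p] {X : Scheme.{u}}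
    (f : X ⟶ Spec (.of k)) (U : X.Opens) : (p : Γ(X, U)) = 0 := by
  have h : (p : k) = 0 := CharP.cast_eq_zero k p
  let φ : k →+* Γ(X, U) :=
    ((Scheme.ΓSpecIso (.of k)).inv ≫ f.appTop ≫ X.presheaf.map (homOfLE le_top).op).hom
  rw [← map_natCast φ p, h, map_zero]

variable (p : ℕ) [Fact p.Prime] {k : Type u} [Field k] [CharP k p] {X Y : Scheme.{u}}

/-- The absolute Frobenius morphism of a scheme `X` over a field of characteristic `p`. -/
def absoluteFrobenius (f : X ⟶ Spec (.of k)) : X ⟶ X where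
  base := 𝟙 _
  c := { app U := CommRingCat.ofHom (powHom p (natCast_eq_zero p f U.unop))
         naturality U V i := by
          ext x
          exact (map_pow (X.presheaf.map i).hom x p).symm }
  prop x := by
    constructor
    intro a ha
    obtain ⟨U, hxU, s, rfl⟩ := X.presheaf.exists_germ_eq a
    rw [PresheafedSpace.stalkMap_germ_apply ] at ha
    have h2 : IsUnit ((X.presheaf.germ U x hxU s) ^ p) := by
      rw [← map_pow]
      exact ha
    exact (isUnit_pow_iff (Fact.out : p.Prime).ne_zero).mp h2

@[simp]
theorem absoluteFrobenius_preimage (f : X ⟶ Spec (.of k)) (U : X.Opens) :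
    absoluteFrobenius p f ⁻¹ᵁ U = U := rfl

theorem absoluteFrobenius_app_apply (f : X ⟶ Spec (.of k)) (U : X.Opens) (s : Γ(X, U)) :
    (absoluteFrobenius p f).app U s = (s ^ p : Γ(X, U)) := rfl

/-- The absolute Frobenius commutes with morphisms. -/
theorem absoluteFrobenius_comm (f : Y ⟶ Spec (.of k)) (π : X ⟶ Y) :
    π ≫ absoluteFrobenius p f = absoluteFrobenius p (π ≫ f) ≫ π := by
  refine Scheme.Hom.ext rfl fun U ↦ ?_
  ext s
  rw [CommRingCat.comp_apply, Scheme.Hom.comp_app, Scheme.Hom.comp_app]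
  refine (ConcreteCategory.congr_hom (X.presheaf.map_id _) _).trans ?_
  exact map_pow (π.app U).hom s p

/-- The Frobenius twist `X^(p) = X ×_{Y, F_Y} Y` of `X` over `Y`. -/
abbrev frobeniusTwist (π : X ⟶ Y) (f : Y ⟶ Spec (.of k)) : Scheme.{u} :=
  pullback π (absoluteFrobenius p f)

/-- The arithmetic Frobenius `W : X^(p) ⟶ X`, the base change of `F_Y`. -/
abbrev arithmeticFrobenius (π : X ⟶ Y) (f : Y ⟶ Spec (.of k)) : frobeniusTwist p π f ⟶ X :=
  pullback.fst π (absoluteFrobenius p f)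

/-- The relative Frobenius `F : X ⟶ X^(p)`, the morphism over `Y` with `W ∘ F = F_X`. -/
def relativeFrobenius (π : X ⟶ Y) (f : Y ⟶ Spec (.of k)) : X ⟶ frobeniusTwist p π f :=
  pullback.lift (absoluteFrobenius p (π ≫ f)) π (absoluteFrobenius_comm p f π).symm

theorem relativeFrobenius_comp (π : X ⟶ Y) (f : Y ⟶ Spec (.of k)) :
    relativeFrobenius p π f ≫ arithmeticFrobenius p π f = absoluteFrobenius p (π ≫ f) :=
  pullback.lift_fst _ _ _

/-- The morphism of presheaves of rings `f⁻¹ 𝒪_Y ⟶ 𝒪_X`, where `f⁻¹` is the presheaf inverse image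
`U ↦ colim_{V ⊇ f(U)} 𝒪_Y(V)`. -/
def inverseImageHom (f : X ⟶ Y) :
    (TopCat.Presheaf.pullback CommRingCat.{u} f.base).obj Y.presheaf ⟶ X.presheaf :=
  ((TopCat.Presheaf.pullbackPushforwardAdjunction CommRingCat.{u} f.base).homEquiv _ _).symm f.c

/-- The presheaf `U ↦ Ω¹` of `𝒪_X(U)` over `(f⁻¹ 𝒪_Y)(U)`. -/
def differentialsPresheaf (f : X ⟶ Y) : X.PresheafOfModules :=
  PresheafOfModules.DifferentialsConstruction.relativeDifferentials' (inverseImageHom f)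

/-- The sheaf of relative differentials `Ω¹_{X/Y}` of a morphism `f : X ⟶ Y`: the sheaf associated
with the presheaf of relative differentials. -/
def differentials (f : X ⟶ Y) : X.Modules :=
  (PresheafOfModules.sheafification (𝟙 X.ringCatSheaf.obj)).obj (differentialsPresheaf f)

/-- The canonical map from the presheaf of differentials to its associated sheaf. -/
def toDifferentials (f : X ⟶ Y) : (differentialsPresheaf f) ⟶ (differentials f).val :=
  (PresheafOfModules.sheafificationAdjunction (𝟙 X.ringCatSheaf.obj)).unit.app
    (differentialsPresheaf f)

/-- The universal derivation `d : 𝒪_X ⟶ Ω¹_{X/Y}`. -/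
def derivation (f : X ⟶ Y) : (differentials f).val.Derivation' (inverseImageHom f) :=
  (PresheafOfModules.DifferentialsConstruction.derivation' (inverseImageHom f)).postcomp
    (toDifferentials f)


/-- The universal derivation `d : 𝒪_X(U) ⟶ Ω¹_{X/Y}(U)` on sections. -/
def d (f : X ⟶ Y) (U : X.Opens) : Γ(X, U) →+ Γ(differentials f, U) :=
  (derivation f).d (X := op U)

theorem d_mul (f : X ⟶ Y) (U : X.Opens) (a b : Γ(X, U)) :
    d f U (a * b) = a • d f U b + b • d f U a :=
  (derivation f).d_mul (X := op U) a b

theorem d_mul_of_eq_zero (f : X ⟶ Y) (U : X.Opens) (a b : Γ(X, U)) (h : d f U a = 0) :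
    d f U (a * b) = a • d f U b := by
  rw [d_mul, h, smul_zero, add_zero]

theorem d_map (f : X ⟶ Y) {U V : X.Opens} (i : V ⟶ U) (a : Γ(X, U)) :
    d f V (X.presheaf.map i.op a) = (differentials f).presheaf.map i.op (d f U a) :=
  (derivation f).d_map (X := op U) i.op a

theorem d_app (f : X ⟶ Y) (V : Y.Opens) (a : Γ(Y, V)) :
    d f (f ⁻¹ᵁ V) (f.app V a) = 0 := by
  let adj := TopCat.Presheaf.pullbackPushforwardAdjunction CommRingCat.{u} f.base
  have h : adj.unit.app Y.presheaf ≫ (TopCat.Presheaf.pushforward _ f.base).map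
      (inverseImageHom f) = f.c := by
    refine (adj.homEquiv_unit _ _ _).symm.trans ?_
    exact (adj.homEquiv _ _).apply_symm_apply f.c
  have h2 : f.app V a = (inverseImageHom f).app (op (f ⁻¹ᵁ V))
      ((adj.unit.app Y.presheaf).app (op V) a) :=
    (ConcreteCategory.congr_hom (NatTrans.congr_app h (op V)) a).symm
  rw [h2]
  exact (derivation f).d_app _

theorem d_appLE (f : X ⟶ Y) (V : Y.Opens) (U : X.Opens) (e : U ≤ f ⁻¹ᵁ V) (a : Γ(Y, V)) :
    d f U (f.appLE V U e a) = 0 := by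
  have := d_map f (homOfLE e) (f.app V a)
  rw [d_app, map_zero] at this
  exact this

theorem d_pow (f : X ⟶ Y) (U : X.Opens) (a : Γ(X, U)) (n : ℕ) :
    d f U (a ^ n) = (n * a ^ (n - 1)) • d f U a := by
  induction n with
  | zero => 
    have := d_mul f U 1 1
    simp only [one_smul, mul_one] at this
    simpa using this
  | succ n ih =>
    rw [pow_succ, d_mul, ih, smul_smul, ← add_smul]
    congr 1
    rcases n with _ | n
    · simp
    · simp [pow_succ]; ring

/-- A section of a sheaf of modules that vanishes locally is zero. -/
theorem eq_zero_of_locally (M : X.Modules) (U : X.Opens) (m : Γ(M, U))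
    (h : ∀ x ∈ U, ∃ (V : X.Opens) (i : V ⟶ U), x ∈ V ∧ M.presheaf.map i.op m = 0) : m = 0 := by
  choose V i hxV hV using h
  refine TopCat.Sheaf.eq_of_locally_eq' ⟨M.presheaf, M.isSheaf⟩
    (fun x : U ↦ V x.1 x.2) U (fun x ↦ i x.1 x.2) ?_ m 0 ?_
  · intro x hx
    exact Opens.mem_iSup.mpr ⟨⟨x, hx⟩, hxV x hx⟩
  · intro x
    rw [map_zero]
    exact hV x.1 x.2

/-- Two ring homomorphisms out of the sections over an affine open give the same morphism after composing
with `G` iff they agree on the functions pulled back along `G`. -/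
theorem specMap_comp_eq_iff (G : X ⟶ Y) {U : X.Opens} (hU : IsAffineOpen U) {W : Y.Opens}
    (hW : IsAffineOpen W) (e : U ≤ G ⁻¹ᵁ W) {T : CommRingCat.{u}} (i j : Γ(X, U) ⟶ T) :
    (Spec.map i ≫ hU.fromSpec) ≫ G = (Spec.map j ≫ hU.fromSpec) ≫ G ↔
      G.appLE W U e ≫ i = G.appLE W U e ≫ j := by
  simp only [Category.assoc]
  rw [← IsAffineOpen.SpecMap_appLE_fromSpec G hW hU e, ← Spec.map_comp_assoc,
    ← Spec.map_comp_assoc, cancel_mono, Spec.map_injective.eq_iff]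

/-- The kernel of a derivation is the equalizer of two ring homomorphisms (into the trivial
square-zero extension). -/
theorem exists_ringHom {R : CommRingCat.{u}} {M : Type u} [AddCommGroup M] [Module R M]
    (D : R →+ M) (hD : ∀ a b, D (a * b) = a • D b + b • D a) :
    ∃ (T : CommRingCat.{u}) (i j : R ⟶ T), (∀ r, i r = j r ↔ D r = 0) := by
  let _ : Module Rᵐᵒᵖ M := Module.compHom M ((RingHom.id R).fromOpposite mul_comm)
  have : IsCentralScalar R M := ⟨fun r m ↦ rfl⟩
  have h1 : D 1 = 0 := by simpa using hD 1 1
  refine ⟨.of (TrivSqZeroExt R M), CommRingCat.ofHom (TrivSqZeroExt.inlHom R M),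
    CommRingCat.ofHom ⟨⟨⟨fun r ↦ TrivSqZeroExt.inl r + TrivSqZeroExt.inr (D r), ?_⟩, ?_⟩, ?_, ?_⟩,
    fun r ↦ ?_⟩
  · simp [h1]
  · intro a b
    ext
    · simp
    · simp [hD]
  · simp
  · intro a b
    simp only [map_add, TrivSqZeroExt.inl_add, TrivSqZeroExt.inr_add]
    abel
  · change TrivSqZeroExt.inl r = TrivSqZeroExt.inl r + TrivSqZeroExt.inr (D r) ↔ _
    rw [left_eq_add]
    exact ⟨fun h ↦ TrivSqZeroExt.inr_injective (h.trans (TrivSqZeroExt.inr_zero R).symm), 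
      fun h ↦ by rw [h, TrivSqZeroExt.inr_zero]⟩

/-- The derivation kills `p`-th powers, i.e. functions pulled back along `F_X`. -/
theorem d_absoluteFrobenius (f : X ⟶ Y) (g : X ⟶ Spec (.of k)) (U : X.Opens) (s : Γ(X, U)) :
    d f (absoluteFrobenius p g ⁻¹ᵁ U) ((absoluteFrobenius p g).app U s) = 0 := by
  change d f U (s ^ p : Γ(X, U)) = 0
  rw [d_pow, natCast_eq_zero p g U, zero_mul, zero_smul]

/-- The relative derivation kills the functions pulled back along `F : X ⟶ X^(p)`. -/
theorem d_relativeFrobenius (π : X ⟶ Y) (f : Y ⟶ Spec (.of k)) (W : (frobeniusTwist p π f).Opens)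
    (s : Γ(frobeniusTwist p π f, W)) :
    d π (relativeFrobenius p π f ⁻¹ᵁ W) ((relativeFrobenius p π f).app W s) = 0 := by
  set G := relativeFrobenius p π f with hG
  refine eq_zero_of_locally _ _ _ fun x hx ↦ ?_
  obtain ⟨W', hW', hxW', hWW'⟩ := exists_isAffineOpen_mem_and_subset (x := G x) (U := W) hx
  obtain ⟨V, hV, hxV, -⟩ := exists_isAffineOpen_mem_and_subset (x := π x) (U := ⊤) trivial
  obtain ⟨U, hU, hxU, hUW⟩ := exists_isAffineOpen_mem_and_subset (x := x)
    (U := G ⁻¹ᵁ W' ⊓ π ⁻¹ᵁ V) ⟨hxW', hxV⟩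
  have e₁ : U ≤ G ⁻¹ᵁ W' := hUW.trans inf_le_left
  have e₂ : U ≤ π ⁻¹ᵁ V := hUW.trans inf_le_right
  have e₃ : U ≤ G ⁻¹ᵁ W := e₁.trans fun y hy ↦ hWW' hy
  refine ⟨U, homOfLE e₃, hxU, ?_⟩
  rw [← d_map]
  obtain ⟨T, i, j, hij⟩ := exists_ringHom (R := Γ(X, U)) (d π U) (d_mul π U)
  have key : (Spec.map i ≫ hU.fromSpec) ≫ G = (Spec.map j ≫ hU.fromSpec) ≫ G := by
    apply pullback.hom_ext
    · rw [Category.assoc (Spec.map i ≫ _), Category.assoc (Spec.map j ≫ _), hG,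
        relativeFrobenius_comp, specMap_comp_eq_iff (absoluteFrobenius p (π ≫ f)) hU hU le_rfl]
      ext r
      refine (hij _).mpr ?_
      exact (congrArg (d π U) (ConcreteCategory.congr_hom
        (Scheme.Hom.appLE_eq_app (absoluteFrobenius p (π ≫ f))) r)).trans
          (d_absoluteFrobenius p π (π ≫ f) U r)
    · rw [Category.assoc (Spec.map i ≫ _), Category.assoc (Spec.map j ≫ _), hG,
        relativeFrobenius, pullback.lift_snd, specMap_comp_eq_iff π hU hV e₂]
      ext r
      exact (hij _).mpr (d_appLE π V U e₂ r)
  rw [specMap_comp_eq_iff _ hU hW' e₁] at key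
  have h2 := (hij _).mp (ConcreteCategory.congr_hom key
    ((frobeniusTwist p π f).presheaf.map (homOfLE hWW').op s))
  exact (congrArg (d π U) (ConcreteCategory.congr_hom
    (Scheme.Hom.map_appLE G e₁ (homOfLE hWW').op) s)).symm.trans h2

/-- The structure sheaf `𝒪_X` as an `𝒪_X`-module. -/
abbrev structureModule (X : Scheme.{u}) : X.Modules := SheafOfModules.unit X.ringCatSheaf

/-- The morphism of `𝒪_Y`-modules `𝒪_Y ⟶ π_* 𝒪_X` given by pulling back functions. -/
def structureHom (π : X ⟶ Y) :
    structureModule Y ⟶ (Scheme.Modules.pushforward π).obj (structureModule X) :=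
  SheafOfModules.unitToPushforwardObjUnit π.toRingCatSheafHom

/-- If `d` kills the functions pulled back along `G : X ⟶ Z`, it is an `𝒪_Z`-linear map
`G_* d : G_* 𝒪_X ⟶ G_* Ω¹_{X/Y}`. -/
def pushforwardD {Z : Scheme.{u}} (f : X ⟶ Y) (G : X ⟶ Z)
    (h : ∀ (U : Z.Opens) (s : Γ(Z, U)), d f (G ⁻¹ᵁ U) (G.app U s) = 0) :
    (Scheme.Modules.pushforward G).obj (structureModule X) ⟶
      (Scheme.Modules.pushforward G).obj (differentials f) where
  val := PresheafOfModules.homMk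
    { app U := AddCommGrpCat.ofHom (d f (G ⁻¹ᵁ U.unop))
      naturality U V i := by
        ext s
        exact d_map f ((Opens.map G.base).map i.unop) s }
    (fun U r m ↦ by
      exact d_mul_of_eq_zero f (G ⁻¹ᵁ U.unop) (G.app U.unop r) m (h U.unop r))


/-- The `𝒪_X`-linear map `F_{X*} d : F_{X*} 𝒪_X ⟶ F_{X*} Ω¹_{X/k}`. -/
def absoluteD (f : X ⟶ Spec (.of k)) :
    (Scheme.Modules.pushforward (absoluteFrobenius p f)).obj (structureModule X) ⟶
      (Scheme.Modules.pushforward (absoluteFrobenius p f)).obj (differentials f) :=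
  pushforwardD f (absoluteFrobenius p f) (d_absoluteFrobenius p f f)

/-- The sheaf `B¹_{X/k}` of locally exact differentials: the image of
`F_{X*} d : F_{X*} 𝒪_X ⟶ F_{X*} Ω¹_{X/k}`, an `𝒪_X`-module. -/
def exactForms (f : X ⟶ Spec (.of k)) : X.Modules := image (absoluteD p f)

/-- The differential, as an epimorphism `F_{X*} 𝒪_X ⟶ B¹_{X/k}`. -/
def toExactForms (f : X ⟶ Spec (.of k)) :
    (Scheme.Modules.pushforward (absoluteFrobenius p f)).obj (structureModule X) ⟶
      exactForms p f :=
  factorThruImage (absoluteD p f)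

/-- The `𝒪_{X^(p)}`-linear map `F_* d : F_* 𝒪_X ⟶ F_* Ω¹_{X/Y}`. -/
def relativeD (π : X ⟶ Y) (f : Y ⟶ Spec (.of k)) :
    (Scheme.Modules.pushforward (relativeFrobenius p π f)).obj (structureModule X) ⟶
      (Scheme.Modules.pushforward (relativeFrobenius p π f)).obj (differentials π) :=
  pushforwardD π (relativeFrobenius p π f) (d_relativeFrobenius p π f)

/-- The sheaf `B¹_{X/Y}` of relative locally exact differentials: the image of
`F_* d : F_* 𝒪_X ⟶ F_* Ω¹_{X/Y}`, an `𝒪_{X^(p)}`-module. -/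
def relativeExactForms (π : X ⟶ Y) (f : Y ⟶ Spec (.of k)) : (frobeniusTwist p π f).Modules :=
  image (relativeD p π f)

/-- The relative differential, as an epimorphism `F_* 𝒪_X ⟶ B¹_{X/Y}`. -/
def toRelativeExactForms (π : X ⟶ Y) (f : Y ⟶ Spec (.of k)) :
    (Scheme.Modules.pushforward (relativeFrobenius p π f)).obj (structureModule X) ⟶
      relativeExactForms p π f :=
  factorThruImage (relativeD p π f)

/-- The identification `F_{X*} 𝒪_X = W_* F_* 𝒪_X` coming from `W ∘ F = F_X`. -/
def pushforwardFrobeniusIso (π : X ⟶ Y) (f : Y ⟶ Spec (.of k)) :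
    (Scheme.Modules.pushforward (absoluteFrobenius p (π ≫ f))).obj (structureModule X) ≅
      (Scheme.Modules.pushforward (arithmeticFrobenius p π f)).obj
        ((Scheme.Modules.pushforward (relativeFrobenius p π f)).obj (structureModule X)) :=
  (Scheme.Modules.pushforwardCongr (relativeFrobenius_comp p π f)).symm.app _ ≪≫
    (Scheme.Modules.pushforwardComp (relativeFrobenius p π f)
      (arithmeticFrobenius p π f)).symm.app _

/-- The `𝒪_Y`-linear map `F_{Y*} 𝒪_Y ⟶ F_{Y*} π_* 𝒪_X = π_* F_{X*} 𝒪_X`, `a ↦ π^♯ a`. -/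
def frobeniusStructureHom (π : X ⟶ Y) (f : Y ⟶ Spec (.of k)) :
    (Scheme.Modules.pushforward (absoluteFrobenius p f)).obj (structureModule Y) ⟶
      (Scheme.Modules.pushforward π).obj
        ((Scheme.Modules.pushforward (absoluteFrobenius p (π ≫ f))).obj (structureModule X)) :=
  (Scheme.Modules.pushforward (absoluteFrobenius p f)).map (structureHom π) ≫
    (Scheme.Modules.pushforwardComp π (absoluteFrobenius p f)).hom.app _ ≫
    (Scheme.Modules.pushforwardCongr (absoluteFrobenius_comm p f π)).hom.app _ ≫
    (Scheme.Modules.pushforwardComp (absoluteFrobenius p (π ≫ f)) π).inv.app _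

/-- `u : π^* B¹_{Y/k} ⟶ B¹_{X/k}` is the pullback of forms: the adjoint morphism
`B¹_{Y/k} ⟶ π_* B¹_{X/k}` sends `da` to `d(π^♯ a)`. -/
def IsPullbackOfForms (π : X ⟶ Y) (f : Y ⟶ Spec (.of k))
    (u : (Scheme.Modules.pullback π).obj (exactForms p f) ⟶ exactForms p (π ≫ f)) : Prop :=
  toExactForms p f ≫ (Scheme.Modules.pullbackPushforwardAdjunction π).homEquiv _ _ u =
    frobeniusStructureHom p π f ≫ (Scheme.Modules.pushforward π).map (toExactForms p (π ≫ f))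

/-- `v : B¹_{X/k} ⟶ W_* B¹_{X/Y}` is the passage to relative forms: it sends `dr` to `dr`. -/
def IsPassageToRelativeForms (π : X ⟶ Y) (f : Y ⟶ Spec (.of k))
    (v : exactForms p (π ≫ f) ⟶
      (Scheme.Modules.pushforward (arithmeticFrobenius p π f)).obj (relativeExactForms p π f)) :
    Prop :=
  toExactForms p (π ≫ f) ≫ v =
    (pushforwardFrobeniusIso p π f).hom ≫
      (Scheme.Modules.pushforward (arithmeticFrobenius p π f)).map (toRelativeExactForms p π f)

end

/-- A local ring `R` (with residue field `κ`) is a normal crossing, or node, if its completion is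
isomorphic to `κ⟦x, y⟧ / (xy)`. -/
def IsNode (R : Type*) [CommRing R] [IsLocalRing R] : Prop :=
  Nonempty (AdicCompletion (IsLocalRing.maximalIdeal R) R ≃+*
    (MvPowerSeries (Fin 2) (IsLocalRing.ResidueField R) ⧸
      Ideal.span {(MvPowerSeries.X 0 * MvPowerSeries.X 1 :
        MvPowerSeries (Fin 2) (IsLocalRing.ResidueField R))}))

/-- A scheme `Z` (of finite type over an algebraically closed field) is a nodal curve if it is
connected, reduced, one-dimensional at every closed point, and all its singular closed points are
normal crossings. -/
structure IsNodalCurve (Z : Scheme.{u}) : Prop where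
  connected : ConnectedSpace Z
  reduced : IsReduced Z
  dim_eq_one : ∀ z : Z, IsClosed {z} → ringKrullDim (Z.presheaf.stalk z) = 1
  node : ∀ z : Z, IsClosed {z} → ¬ IsRegularLocalRing (Z.presheaf.stalk z) →
    IsNode (Z.presheaf.stalk z)

/-- A nodal fibration: a proper flat morphism all of whose geometric fibres are (connected) nodal
curves. Every semistable fibration is one. -/
structure IsNodalFibration {X Y : Scheme.{u}} (π : X ⟶ Y) : Prop where
  proper : IsProper π
  flat : Flat π
  nodal : ∀ (K : Type u) [Field K] [IsAlgClosed K] (y : Spec (.of K) ⟶ Y),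
    IsNodalCurve (pullback π y)

end LocallyExact

/-! ### Monomorphisms, epimorphisms and exactness of sheaves of modules via local sections -/

namespace LocallyExact
noncomputable section
variable {X Y : Scheme.{u}}

/-! The sequence is checked on sections near closed points `s` of `S`; this suffices because `S` is
a Jacobson space, so every point specializes to a closed point inside any given neighbourhood. Let
`B` be the local ring at `s`, with coordinates `x₀, x₁` and dual derivations `∂₀, ∂₁`, and let `t`
be a parameter of `C` at `π s`. Every element of the local ring of `C` is a sum `∑ cᵢ ^ p tⁱ` with
`i < p`. The module structure on exact forms goes through Frobenius, `c • dr = d(c ^ p r)`, so the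
`d(tⁱ)` generate `B¹_C` near `π s`, and the image of `u` consists locally of the forms `d(∑ cᵢ ^ p
tⁱ)`.

The map `u` exists because a function with zero differential on a smooth curve is locally a `p`-th
power, and `v` exists for the same reason on the surface. The composite is zero because relative
differentials kill functions from `C`. The map `v` is epi because `W` is a homeomorphism, so that
`W_*` preserves epimorphisms. The map `u` is mono because `d(∑ cᵢ ^ p tⁱ) = 0` with `dt ≠ 0` forces
`cᵢ = 0` for `0 < i < p` (`coeff_eq_zero_of_derivation_sum_eq_zero`), while `d(t⁰) = 0`.

The heart is exactness in the middle: if `r` has zero relative differential, then `r = ∑ cᵢ ^ p tⁱ`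
(`IsCoordinates.exists_eq_sum`). The hypothesis on `r` says `dr ∧ dt = 0`. The hypothesis on the
fibres enters only through `IsCoordinates.maximalIdeal_le_jacobian`: at a smooth or nodal point of
the fibre, the ideal `(∂₀ t, ∂₁ t)` contains the maximal ideal. Since `x₀, x₁` is a regular
sequence, the Koszul relation is then the only one between `∂₀ t` and `∂₁ t`, and `dr = g dt` for
some `g` in `B`. Over the fraction field, `r` is a polynomial in `t` of degree less than `p` with
`p`-th power coefficients, by a `p`-basis argument. The denominator is removed by induction on the
degree: `g` plays the role of the derivative of `r` with respect to `t`, it is a polynomial of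
smaller degree, and it can be integrated because `1, …, p - 1` are invertible; the remaining
difference is closed, hence a `p`-th power. -/

theorem Modules.map_map (M : X.Modules) {U V W : X.Opens} (i : V ⟶ U) (j : W ⟶ V) (m : Γ(M, U)) :
    M.presheaf.map j.op (M.presheaf.map i.op m) = M.presheaf.map (j ≫ i).op m := by
  rw [op_comp, Functor.map_comp]
  rfl

theorem Modules.app_map {M N : X.Modules} (φ : M ⟶ N) {U V : X.Opens} (i : V ⟶ U) (m : Γ(M, U)) :
    φ.app V (M.presheaf.map i.op m) = N.presheaf.map i.op (φ.app U m) :=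
  NatTrans.naturality_apply φ.mapPresheaf i.op m

theorem Modules.comp_app_apply {M N K : X.Modules} (φ : M ⟶ N) (ψ : N ⟶ K) (U : X.Opens)
    (m : Γ(M, U)) : (φ ≫ ψ).app U m = ψ.app U (φ.app U m) := rfl

theorem Modules.app_injective {M N : X.Modules} (φ : M ⟶ N) [Mono φ] (U : X.Opens) :
    Function.Injective (φ.app U) := by
  have h : Mono φ.mapPresheaf := inferInstanceAs (Mono ((Scheme.Modules.toPresheaf X).map φ))
  have h2 : Mono (φ.mapPresheaf.app (op U)) := inferInstance
  exact (AddCommGrpCat.mono_iff_injective _).mp h2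

theorem Modules.mono_of_app_injective {M N : X.Modules} (φ : M ⟶ N)
    (h : ∀ U, Function.Injective (φ.app U)) : Mono φ := by
  refine ⟨fun g g' e ↦ Scheme.Modules.hom_ext _ _ fun U ↦ ?_⟩
  ext m
  apply h U
  exact congr(Scheme.Modules.Hom.app $e U m)

theorem Modules.eq_of_locally (M : X.Modules) (U : X.Opens) (m n : Γ(M, U))
    (h : ∀ x ∈ U, ∃ (V : X.Opens) (i : V ⟶ U), x ∈ V ∧
      M.presheaf.map i.op m = M.presheaf.map i.op n) : m = n := by
  rw [← sub_eq_zero]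
  refine eq_zero_of_locally M U _ fun x hx ↦ ?_
  obtain ⟨V, i, hV, e⟩ := h x hx
  exact ⟨V, i, hV, by rw [map_sub, e, sub_self]⟩

/-- A morphism of modules that is surjective locally on sections. -/
def IsLocallySurjective {M N : X.Modules} (φ : M ⟶ N) : Prop :=
  ∀ (U : X.Opens) (n : Γ(N, U)), ∀ x ∈ U, ∃ (V : X.Opens) (i : V ⟶ U) (m : Γ(M, V)),
    x ∈ V ∧ φ.app V m = N.presheaf.map i.op n

theorem IsLocallySurjective.epi {M N : X.Modules} {φ : M ⟶ N} (h : IsLocallySurjective φ) :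
    Epi φ := by
  refine ⟨fun g g' e ↦ Scheme.Modules.hom_ext _ _ fun U ↦ ?_⟩
  ext n
  refine Modules.eq_of_locally _ _ _ _ fun x hx ↦ ?_
  obtain ⟨V, i, m, hV, hm⟩ := h U n x hx
  refine ⟨V, i, hV, ?_⟩
  rw [← Modules.app_map, ← Modules.app_map, ← hm]
  exact congr(Scheme.Modules.Hom.app $e V m)

/-- A submodule of the presheaf of modules underlying a sheaf is local if it contains all sections
that are locally contained in it. -/
def IsLocalSubmodule (M : X.Modules) (N : M.val.Submodule) : Prop :=
  ∀ (U : X.Opens) (m : Γ(M, U)), (∀ x ∈ U, ∃ (V : X.Opens) (i : V ⟶ U), x ∈ V ∧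
    M.presheaf.map i.op m ∈ N.obj (op V)) → m ∈ N.obj (op U)

variable {M : X.Modules} (N : M.val.Submodule) (hN : IsLocalSubmodule M N)

include hN in
theorem IsLocalSubmodule.isSheaf : TopCat.Presheaf.IsSheaf N.toPresheafOfModules.presheaf := by
  rw [TopCat.Presheaf.isSheaf_iff_isSheafUniqueGluing]
  intro ι U sf hsf
  obtain ⟨s, hs, hs'⟩ := M.isSheaf.isSheafUniqueGluing U (fun i ↦ (sf i).1) (fun i j ↦ 
    congr_arg Subtype.val (hsf i j))
  refine ⟨⟨s, hN _ _ fun x hx ↦ ?_⟩, fun i ↦ Subtype.ext (hs i), fun t ht ↦ Subtype.ext 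
    (hs' _ fun i ↦ congr_arg Subtype.val (ht i))⟩
  obtain ⟨i, hi⟩ := Opens.mem_iSup.mp hx
  refine ⟨U i, Opens.leSupr U i, hi, ?_⟩
  have := hs i
  dsimp at this
  rw [this]
  exact (sf i).2

/-- The module associated with a local submodule. -/
def subsheaf : X.Modules := SheafOfModules.mk N.toPresheafOfModules (hN.isSheaf N)

/-- The inclusion of a local submodule. -/
def subsheafι : subsheaf N hN ⟶ M := ⟨N.ι⟩

instance : Mono (subsheafι N hN) :=
  Modules.mono_of_app_injective _ fun _ ↦ Subtype.val_injective

theorem subsheafι_mem (U : X.Opens) (m : Γ(subsheaf N hN, U)) :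
    (subsheafι N hN).app U m ∈ N.obj (op U) := m.2

/-- Lift a morphism to a local submodule that contains its image. -/
def subsheafLift {K : X.Modules} (φ : K ⟶ M) (h : ∀ U m, φ.app U m ∈ N.obj (op U)) :
    K ⟶ subsheaf N hN where
  val := PresheafOfModules.homMk
    { app U := AddCommGrpCat.ofHom
        { toFun m := ⟨φ.app U.unop m, h U.unop m⟩
          map_zero' := Subtype.ext (map_zero _)
          map_add' _ _ := Subtype.ext (map_add _ _ _) }
      naturality U V i := by
        ext m
        exact Subtype.ext (Modules.app_map φ i.unop m) }
    (fun U r m ↦ Subtype.ext (Scheme.Modules.Hom.app_smul φ r m))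

theorem subsheafLift_ι {K : X.Modules} (φ : K ⟶ M) (h : ∀ U m, φ.app U m ∈ N.obj (op U)) :
    subsheafLift N hN φ h ≫ subsheafι N hN = φ := rfl

/-- Construct a submodule of the presheaf of modules underlying a sheaf of modules from sets of
sections. -/
def mkSubmodule (M : X.Modules) (s : ∀ U : X.Opens, Set Γ(M, U)) (zero : ∀ U, 0 ∈ s U)
    (add : ∀ U (a b : Γ(M, U)), a ∈ s U → b ∈ s U → a + b ∈ s U)
    (smul : ∀ U (r : Γ(X, U)) (a : Γ(M, U)), a ∈ s U → r • a ∈ s U)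
    (map : ∀ (U V : X.Opens) (i : V ⟶ U) (a : Γ(M, U)), a ∈ s U → M.presheaf.map i.op a ∈ s V) :
    M.val.Submodule where
  obj U :=
    { carrier := s U.unop
      zero_mem' := zero U.unop
      add_mem' {a b} := add U.unop a b
      smul_mem' r a := smul U.unop r a }
  map {U V} f := fun m hm ↦ map U.unop V.unop f.unop m hm

/-- The submodule of sections that are locally in the image of a morphism. -/
def localRange {K : X.Modules} (φ : K ⟶ M) : M.val.Submodule :=
  mkSubmodule M
    (fun U ↦ { m | ∀ x ∈ U, ∃ (V : X.Opens) (i : V ⟶ U) (n : Γ(K, V)),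
        x ∈ V ∧ φ.app V n = M.presheaf.map i.op m })
    (fun U x hx ↦ ⟨U, 𝟙 _, 0, hx, by simp only [map_zero]⟩)
    (fun U a b ha hb x hx ↦ by
      obtain ⟨V, i, n, hxV, hn⟩ := ha x hx
      obtain ⟨V', i', n', hxV', hn'⟩ := hb x hx
      refine ⟨V ⊓ V', homOfLE (inf_le_left.trans i.le), K.presheaf.map (homOfLE inf_le_left).op n
        + K.presheaf.map (homOfLE inf_le_right).op n', ⟨hxV, hxV'⟩, ?_⟩
      rw [map_add, Modules.app_map, Modules.app_map, hn, hn', Modules.map_map, Modules.map_map,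
        map_add]
      rfl)
    (fun U r a ha x hx ↦ by
      obtain ⟨V, i, n, hxV, hn⟩ := ha x hx
      refine ⟨V, i, (X.presheaf.map i.op r : Γ(X, V)) • n, hxV, ?_⟩
      rw [Scheme.Modules.Hom.app_smul, hn, Scheme.Modules.map_smul])
    (fun U V f m hm x hx ↦ by
      obtain ⟨W, i, n, hxW, hn⟩ := hm x (f.le hx)
      refine ⟨W ⊓ V, homOfLE inf_le_right, K.presheaf.map (homOfLE inf_le_left).op n,
        ⟨hxW, hx⟩, ?_⟩
      rw [Modules.app_map, hn, Modules.map_map, Modules.map_map]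
      rfl)

theorem isLocalSubmodule_localRange {K : X.Modules} (φ : K ⟶ M) :
    IsLocalSubmodule M (localRange φ) := by
  intro U m h x hx
  obtain ⟨V, i, hxV, hV⟩ := h x hx
  obtain ⟨W, j, n, hxW, hn⟩ := hV x hxV
  exact ⟨W, j ≫ i, n, hxW, by rw [hn, Modules.map_map]⟩

/-- The sections locally in the image form a subsheaf through which `φ` factors. Its inclusion is
mono and, since `φ` is epi, also epi; modules form an abelian category, so it is an isomorphism. -/
theorem isLocallySurjective_of_epi {K : X.Modules} (φ : K ⟶ M) [Epi φ] :
    IsLocallySurjective φ := by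
  have h : ∀ U m, φ.app U m ∈ (localRange φ).obj (op U) := fun U m x hx ↦
    ⟨U, 𝟙 _, m, hx, by rw [op_id, M.presheaf.map_id]; rfl⟩
  have e := subsheafLift_ι _ (isLocalSubmodule_localRange φ) φ h
  have : Epi (subsheafι _ (isLocalSubmodule_localRange φ)) := epi_of_epi_fac e
  have : IsIso (subsheafι _ (isLocalSubmodule_localRange φ)) := isIso_of_mono_of_epi _
  intro U n
  have h2 := subsheafι_mem _ (isLocalSubmodule_localRange φ) U
    ((inv (subsheafι _ (isLocalSubmodule_localRange φ))).app U n)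
  rw [← Modules.comp_app_apply, IsIso.inv_hom_id] at h2
  exact h2

/-- Exactness can be checked locally on sections. -/
theorem exact_of_locally {S : ShortComplex X.Modules}
    (h : ∀ (U : X.Opens) (m : Γ(S.X₂, U)), S.g.app U m = 0 → ∀ x ∈ U,
      ∃ (V : X.Opens) (i : V ⟶ U) (n : Γ(S.X₁, V)), x ∈ V ∧
        S.f.app V n = S.X₂.presheaf.map i.op m) : S.Exact := by
  rw [S.exact_iff_epi_kernel_lift]
  apply IsLocallySurjective.epi
  intro U m x hx
  obtain ⟨V, i, n, hxV, hn⟩ := h U ((kernel.ι S.g).app U m) (by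
    rw [← Modules.comp_app_apply, kernel.condition]; rfl) x hx
  refine ⟨V, i, n, hxV, Modules.app_injective (kernel.ι S.g) V ?_⟩
  rw [← Modules.comp_app_apply, kernel.lift_ι, hn, Modules.app_map]

/-- Pushforward along a homeomorphism preserves epimorphisms. -/
theorem epi_pushforward_map (f : X ⟶ Y) (hf : IsHomeomorph f) {K : X.Modules} (φ : K ⟶ M)
    [Epi φ] : Epi ((Scheme.Modules.pushforward f).map φ) := by
  apply IsLocallySurjective.epi
  intro U n y hy
  obtain ⟨x, rfl⟩ := hf.surjective y
  obtain ⟨V, i, m, hxV, hm⟩ := isLocallySurjective_of_epi φ (f ⁻¹ᵁ U) n x hy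
  -- The neighbourhood found upstairs may not be a preimage a priori; for a homeomorphism it is the
  -- preimage of its open image.
  let V' : Y.Opens := ⟨f '' V, hf.isOpenMap _ V.2⟩
  have hV' : V' ≤ U := by
    rintro _ ⟨z, hz, rfl⟩
    exact i.le hz
  have e : f ⁻¹ᵁ V' ≤ V := by
    rintro z ⟨z', hz', h⟩
    rwa [← hf.injective h]
  refine ⟨V', homOfLE hV', K.presheaf.map (homOfLE e).op m, ⟨x, hxV, rfl⟩, ?_⟩
  refine (Modules.app_map φ (homOfLE e) m).trans ?_
  rw [hm]
  exact Modules.map_map M i (homOfLE e) n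

end
end LocallyExact

namespace LocallyExact
noncomputable section
variable {X Y : Scheme.{u}}

/-! ### Local generators of the pullback of a module -/

section Pullback

variable (π : X ⟶ Y) (M : Y.Modules)

/-- The pullback of a section of a module. -/
def pullbackSection (W : Y.Opens) (b : Γ(M, W)) :
    Γ((Scheme.Modules.pullback π).obj M, π ⁻¹ᵁ W) :=
  ((Scheme.Modules.pullbackPushforwardAdjunction π).unit.app M).app W b

theorem pullbackSection_add (W : Y.Opens) (b c : Γ(M, W)) :
    pullbackSection π M W (b + c) = pullbackSection π M W b + pullbackSection π M W c :=
  map_add (((Scheme.Modules.pullbackPushforwardAdjunction π).unit.app M).app W).hom b c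

theorem pullbackSection_zero (W : Y.Opens) : pullbackSection π M W 0 = 0 :=
  map_zero (((Scheme.Modules.pullbackPushforwardAdjunction π).unit.app M).app W).hom

theorem pullbackSection_smul (W : Y.Opens) (r : Γ(Y, W)) (b : Γ(M, W)) :
    pullbackSection π M W (r • b) = (π.app W r : Γ(X, π ⁻¹ᵁ W)) • pullbackSection π M W b :=
  Scheme.Modules.Hom.app_smul ((Scheme.Modules.pullbackPushforwardAdjunction π).unit.app M) r b

theorem pullbackSection_sum {ι : Type*} (s : Finset ι) (W : Y.Opens) (b : ι → Γ(M, W)) :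
    pullbackSection π M W (∑ i ∈ s, b i) = ∑ i ∈ s, pullbackSection π M W (b i) :=
  map_sum (((Scheme.Modules.pullbackPushforwardAdjunction π).unit.app M).app W).hom b s

theorem pullbackSection_map {W W' : Y.Opens} (i : W' ⟶ W) (b : Γ(M, W)) :
    pullbackSection π M W' (M.presheaf.map i.op b) =
      ((Scheme.Modules.pullback π).obj M).presheaf.map ((Opens.map π.base).map i).op
        (pullbackSection π M W b) :=
  Modules.app_map ((Scheme.Modules.pullbackPushforwardAdjunction π).unit.app M) i b

/-- The set of sections over `V` that are restrictions of pulled back sections. -/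
def pulledBack (V : X.Opens) : Set Γ((Scheme.Modules.pullback π).obj M, V) :=
  { m | ∃ (W : Y.Opens) (i : V ⟶ π ⁻¹ᵁ W) (b : Γ(M, W)),
    m = ((Scheme.Modules.pullback π).obj M).presheaf.map i.op (pullbackSection π M W b) }

theorem map_mem_span_pulledBack {U V : X.Opens} (i : V ⟶ U)
    (m : Γ((Scheme.Modules.pullback π).obj M, U))
    (hm : m ∈ Submodule.span Γ(X, U) (pulledBack π M U)) :
    ((Scheme.Modules.pullback π).obj M).presheaf.map i.op m ∈
      Submodule.span Γ(X, V) (pulledBack π M V) := by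
  induction hm using Submodule.span_induction with
  | mem m hm =>
    obtain ⟨W, j, b, rfl⟩ := hm
    exact Submodule.subset_span ⟨W, i ≫ j, b, Modules.map_map _ _ _ _⟩
  | zero => rw [map_zero]; exact zero_mem _
  | add a b _ _ ha hb => rw [map_add]; exact add_mem ha hb
  | smul r a _ ha => rw [Scheme.Modules.map_smul]; exact Submodule.smul_mem _ _ ha

/-- The submodule of the pullback generated locally by pulled back sections. -/
def pulledBackSubmodule : ((Scheme.Modules.pullback π).obj M).val.Submodule :=
  mkSubmodule ((Scheme.Modules.pullback π).obj M)
    (fun U ↦ { m | ∀ x ∈ U, ∃ (V : X.Opens) (i : V ⟶ U), x ∈ V ∧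
      ((Scheme.Modules.pullback π).obj M).presheaf.map i.op m ∈
        Submodule.span Γ(X, V) (pulledBack π M V) })
    (fun U _ hx ↦ ⟨U, 𝟙 _, hx, by rw [map_zero]; exact zero_mem _⟩)
    (fun U a b ha hb x hx ↦ by
      obtain ⟨V, i, hxV, hn⟩ := ha x hx
      obtain ⟨V', i', hxV', hn'⟩ := hb x hx
      refine ⟨V ⊓ V', homOfLE (inf_le_left.trans i.le), ⟨hxV, hxV'⟩, ?_⟩
      rw [map_add]
      refine add_mem ?_ ?_
      · rw [Subsingleton.elim (homOfLE (inf_le_left.trans i.le)) (homOfLE inf_le_left ≫ i),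
          ← Modules.map_map]
        exact map_mem_span_pulledBack _ _ _ _ hn
      · rw [Subsingleton.elim (homOfLE (inf_le_left.trans i.le)) (homOfLE inf_le_right ≫ i'),
          ← Modules.map_map]
        exact map_mem_span_pulledBack _ _ _ _ hn')
    (fun U r a ha x hx ↦ by
      obtain ⟨V, i, hxV, hn⟩ := ha x hx
      refine ⟨V, i, hxV, ?_⟩
      rw [Scheme.Modules.map_smul]
      exact Submodule.smul_mem _ _ hn)
    (fun U V f m hm x hx ↦ by
      obtain ⟨W, i, hxW, hn⟩ := hm x (f.le hx)
      refine ⟨W ⊓ V, homOfLE inf_le_right, ⟨hxW, hx⟩, ?_⟩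
      rw [Modules.map_map, Subsingleton.elim (homOfLE inf_le_right ≫ f)
        (homOfLE inf_le_left ≫ i), ← Modules.map_map]
      exact map_mem_span_pulledBack _ _ _ _ hn)

theorem isLocalSubmodule_pulledBackSubmodule :
    IsLocalSubmodule _ (pulledBackSubmodule π M) := by
  intro U m h x hx
  obtain ⟨V, i, hxV, hV⟩ := h x hx
  obtain ⟨W, j, hxW, hn⟩ := hV x hxV
  exact ⟨W, j ≫ i, hxW, by rwa [← Modules.map_map]⟩

theorem pullbackSection_mem (W : Y.Opens) (b : Γ(M, W)) :
    pullbackSection π M W b ∈ (pulledBackSubmodule π M).obj (op (π ⁻¹ᵁ W)) := fun _ hx ↦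
  ⟨π ⁻¹ᵁ W, 𝟙 _, hx, Submodule.subset_span ⟨W, 𝟙 _, b, rfl⟩⟩

/-- The unit of the adjunction factors through the submodule generated by pulled back sections. -/
def toPulledBack : M ⟶ (Scheme.Modules.pushforward π).obj
    (subsheaf _ (isLocalSubmodule_pulledBackSubmodule π M)) where
  val := PresheafOfModules.homMk
    { app U := AddCommGrpCat.ofHom
        { toFun m := ⟨pullbackSection π M U.unop m, pullbackSection_mem π M U.unop m⟩
          map_zero' := Subtype.ext (pullbackSection_zero π M _)
          map_add' _ _ := Subtype.ext (pullbackSection_add π M _ _ _) }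
      naturality U V i := by
        ext m
        exact Subtype.ext (pullbackSection_map π M i.unop m) }
    (fun U r m ↦ Subtype.ext (pullbackSection_smul π M U.unop r m))

/-- The pullback of a module is locally generated by pulled back sections. -/
theorem exists_map_mem_span_pulledBack (U : X.Opens) (m : Γ((Scheme.Modules.pullback π).obj M, U))
    (x : X) (hx : x ∈ U) : ∃ (V : X.Opens) (i : V ⟶ U), x ∈ V ∧
      ((Scheme.Modules.pullback π).obj M).presheaf.map i.op m ∈
        Submodule.span Γ(X, V) (pulledBack π M V) := by
  let adj := Scheme.Modules.pullbackPushforwardAdjunction π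
  let ι := subsheafι _ (isLocalSubmodule_pulledBackSubmodule π M)
  -- The unit factors through the submodule generated by pulled back sections, so by adjunction the
  -- inclusion of this submodule has a section; every element therefore lies in it.
  have h : (adj.homEquiv _ _).symm (toPulledBack π M) ≫ ι = 𝟙 _ := by
    apply (adj.homEquiv _ _).injective
    rw [Adjunction.homEquiv_naturality_right, Equiv.apply_symm_apply, Adjunction.homEquiv_id]
    rfl
  have h2 := subsheafι_mem _ (isLocalSubmodule_pulledBackSubmodule π M) U
    (((adj.homEquiv _ _).symm (toPulledBack π M)).app U m)
  rw [← Modules.comp_app_apply] at h2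
  erw [h] at h2
  exact h2 x hx

/-- If a module is generated near `π x` by finitely many sections `g i`, then its pullback is
generated near `x` by the pullbacks of these. -/
theorem exists_map_eq_sum {n : ℕ} (W : Y.Opens) (g : Fin n → Γ(M, W)) (x : X) (hxW : π x ∈ W)
    (hg : ∀ (W' : Y.Opens) (b : Γ(M, W')), π x ∈ W' → ∃ (W'' : Y.Opens) (i : W'' ⟶ W)
      (j : W'' ⟶ W') (c : Fin n → Γ(Y, W'')), π x ∈ W'' ∧
        M.presheaf.map j.op b = ∑ l, c l • M.presheaf.map i.op (g l))
    (U : X.Opens) (m : Γ((Scheme.Modules.pullback π).obj M, U)) (hx : x ∈ U) :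
    ∃ (V : X.Opens) (i : V ⟶ U) (j : V ⟶ π ⁻¹ᵁ W) (c : Fin n → Γ(X, V)), x ∈ V ∧
      ((Scheme.Modules.pullback π).obj M).presheaf.map i.op m = ∑ l, c l •
        ((Scheme.Modules.pullback π).obj M).presheaf.map j.op (pullbackSection π M W (g l)) := by
  obtain ⟨V, i, hxV, hm⟩ := exists_map_mem_span_pulledBack π M U m x hx
  suffices ∀ m' ∈ Submodule.span Γ(X, V) (pulledBack π M V),
      ∃ (V' : X.Opens) (i : V' ⟶ V) (j : V' ⟶ π ⁻¹ᵁ W) (c : Fin n → Γ(X, V')), x ∈ V' ∧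
      ((Scheme.Modules.pullback π).obj M).presheaf.map i.op m' = ∑ l, c l •
        ((Scheme.Modules.pullback π).obj M).presheaf.map j.op (pullbackSection π M W (g l)) by
    obtain ⟨V', i', j, c, hxV', e⟩ := this _ hm
    exact ⟨V', i' ≫ i, j, c, hxV', by rw [← Modules.map_map, e]⟩
  intro m' hm'
  induction hm' using Submodule.span_induction with
  | mem m hm =>
    obtain ⟨W', j, b, rfl⟩ := hm
    obtain ⟨W'', i', j', c, hxW'', e⟩ := hg W' b (j.le hxV)
    have h := congr_arg (pullbackSection π M W'') e
    rw [pullbackSection_map, pullbackSection_sum] at h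
    refine ⟨V ⊓ π ⁻¹ᵁ W'', homOfLE inf_le_left, homOfLE inf_le_right ≫ (Opens.map π.base).map i',
      fun l ↦ X.presheaf.map (homOfLE inf_le_right).op (π.app W'' (c l)), ⟨hxV, hxW''⟩, ?_⟩
    rw [Modules.map_map, Subsingleton.elim (homOfLE inf_le_left ≫ j)
      (homOfLE inf_le_right ≫ (Opens.map π.base).map j'), ← Modules.map_map, h, map_sum]
    refine Finset.sum_congr rfl fun l _ ↦ ?_
    rw [pullbackSection_smul, Scheme.Modules.map_smul, pullbackSection_map, Modules.map_map]
  | zero =>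
    refine ⟨V ⊓ π ⁻¹ᵁ W, homOfLE inf_le_left, homOfLE inf_le_right, 0, ⟨hxV, hxW⟩, ?_⟩
    simp
  | add a b _ _ ha hb =>
    obtain ⟨V₁, i₁, j₁, c₁, hx₁, e₁⟩ := ha
    obtain ⟨V₂, i₂, j₂, c₂, hx₂, e₂⟩ := hb
    refine ⟨V₁ ⊓ V₂, homOfLE inf_le_left ≫ i₁, homOfLE inf_le_left ≫ j₁,
      fun l ↦ X.presheaf.map (homOfLE inf_le_left).op (c₁ l) +
        X.presheaf.map (homOfLE inf_le_right).op (c₂ l), ⟨hx₁, hx₂⟩, ?_⟩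
    rw [map_add]
    nth_rw 2 [Subsingleton.elim (homOfLE inf_le_left ≫ i₁) (homOfLE inf_le_right ≫ i₂)]
    rw [← Modules.map_map, ← Modules.map_map, e₁, e₂, map_sum, map_sum, ← Finset.sum_add_distrib]
    refine Finset.sum_congr rfl fun l _ ↦ ?_
    rw [Scheme.Modules.map_smul, Scheme.Modules.map_smul, add_smul, Modules.map_map,
      Modules.map_map]
    rfl
  | smul r a _ ha =>
    obtain ⟨V₁, i₁, j₁, c₁, hx₁, e₁⟩ := ha
    refine ⟨V₁, i₁, j₁, fun l ↦ X.presheaf.map i₁.op r * c₁ l, hx₁, ?_⟩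
    rw [Scheme.Modules.map_smul, e₁, Finset.smul_sum]
    simp_rw [mul_smul]

end Pullback

/-! ### Functions killed by the universal derivation of the sheaf of differentials -/

section Kernel

variable (f : X ⟶ Y)

/-- Morphisms out of the sections of the inverse image presheaf are determined by their
compositions with the pulled back sections. -/
theorem inverseImage_hom_ext {V : X.Opens} {T : CommRingCat.{u}}
    (a b : ((TopCat.Presheaf.pullback CommRingCat.{u} f.base).obj Y.presheaf).obj (op V) ⟶ T)
    (h : ∀ (W : Y.Opens) (i : V ⟶ f ⁻¹ᵁ W),
      ((TopCat.Presheaf.pullbackPushforwardAdjunction CommRingCat.{u} f.base).unit.app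
        Y.presheaf).app (op W) ≫
        ((TopCat.Presheaf.pullback CommRingCat.{u} f.base).obj Y.presheaf).map i.op ≫ a =
      ((TopCat.Presheaf.pullbackPushforwardAdjunction CommRingCat.{u} f.base).unit.app
        Y.presheaf).app (op W) ≫
        ((TopCat.Presheaf.pullback CommRingCat.{u} f.base).obj Y.presheaf).map i.op ≫ b) :
    a = b := by
  -- The inverse image presheaf is a pointwise left Kan extension: its sections over `V` are a
  -- colimit over the opens `W` with `V ≤ f ⁻¹ᵁ W`.
  refine ((Opens.map f.base).op.isPointwiseLeftKanExtensionLeftKanExtensionUnit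
    Y.presheaf (op V)).hom_ext fun j ↦ ?_
  have := h j.left.unop j.hom.unop
  erw [← Category.assoc, ← Category.assoc] at this
  exact this

theorem unit_inverseImageHom {V : X.Opens} (W : Y.Opens) (i : V ⟶ f ⁻¹ᵁ W) :
    ((TopCat.Presheaf.pullbackPushforwardAdjunction CommRingCat.{u} f.base).unit.app
      Y.presheaf).app (op W) ≫
      ((TopCat.Presheaf.pullback CommRingCat.{u} f.base).obj Y.presheaf).map i.op ≫
        (inverseImageHom f).app (op V) = f.appLE W V i.le := by
  let adj := TopCat.Presheaf.pullbackPushforwardAdjunction CommRingCat.{u} f.base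
  have h : adj.unit.app Y.presheaf ≫ (TopCat.Presheaf.pushforward _ f.base).map
      (inverseImageHom f) = f.c := by
    refine (adj.homEquiv_unit _ _ _).symm.trans ?_
    exact (adj.homEquiv _ _).apply_symm_apply f.c
  have h2 : (adj.unit.app Y.presheaf).app (op W) ≫ (inverseImageHom f).app (op (f ⁻¹ᵁ W)) =
    f.app W := NatTrans.congr_app h (op W)
  rw [(inverseImageHom f).naturality i.op, ← Category.assoc]
  erw [h2]
  rfl

/-- A derivation on the sections over `V` that kills all functions coming from `Y` kills the
functions that are killed by the universal derivation of the presheaf of differentials. -/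
theorem eq_zero_of_presheaf_d_eq_zero {V : X.Opens} (M : ModuleCat.{u} Γ(X, V))
    (D : Γ(X, V) →+ M) (hD : ∀ a b, D (a * b) = a • D b + b • D a)
    (hDf : ∀ (W : Y.Opens) (e : V ≤ f ⁻¹ᵁ W) (b : Γ(Y, W)), D (f.appLE W V e b) = 0)
    (r : Γ(X, V)) (h : CommRingCat.KaehlerDifferential.d
      (f := (inverseImageHom f).app (op V)) r = 0) : D r = 0 := by
  -- A colimit is tested by ring homomorphisms, not derivations, so `D` is replaced by two
  -- homomorphisms into the square-zero extension whose equalizer is its kernel.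
  obtain ⟨T, i, j, hij⟩ := exists_ringHom D hD
  have e : (inverseImageHom f).app (op V) ≫ i = (inverseImageHom f).app (op V) ≫ j := by
    refine inverseImage_hom_ext f _ _ fun W l ↦ ?_
    have h := unit_inverseImageHom f W l
    have h' : f.appLE W V l.le ≫ i = f.appLE W V l.le ≫ j := by
      ext b
      exact (hij _).mpr (hDf W l.le b)
    rw [← h] at h'
    simpa only [Category.assoc] using h'
  let D' : M.Derivation ((inverseImageHom f).app (op V)) := ModuleCat.Derivation.mk D
    (map_add D) hD (fun a ↦ (hij _).mp (ConcreteCategory.congr_hom e a))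
  have h2 : D'.d r = 0 := by
    rw [← ModuleCat.Derivation.desc_d, h, map_zero]
  exact h2

/-- The map from a presheaf to its sheafification is locally injective, so a differential that
vanishes in the sheaf already vanishes in the presheaf after shrinking. -/
theorem presheaf_d_eq_zero (U : X.Opens) (r : Γ(X, U)) (h : d f U r = 0) (x : X) (hx : x ∈ U) :
    ∃ (V : X.Opens) (i : V ⟶ U), x ∈ V ∧ CommRingCat.KaehlerDifferential.d
      (f := (inverseImageHom f).app (op V)) (X.presheaf.map i.op r) = 0 := by
  have inj : Presheaf.IsLocallyInjective (Opens.grothendieckTopology X)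
    ((PresheafOfModules.toPresheaf _).map (toDifferentials f)) :=
    inferInstanceAs (Presheaf.IsLocallyInjective (Opens.grothendieckTopology X)
      (CategoryTheory.toSheafify _ (differentialsPresheaf f).presheaf))
  let m : (differentialsPresheaf f).presheaf.obj (op U) :=
    CommRingCat.KaehlerDifferential.d (f := (inverseImageHom f).app (op U)) r
  have h0 : ((PresheafOfModules.toPresheaf _).map (toDifferentials f)).app (op U) m =
      ((PresheafOfModules.toPresheaf _).map (toDifferentials f)).app (op U) 0 :=
    h.trans (map_zero _).symm
  obtain ⟨V, i, hi, hxV⟩ := inj.equalizerSieve_mem m 0 h0 x hx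
  refine ⟨V, i, hxV, ?_⟩
  have h3 : (differentialsPresheaf f).presheaf.map i.op m =
      (differentialsPresheaf f).presheaf.map i.op 0 := hi
  rw [map_zero] at h3
  exact (PresheafOfModules.DifferentialsConstruction.relativeDifferentials'_map_d
    (inverseImageHom f) i.op r).symm.trans h3

/-- If a function is killed by the derivation of the structure sheaf, then its germ is killed by
every derivation of the stalk that kills the functions coming from `Y`. -/
theorem stalk_derivation_eq_zero (U : X.Opens) (r : Γ(X, U)) (h : d f U r = 0) (x : X)
    (hx : x ∈ U) {M : Type u} [AddCommGroup M] [Module (X.presheaf.stalk x) M]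
    (D : X.presheaf.stalk x →+ M) (hD : ∀ a b, D (a * b) = a • D b + b • D a)
    (hDf : ∀ a, D (f.stalkMap x a) = 0) : D (X.presheaf.germ U x hx r) = 0 := by
  obtain ⟨V, i, hxV, hV⟩ := presheaf_d_eq_zero f U r h x hx
  let M' := (ModuleCat.restrictScalars (X.presheaf.germ V x hxV).hom).obj
    (ModuleCat.of (X.presheaf.stalk x) M)
  let D' : Γ(X, V) →+ M' := D.comp (X.presheaf.germ V x hxV).hom.toAddMonoidHom
  have := eq_zero_of_presheaf_d_eq_zero f M' D' ?_ ?_ _ hV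
  · rw [← X.presheaf.germ_res_apply i x hxV]
    exact this
  · intro a b
    exact (congrArg D (map_mul (X.presheaf.germ V x hxV).hom a b)).trans (hD _ _)
  · intro W e b
    have h1 : X.presheaf.germ V x hxV (f.appLE W V e b) =
        f.stalkMap x (Y.presheaf.germ W (f x) (e hxV) b) := by
      refine Eq.trans ?_ (Scheme.Hom.germ_stalkMap_apply f W x (e hxV) b).symm
      exact X.presheaf.germ_res_apply (homOfLE e) x hxV (f.app W b)
    exact (congrArg D h1).trans (hDf _)

end Kernel

end
end LocallyExact

namespace LocallyExact
noncomputable section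

/-! ### Generation over `p`-th powers and polynomials over constants of a derivation -/

section Algebra

open TensorProduct

/-- A finite unramified homomorphism whose image contains all `p`-th powers is surjective. -/
theorem surjective_of_formallyUnramified (p : ℕ) (hp : p.Prime) {A R : Type*} [CommRing A]
    [CommRing R] [Algebra A R] [Module.Finite A R] [Algebra.FormallyUnramified A R]
    (hpR : (p : R) = 0) (hpow : ∀ r : R, ∃ a : A, algebraMap A R a = r ^ p) :
    Function.Surjective (algebraMap A R) := by
  obtain ⟨t, ht, ht1⟩ := (Algebra.FormallyUnramified.iff_exists_tensorProduct (R := A)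
    (S := R)).mp inferInstance
  have hpT : (p : R ⊗[A] R) = 0 := by
    have := map_natCast (algebraMap R (R ⊗[A] R)) p
    rw [← this, hpR, map_zero]
  -- On a pure tensor `a ⊗ b` the factor `b ^ p` comes from `A` and moves to the left; Frobenius is
  -- additive, so the formula extends to all tensors.
  have key : ∀ z : R ⊗[A] R, z ^ p = ((Algebra.TensorProduct.lmul' A z) ^ p) ⊗ₜ 1 := by
    intro z
    induction z with
    | zero => simp [hp.ne_zero]
    | tmul a b =>
      obtain ⟨b', hb'⟩ := hpow b
      rw [Algebra.TensorProduct.tmul_pow, Algebra.TensorProduct.lmul'_apply_tmul, mul_pow, ← hb',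
        Algebra.algebraMap_eq_smul_one, TensorProduct.tmul_smul, mul_smul_comm, mul_one,
        TensorProduct.smul_tmul']
    | add a b ha hb =>
      obtain ⟨r, hr⟩ := exists_add_pow_prime_eq hp a b
      rw [map_add]
      obtain ⟨s, hs⟩ := exists_add_pow_prime_eq hp (Algebra.TensorProduct.lmul' A a)
        (Algebra.TensorProduct.lmul' A b)
      rw [hr, hs, hpR, hpT, ha, hb]
      simp only [zero_mul, add_zero, TensorProduct.add_tmul]
  -- The element `t` witnessing unramifiedness has product `1`, so `(1 - t) ^ p = 0` by `key` and
  -- `t` is a unit. Since `t` annihilates the differences of `r ⊗ 1` and `1 ⊗ r`, the map is an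
  -- epimorphism of rings, and finite epimorphisms are surjective.
  have hu : IsUnit t := by
    have : IsNilpotent (1 - t) := ⟨p, by
      rw [key, map_sub, map_one, ht1, sub_self, zero_pow hp.ne_zero, TensorProduct.zero_tmul]⟩
    simpa using this.isUnit_one_sub
  have : Algebra.IsEpi A R := by
    rw [Algebra.isEpi_iff_forall_one_tmul_eq]
    intro r
    exact sub_eq_zero.mp (hu.mul_left_eq_zero.mp (ht r))
  exact Algebra.isEpi_iff_surjective_algebraMap_of_finite.mp this

/-- If `dx`, `x ∈ s`, generate the differentials, then `R` is generated by `s` over `R^p`. -/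
theorem closure_pow_union_eq_top (p : ℕ) (hp : p.Prime) {k R : Type*} [Field k]
    [CommRing R] [Algebra k R] [Algebra.EssFiniteType k R] (hpR : (p : R) = 0)
    (hk : ∀ a : k, ∃ b, b ^ p = a) (s : Set R)
    (hs : Submodule.span R (KaehlerDifferential.D k R '' s) = ⊤) :
    Subring.closure (Set.range (fun r : R ↦ r ^ p) ∪ s) = ⊤ := by
  set A := Subring.closure (Set.range (fun r : R ↦ r ^ p) ∪ s) with hA
  have hpow : ∀ r : R, r ^ p ∈ A := fun r ↦ Subring.subset_closure (Or.inl ⟨r, rfl⟩)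
  have hkA : ∀ a : k, algebraMap k R a ∈ A := fun a ↦ by
    obtain ⟨b, rfl⟩ := hk a
    rw [map_pow]
    exact hpow _
  let _ : Algebra k A := ((algebraMap k R).codRestrict A hkA).toAlgebra
  have _ : IsScalarTower k A R := IsScalarTower.of_algebraMap_eq fun _ ↦ rfl
  have hint : Algebra.IsIntegral A R := ⟨fun r ↦
    IsIntegral.of_pow hp.pos (isIntegral_algebraMap (x := (⟨r ^ p, hpow r⟩ : A)))⟩
  have hft : Algebra.FiniteType A R := by
    refine ⟨⟨Algebra.EssFiniteType.finset k R, eq_top_iff.mpr fun r _ ↦ ?_⟩⟩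
    set T := Algebra.adjoin A (Algebra.EssFiniteType.finset k R : Set R) with hT
    have h1 : Algebra.EssFiniteType.subalgebra k R ≤ T.restrictScalars k :=
      Algebra.adjoin_le Algebra.subset_adjoin
    obtain ⟨⟨g, m⟩, h⟩ := IsLocalization.surj (Algebra.EssFiniteType.submonoid k R) r
    have hm : IsUnit (m : Algebra.EssFiniteType.subalgebra k R).1 :=
      IsLocalization.map_units R m
    obtain ⟨w, hw⟩ := hm.exists_right_inv
    -- Denominators cost nothing: `g / m = g m ^ (p - 1) (1 / m) ^ p`, and the last factor lies in
    -- `A`.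
    have e : r = g.1 * m.1.1 ^ (p - 1) * w ^ p := by
      have h' : r * m.1.1 = g.1 := h
      rw [← h', mul_assoc r, ← pow_succ', Nat.sub_add_cancel hp.one_le, mul_assoc, ← mul_pow, hw,
        one_pow, mul_one]
    rw [e]
    exact mul_mem (mul_mem (h1 g.2) (pow_mem (h1 m.1.2) _))
      (T.algebraMap_mem (⟨w ^ p, hpow w⟩ : A))
  have hfin : Module.Finite A R := Algebra.IsIntegral.finite
  have hunr : Algebra.FormallyUnramified A R := by
    rw [Algebra.formallyUnramified_iff, ← not_nontrivial_iff_subsingleton]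
    -- The map from differentials over `k` to differentials over `A` kills the generators `dx`,
    -- because `s` is contained in `A`.
    have h0 : ∀ r : R, KaehlerDifferential.D A R r = 0 := by
      intro r
      let φ := ((KaehlerDifferential.D A R).restrictScalars k).liftKaehlerDifferential
      have h : φ = 0 := by
        rw [← LinearMap.ker_eq_top, eq_top_iff, ← hs, Submodule.span_le]
        rintro _ ⟨x, hx, rfl⟩
        refine (Derivation.liftKaehlerDifferential_comp_D _ x).trans ?_
        exact (KaehlerDifferential.D A R).map_algebraMap ⟨x, Subring.subset_closure (Or.inr hx)⟩
      rw [← show φ (KaehlerDifferential.D k R r) = KaehlerDifferential.D A R r from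
        Derivation.liftKaehlerDifferential_comp_D _ r, h, LinearMap.zero_apply]
    rw [not_nontrivial_iff_subsingleton, ← Submodule.subsingleton_iff R,
      ← subsingleton_iff_bot_eq_top, ← KaehlerDifferential.span_range_derivation, eq_comm, Submodule.span_eq_bot]
    rintro _ ⟨r, rfl⟩
    exact h0 r
  have hsurj := surjective_of_formallyUnramified p hp (A := A) (R := R) hpR
    fun r ↦ ⟨⟨r ^ p, hpow r⟩, rfl⟩
  rw [eq_top_iff]
  intro r _
  obtain ⟨a, rfl⟩ := hsurj r
  exact a.2

/-- An element of `A[y]` with `y ^ p ∈ A` is a polynomial in `y` of degree less than `p`. -/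
theorem exists_eq_sum_of_mem_closure {p : ℕ} (hp : p ≠ 0) {R : Type*} [CommRing R] (A : Subring R)
    (y : R) (hy : y ^ p ∈ A) (r : R) (hr : r ∈ Subring.closure (A ∪ {y})) :
    ∃ c : ℕ → R, (∀ i, c i ∈ A) ∧ r = ∑ i ∈ Finset.range p, c i * y ^ i := by
  nontriviality R
  have h1 : r ∈ (Polynomial.aeval (R := A) y).range := by
    have : Subring.closure (A ∪ {y}) ≤ (Polynomial.aeval (R := A) y).range.toSubring := by
      rw [Subring.closure_le, Set.union_subset_iff, Set.singleton_subset_iff]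
      exact ⟨fun a ha ↦ ⟨Polynomial.C ⟨a, ha⟩, Polynomial.aeval_C _ _⟩, ⟨Polynomial.X, by simp⟩⟩
    exact this hr
  obtain ⟨f, rfl⟩ := h1
  -- Division by the monic polynomial `X ^ p - y ^ p`, which vanishes at `y`, lowers the degree
  -- below `p`.
  let q : Polynomial A := Polynomial.X ^ p - Polynomial.C ⟨y ^ p, hy⟩
  have hq : q.Monic := Polynomial.monic_X_pow_sub_C _ hp
  have hq0 : Polynomial.aeval y q = 0 := by
    rw [map_sub, map_pow, Polynomial.aeval_X, Polynomial.aeval_C]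
    exact sub_self _
  have hdeg : (f %ₘ q).natDegree < p := by
    have := Polynomial.natDegree_modByMonic_lt f hq (by
      intro h
      have := congr_arg Polynomial.natDegree h
      rw [Polynomial.natDegree_X_pow_sub_C, Polynomial.natDegree_one] at this
      exact hp this)
    rwa [Polynomial.natDegree_X_pow_sub_C] at this
  refine ⟨fun i ↦ (f %ₘ q).coeff i, fun i ↦ ((f %ₘ q).coeff i).2, ?_⟩
  have e : Polynomial.aeval y f = Polynomial.aeval y (f %ₘ q) := by
    conv_lhs => rw [← Polynomial.modByMonic_add_div f q]
    rw [map_add, map_mul, hq0, zero_mul, add_zero]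
  refine e.trans ?_
  rw [Polynomial.aeval_eq_sum_range' hdeg]
  rfl

variable {p : ℕ} {k R : Type*} [Field k] [CommRing R] [Algebra k R] [CharP R p]

theorem derivation_pow_eq_zero {M : Type*} [AddCommGroup M] [Module R M] [Module k M]
    (D : Derivation k R M) (r : R) : D (r ^ p) = 0 := by
  rw [Derivation.leibniz_pow, ← Nat.cast_smul_eq_nsmul R, CharP.cast_eq_zero, zero_smul]

variable [hp : Fact p.Prime]

theorem isUnit_natCast_of_lt {i : ℕ} (h0 : i ≠ 0) (hi : i < p) : IsUnit (i : R) :=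
  (CharP.isUnit_natCast_iff hp.out).mpr fun h ↦ absurd (Nat.le_of_dvd (Nat.pos_of_ne_zero h0) h)
    (not_le.mpr hi)

theorem derivation_sum (D : Derivation k R R) (y : R) (c : ℕ → R) (hc : ∀ i, D (c i) = 0)
    (n : ℕ) : D (∑ i ∈ Finset.range (n + 1), c i * y ^ i) =
      (∑ i ∈ Finset.range n, ((i + 1 : ℕ) : R) * c (i + 1) * y ^ i) * D y := by
  rw [map_sum, Finset.sum_range_succ', Finset.sum_mul]
  simp only [pow_zero, mul_one, hc, add_zero]
  refine Finset.sum_congr rfl fun i _ ↦ ?_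
  rw [Derivation.leibniz, hc, smul_zero, add_zero, Derivation.leibniz_pow]
  simp only [add_tsub_cancel_right, smul_eq_mul, nsmul_eq_mul]
  ring

theorem derivation_natCast_mul_eq_zero (D : Derivation k R R) {c : R} (hc : D c = 0) (n : ℕ) :
    D ((n : R) * c) = 0 := by
  rw [Derivation.leibniz, hc, Derivation.map_natCast, smul_zero, smul_zero, add_zero]

/-- Applying `D` to a relation among powers of `y` over the constants gives, after cancelling `D y`,
a relation of smaller length with coefficients `(i + 1) c (i + 1)`. The integers involved are
invertible because `n ≤ p`. -/
theorem coeff_eq_zero_of_sum_eq_zero [IsDomain R] (D : Derivation k R R) (y : R) (hy : D y ≠ 0)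
    (n : ℕ) (hn : n ≤ p) (c : ℕ → R) (hc : ∀ i, D (c i) = 0)
    (h : ∑ i ∈ Finset.range n, c i * y ^ i = 0) : ∀ i < n, c i = 0 := by
  induction n generalizing c with
  | zero => simp
  | succ n ih =>
    have h1 := derivation_sum D y c hc n
    rw [h, map_zero, eq_comm, mul_eq_zero, or_iff_left hy] at h1
    have h2 := ih (by omega) (fun i ↦ ((i + 1 : ℕ) : R) * c (i + 1))
      (fun i ↦ derivation_natCast_mul_eq_zero D (hc _) _) h1
    have h3 : ∀ i < n, c (i + 1) = 0 := fun i hi ↦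
      (isUnit_natCast_of_lt (p := p) (R := R) (Nat.succ_ne_zero i)
        (by omega)).mul_right_eq_zero.mp (h2 i hi)
    intro i hi
    rcases i with _ | i
    · rw [Finset.sum_range_succ', Finset.sum_eq_zero] at h
      · simpa using h
      · intro j hj
        rw [h3 j (Finset.mem_range.mp hj), zero_mul]
    · exact h3 i (by omega)

/-- The coefficients of a polynomial of degree less than `p` that is killed by a derivation. -/
theorem coeff_eq_zero_of_derivation_sum_eq_zero [IsDomain R] (D : Derivation k R R) (y : R)
    (hy : D y ≠ 0) (c : ℕ → R) (hc : ∀ i, D (c i) = 0)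
    (h : D (∑ i ∈ Finset.range p, c i * y ^ i) = 0) : ∀ i < p, i ≠ 0 → c i = 0 := by
  obtain ⟨n, rfl⟩ : ∃ n, p = n + 1 := Nat.exists_eq_succ_of_ne_zero hp.out.ne_zero
  rw [derivation_sum D y c hc n, mul_eq_zero, or_iff_left hy] at h
  have h2 := coeff_eq_zero_of_sum_eq_zero (p := n + 1) D y hy n (by omega)
    (fun i ↦ ((i + 1 : ℕ) : R) * c (i + 1)) (fun i ↦ derivation_natCast_mul_eq_zero D (hc _) _) h
  intro i hi h0
  obtain ⟨j, rfl⟩ := Nat.exists_eq_succ_of_ne_zero h0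
  exact (isUnit_natCast_of_lt (p := n + 1) (R := R) (Nat.succ_ne_zero j)
    (by omega)).mul_right_eq_zero.mp (h2 j (by omega))

theorem sum_eq_of_derivation_sum_eq_zero [IsDomain R] (D : Derivation k R R) (y : R)
    (hy : D y ≠ 0) (c : ℕ → R) (hc : ∀ i, D (c i) = 0)
    (h : D (∑ i ∈ Finset.range p, c i * y ^ i) = 0) :
    ∑ i ∈ Finset.range p, c i * y ^ i = c 0 := by
  rw [Finset.sum_eq_single 0]
  · simp
  · intro i hi h0
    rw [coeff_eq_zero_of_derivation_sum_eq_zero D y hy c hc h i (Finset.mem_range.mp hi) h0,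
      zero_mul]
  · intro h0
    exact absurd (Finset.mem_range.mpr hp.out.pos) h0

end Algebra

end
end LocallyExact

namespace LocallyExact
noncomputable section

/-! ### Local coordinates, `p`-th powers and the maximal ideal -/

section LocalAlgebra

open IsLocalRing

/-- Local coordinates `x i` of a `k`-algebra `B` at its maximal ideal, with dual derivations
`∂ i`. -/
structure IsCoordinates (k : Type*) {B : Type*} [Field k] [CommRing B] [Algebra k B]
    [IsLocalRing B] {n : ℕ} (x : Fin n → B) (D : Fin n → Derivation k B B) : Prop where
  mem : ∀ i, x i ∈ maximalIdeal B
  apply_same : ∀ i, D i (x i) = 1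
  apply_ne : ∀ i j, i ≠ j → D i (x j) = 0
  span : Submodule.span B (KaehlerDifferential.D k B '' Set.range x) = ⊤

variable (p : ℕ) [hp : Fact p.Prime] {k B : Type*} [Field k] [CommRing B] [Algebra k B]
  [IsLocalRing B] [CharP B p] {n : ℕ} {x : Fin n → B} {D : Fin n → Derivation k B B}

-- The differentials of the coordinates generate, and pairing with the dual derivations reads off
-- the coefficients.
omit [CharP B p] in
theorem IsCoordinates.D_eq_sum (h : IsCoordinates k x D) (b : B) :
    KaehlerDifferential.D k B b = ∑ i, D i b • KaehlerDifferential.D k B (x i) := by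
  have hb : KaehlerDifferential.D k B b ∈
    Submodule.span B (Set.range fun i ↦ KaehlerDifferential.D k B (x i)) := by
    rw [Set.range_comp' (KaehlerDifferential.D k B) x, h.span]
    trivial
  obtain ⟨c, hc⟩ := (Submodule.mem_span_range_iff_exists_fun B).mp hb
  have e : ∀ i, D i b = c i := by
    intro i
    rw [← (D i).liftKaehlerDifferential_comp_D b, ← hc, map_sum, Finset.sum_eq_single i]
    · rw [map_smul, (D i).liftKaehlerDifferential_comp_D, h.apply_same, smul_eq_mul, mul_one]
    · intro j _ hj
      rw [map_smul, (D i).liftKaehlerDifferential_comp_D, h.apply_ne _ _ hj.symm, smul_zero]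
    · simp
  simp_rw [e, hc]

theorem IsCoordinates.closure_eq_top [Algebra.EssFiniteType k B] [IsAlgClosed k]
    (h : IsCoordinates k x D) :
    Subring.closure (Set.range (fun r : B ↦ r ^ p) ∪ Set.range x) = ⊤ :=
  closure_pow_union_eq_top p hp.out (CharP.cast_eq_zero B p)
    (fun a ↦ IsAlgClosed.exists_pow_nat_eq a hp.out.pos) _ h.span

variable (B) in
/-- The subring of `p`-th powers. -/
abbrev powSubring : Subring B := (frobenius B p).range

omit [IsLocalRing B] in
theorem mem_powSubring {b : B} : b ∈ powSubring p B ↔ ∃ c, b = c ^ p :=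
  ⟨fun ⟨c, hc⟩ ↦ ⟨c, hc.symm⟩, fun ⟨c, hc⟩ ↦ ⟨c, hc.symm⟩⟩

omit [IsLocalRing B] in
theorem derivation_eq_zero_of_mem_powSubring (D : Derivation k B B) {b : B}
    (hb : b ∈ powSubring p B) : D b = 0 := by
  obtain ⟨c, rfl⟩ := (mem_powSubring p).mp hb
  exact derivation_pow_eq_zero D c

omit [IsLocalRing B] in
/-- A ring generated by one element over its `p`-th powers. -/
theorem exists_eq_sum_of_closure_eq_top {x : Fin 1 → B}
    (h : Subring.closure (Set.range (fun r : B ↦ r ^ p) ∪ Set.range x) = ⊤) (r : B) :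
    ∃ c : ℕ → B, (∀ i, c i ∈ powSubring p B) ∧ r = ∑ i ∈ Finset.range p, c i * x 0 ^ i := by
  refine exists_eq_sum_of_mem_closure hp.out.ne_zero (powSubring p B) (x 0)
    ((mem_powSubring p).mpr ⟨_, rfl⟩) r ?_
  have : Set.range x = {x 0} := by
    ext b
    simp [Fin.exists_fin_one, eq_comm]
  rw [this] at h
  exact h.ge trivial

omit [IsLocalRing B] in
/-- A ring generated by two elements over its `p`-th powers. -/
theorem exists_eq_sum_of_closure_eq_top₂ (y z : B)
    (h : Subring.closure (Set.range (fun r : B ↦ r ^ p) ∪ {y, z}) = ⊤) (r : B) :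
    ∃ c : ℕ → ℕ → B, (∀ i j, c i j ∈ powSubring p B) ∧
      r = ∑ j ∈ Finset.range p, (∑ i ∈ Finset.range p, c i j * y ^ i) * z ^ j := by
  set A := Subring.closure (powSubring p B ∪ {y}) with hA
  have hle : (powSubring p B : Set B) ⊆ A := Set.subset_union_left.trans Subring.subset_closure
  obtain ⟨c, hc, e⟩ := exists_eq_sum_of_mem_closure hp.out.ne_zero A z
    (hle ((mem_powSubring p).mpr ⟨_, rfl⟩)) r (by
      have : (⊤ : Subring B) ≤ Subring.closure (A ∪ {z}) := by
        rw [← h, Subring.closure_le]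
        rintro b (hb | rfl | rfl)
        · exact Subring.subset_closure (Or.inl (hle hb))
        · exact Subring.subset_closure (Or.inl (Subring.subset_closure (Or.inr rfl)))
        · exact Subring.subset_closure (Or.inr rfl)
      exact this trivial)
  choose c' hc' e' using fun j ↦ exists_eq_sum_of_mem_closure hp.out.ne_zero (powSubring p B) y
    ((mem_powSubring p).mpr ⟨_, rfl⟩) (c j) (hc j)
  refine ⟨fun i j ↦ c' j i, fun i j ↦ hc' j i, e.trans ?_⟩
  exact Finset.sum_congr rfl fun j _ ↦ by rw [← e' j]

/-- The ring is generated by `x 0` over its `p`-th powers, and a polynomial in `x 0` of degree less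
than `p` that is killed by `D 0` equals its constant coefficient. -/
theorem IsCoordinates.exists_eq_pow₁ [IsDomain B] [Algebra.EssFiniteType k B] [IsAlgClosed k]
    {x : Fin 1 → B} {D : Fin 1 → Derivation k B B} (h : IsCoordinates k x D) (b : B)
    (hb : D 0 b = 0) : ∃ c, b = c ^ p := by
  obtain ⟨c, hc, rfl⟩ := exists_eq_sum_of_closure_eq_top p (h.closure_eq_top p) b
  rw [sum_eq_of_derivation_sum_eq_zero (D 0) (x 0) (by rw [h.apply_same]; exact one_ne_zero) c
    (fun i ↦ derivation_eq_zero_of_mem_powSubring p _ (hc i)) hb]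
  exact (mem_powSubring p).mp (hc 0)

theorem IsCoordinates.closure_pair_eq_top [Algebra.EssFiniteType k B] [IsAlgClosed k]
    {x : Fin 2 → B} {D : Fin 2 → Derivation k B B} (h : IsCoordinates k x D) :
    Subring.closure (Set.range (fun r : B ↦ r ^ p) ∪ {x 0, x 1}) = ⊤ := by
  rw [← h.closure_eq_top p]
  congr 2
  ext b
  simp [eq_comm]

/-- The one-variable argument is applied twice: `D 1` removes the powers of `x 1`, whose
coefficients are polynomials in `x 0` and hence constants for `D 1`; then `D 0` removes the powers
of `x 0`. -/
theorem IsCoordinates.exists_eq_pow₂ [IsDomain B] [Algebra.EssFiniteType k B] [IsAlgClosed k]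
    {x : Fin 2 → B} {D : Fin 2 → Derivation k B B} (h : IsCoordinates k x D) (b : B)
    (hb : D 0 b = 0) (hb' : D 1 b = 0) : ∃ c, b = c ^ p := by
  obtain ⟨c, hc, rfl⟩ := exists_eq_sum_of_closure_eq_top₂ p (x 0) (x 1)
    (h.closure_pair_eq_top p) b
  have h1 : ∀ j, D 1 (∑ i ∈ Finset.range p, c i j * x 0 ^ i) = 0 := fun j ↦ by
    rw [map_sum]
    refine Finset.sum_eq_zero fun i _ ↦ ?_
    rw [Derivation.leibniz, derivation_eq_zero_of_mem_powSubring p _ (hc i j),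
      Derivation.leibniz_pow, h.apply_ne _ _ (by decide)]
    simp
  rw [sum_eq_of_derivation_sum_eq_zero (D 1) (x 1) (by rw [h.apply_same]; exact one_ne_zero) _
    h1 hb'] at hb ⊢
  rw [sum_eq_of_derivation_sum_eq_zero (D 0) (x 0) (by rw [h.apply_same]; exact one_ne_zero)
    (fun i ↦ c i 0) (fun i ↦ derivation_eq_zero_of_mem_powSubring p _ (hc i 0)) hb]
  exact (mem_powSubring p).mp (hc 0 0)

/-- The coordinates generate the maximal ideal. -/
theorem IsCoordinates.span_eq_maximalIdeal (p : ℕ) [hp : Fact p.Prime] [CharP B p]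
    [Algebra.EssFiniteType k B] [IsAlgClosed k]
    [IsNoetherianRing B] (h : IsCoordinates k x D) :
    Ideal.span (Set.range x) = maximalIdeal B := by
  -- Modulo the coordinates every element is a `p`-th power. For `b` in the maximal ideal the root
  -- lies there too, so its `p`-th power is in the square of that ideal, and Nakayama's lemma
  -- concludes.
  have key : ∀ b : B, ∃ c, b - c ^ p ∈ Ideal.span (Set.range x) := by
    intro b
    have hb : b ∈ Subring.closure (Set.range (fun r : B ↦ r ^ p) ∪ Set.range x) := by
      rw [h.closure_eq_top p]
      trivial
    induction hb using Subring.closure_induction with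
    | mem b hb =>
      rcases hb with ⟨c, rfl⟩ | hb
      · exact ⟨c, by simp⟩
      · exact ⟨0, by rw [zero_pow hp.out.ne_zero, sub_zero]; exact Ideal.subset_span hb⟩
    | zero => exact ⟨0, by simp [hp.out.ne_zero]⟩
    | one => exact ⟨1, by simp⟩
    | add a b _ _ ha hb =>
      obtain ⟨c, hc⟩ := ha
      obtain ⟨d, hd⟩ := hb
      refine ⟨c + d, ?_⟩
      rw [add_pow_char, add_sub_add_comm]
      exact add_mem hc hd
    | neg a _ ha =>
      obtain ⟨c, hc⟩ := ha
      refine ⟨-c, ?_⟩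
      have : (-c) ^ p = -(c ^ p) := (frobenius B p).map_neg c
      rw [this, ← neg_sub', neg_mem_iff]
      exact hc
    | mul a b _ _ ha hb =>
      obtain ⟨c, hc⟩ := ha
      obtain ⟨d, hd⟩ := hb
      refine ⟨c * d, ?_⟩
      rw [mul_pow, show a * b - c ^ p * d ^ p = b * (a - c ^ p) + c ^ p * (b - d ^ p) by ring]
      exact add_mem (Ideal.mul_mem_left _ _ hc) (Ideal.mul_mem_left _ _ hd)
  have hle : Ideal.span (Set.range x) ≤ maximalIdeal B := by
    rw [Ideal.span_le]
    rintro _ ⟨i, rfl⟩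
    exact h.mem i
  refine le_antisymm hle ?_
  refine Submodule.le_of_le_smul_of_le_jacobson_bot (I := maximalIdeal B)
    (IsNoetherian.noetherian _) (maximalIdeal_le_jacobson _) ?_
  intro b hb
  obtain ⟨c, hc⟩ := key b
  have hcm : c ∈ maximalIdeal B := by
    have := sub_mem hb (hle hc)
    rw [sub_sub_cancel] at this
    exact (inferInstance : (maximalIdeal B).IsPrime).mem_of_pow_mem _ this
  rw [← sub_add_cancel b (c ^ p)]
  refine Submodule.add_mem_sup hc ?_
  have := Ideal.pow_le_pow_right hp.out.two_le (Ideal.pow_mem_pow hcm p)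
  rwa [pow_two] at this

end LocalAlgebra

end
end LocallyExact

namespace LocallyExact
noncomputable section

/-! ### Generators of the maximal ideal at a node -/

section Node

open IsLocalRing

/-- A power series in two variables without constant term is in the ideal generated by the
variables. -/
theorem mem_span_X_of_constantCoeff_eq_zero {κ : Type*} [CommRing κ]
    (f : MvPowerSeries (Fin 2) κ) (hf : MvPowerSeries.constantCoeff f = 0) :
    f ∈ Ideal.span {(MvPowerSeries.X 0 : MvPowerSeries (Fin 2) κ), MvPowerSeries.X 1} := by
  classical
  -- `g` collects the terms free of the first variable. It has no constant term, so it is divisible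
  -- by the second variable.
  let g : MvPowerSeries (Fin 2) κ := fun m ↦ if m 0 = 0 then MvPowerSeries.coeff m f else 0
  have hg : ∀ m, MvPowerSeries.coeff m g = if m 0 = 0 then MvPowerSeries.coeff m f else 0 :=
    fun m ↦ rfl
  have h0 : (MvPowerSeries.X 0 : MvPowerSeries (Fin 2) κ) ∣ f - g := by
    rw [MvPowerSeries.X_dvd_iff]
    intro m hm
    rw [map_sub, hg, if_pos hm, sub_self]
  have h1 : (MvPowerSeries.X 1 : MvPowerSeries (Fin 2) κ) ∣ g := by
    rw [MvPowerSeries.X_dvd_iff]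
    intro m hm
    rw [hg]
    split_ifs with hm0
    · have : m = 0 := by
        ext i
        fin_cases i
        · exact hm0
        · exact hm
      rw [this]
      exact hf
    · rfl
  rw [← sub_add_cancel f g]
  exact add_mem (Ideal.mem_of_dvd _ h0 (Ideal.subset_span (by simp)))
    (Ideal.mem_of_dvd _ h1 (Ideal.subset_span (by simp)))

/-- At a node, the maximal ideal is generated by two elements whose product is small. -/
theorem IsNode.exists_generators {R : Type*} [CommRing R] [IsLocalRing R] (h : IsNode R) :
    ∃ ξ ∈ maximalIdeal R, ∃ η ∈ maximalIdeal R,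
      maximalIdeal R ≤ Ideal.span {ξ, η} ⊔ maximalIdeal R ^ 3 ∧ ξ * η ∈ maximalIdeal R ^ 3 := by
  obtain ⟨e⟩ := h
  set κ := ResidueField R
  set I : Ideal (MvPowerSeries (Fin 2) κ) := Ideal.span {MvPowerSeries.X 0 * MvPowerSeries.X 1}
  set m := maximalIdeal R
  -- Only the node modulo the cube of the maximal ideal matters: the quadratic part of the equation
  -- is visible there, and the completion can be replaced by `R ⧸ m ^ 3`.
  let φ : MvPowerSeries (Fin 2) κ →+* R ⧸ m ^ 3 :=
    ((AdicCompletion.evalₐ m 3 : AdicCompletion m R →+* R ⧸ m ^ 3).comp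
      (e.symm : _ →+* AdicCompletion m R)).comp (Ideal.Quotient.mk I)
  have hφ : Function.Surjective φ := 
    ((AdicCompletion.surjective_evalₐ m 3).comp e.symm.surjective).comp
      Ideal.Quotient.mk_surjective
  have hφ0 : φ (MvPowerSeries.X 0) * φ (MvPowerSeries.X 1) = 0 := by
    rw [← map_mul]
    have : Ideal.Quotient.mk I (MvPowerSeries.X 0 * MvPowerSeries.X 1) = 0 :=
      Ideal.Quotient.eq_zero_iff_mem.mpr (Ideal.subset_span rfl)
    simp only [φ, RingHom.comp_apply, this, map_zero]
  have hnt : Nontrivial (R ⧸ m ^ 3) := Ideal.Quotient.nontrivial_iff.mpr fun h ↦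
    (maximalIdeal.isMaximal R).ne_top (top_le_iff.mp (h ▸ Ideal.pow_le_self three_ne_zero))
  -- If `φ f` had inverse `φ g`, then `1 - f g` would be a unit power series mapped to zero.
  have hnu : ∀ f : MvPowerSeries (Fin 2) κ, MvPowerSeries.constantCoeff f = 0 →
      ¬ IsUnit (φ f) := by
    intro f hf hu
    obtain ⟨w, hw⟩ := hu.exists_right_inv
    obtain ⟨g, rfl⟩ := hφ w
    have h1 : φ (1 - f * g) = 0 := by rw [map_sub, map_mul, hw, map_one, sub_self]
    have h2 : IsUnit (1 - f * g) := by
      rw [MvPowerSeries.isUnit_iff_constantCoeff]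
      simp [hf]
    exact not_isUnit_zero (h1 ▸ h2.map φ)
  obtain ⟨ξ, hξ⟩ := Ideal.Quotient.mk_surjective (φ (MvPowerSeries.X 0))
  obtain ⟨η, hη⟩ := Ideal.Quotient.mk_surjective (φ (MvPowerSeries.X 1))
  have hmem : ∀ (r : R) (f : MvPowerSeries (Fin 2) κ), MvPowerSeries.constantCoeff f = 0 →
      Ideal.Quotient.mk (m ^ 3) r = φ f → r ∈ m := by
    intro r f hf e
    rw [mem_maximalIdeal, mem_nonunits_iff]
    intro hu
    exact hnu f hf (e ▸ hu.map _)
  refine ⟨ξ, hmem ξ _ (MvPowerSeries.constantCoeff_X _) hξ, η,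
    hmem η _ (MvPowerSeries.constantCoeff_X _) hη, fun r hr ↦ ?_, ?_⟩
  · obtain ⟨f, hf⟩ := hφ (Ideal.Quotient.mk _ r)
    have hf0 : MvPowerSeries.constantCoeff f = 0 := by
      by_contra hne
      have hu : IsUnit (φ f) := (MvPowerSeries.isUnit_iff_constantCoeff.mpr
        (isUnit_iff_ne_zero.mpr hne)).map φ
      have hn : φ f ^ 3 = 0 := by
        rw [hf, ← map_pow]
        exact Ideal.Quotient.eq_zero_iff_mem.mpr (Ideal.pow_mem_pow hr 3)
      exact not_isUnit_zero (hn ▸ hu.pow 3)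
    obtain ⟨a, b, hab⟩ := Ideal.mem_span_pair.mp (mem_span_X_of_constantCoeff_eq_zero f hf0)
    obtain ⟨a', ha'⟩ := Ideal.Quotient.mk_surjective (φ a)
    obtain ⟨b', hb'⟩ := Ideal.Quotient.mk_surjective (φ b)
    rw [← sub_add_cancel r (a' * ξ + b' * η), add_comm]
    refine Submodule.add_mem_sup (Ideal.mem_span_pair.mpr ⟨a', b', rfl⟩) ?_
    rw [← Ideal.Quotient.eq_zero_iff_mem, map_sub, map_add, map_mul, map_mul, ha', hb', hξ, hη,
      ← hf, ← map_mul, ← map_mul, ← map_add, hab, sub_self]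
  · rw [← Ideal.Quotient.eq_zero_iff_mem, map_mul, hξ, hη, hφ0]

end Node

/-! ### The Jacobian ideal of the base parameter -/

section Jacobian

open IsLocalRing

theorem derivation_mem_pow {k B : Type*} [CommRing k] [CommRing B] [Algebra k B]
    (D : Derivation k B B) (I : Ideal B) (n : ℕ) {b : B} (hb : b ∈ I ^ (n + 1)) : D b ∈ I ^ n := by
  induction n generalizing b with
  | zero => simp
  | succ n ih =>
    rw [pow_succ] at hb
    induction hb using Submodule.mul_induction_on' with
    | mem_mul_mem a ha c hc =>
      rw [Derivation.leibniz, smul_eq_mul, smul_eq_mul]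
      refine add_mem (Ideal.mul_mem_right _ _ ha) ?_
      rw [mul_comm, pow_succ]
      exact Ideal.mul_mem_mul (ih ha) hc
    | add a _ c _ ha hc => rw [map_add]; exact add_mem ha hc

variable {B : Type*} [CommRing B] [IsLocalRing B] [IsNoetherianRing B]

theorem maximalIdeal_le_of_le_sup_sq (J : Ideal B)
    (h : maximalIdeal B ≤ J ⊔ maximalIdeal B ^ 2) : maximalIdeal B ≤ J := by
  refine Submodule.le_of_le_smul_of_le_jacobson_bot (I := maximalIdeal B)
    (IsNoetherian.noetherian _) (maximalIdeal_le_jacobson _) ?_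
  rwa [pow_two] at h

section Quotient

variable {R : Type*} [CommRing R] [IsLocalRing R] (q : B →+* R) (hq : Function.Surjective q)
include hq

omit [IsNoetherianRing B] in
theorem map_maximalIdeal_of_surjective : (maximalIdeal B).map q = maximalIdeal R := by
  have : IsLocalHom q := hq.isLocalHom
  refine le_antisymm (((IsLocalRing.local_hom_TFAE q).out 0 2).mp this) fun r hr ↦ ?_
  obtain ⟨b, rfl⟩ := hq r
  exact Ideal.mem_map_of_mem q ((mem_maximalIdeal _).mpr fun hb ↦ hr (hb.map q))

omit [IsLocalRing B] [IsNoetherianRing B] [IsLocalRing R] in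
theorem mem_sup_ker_of_mem_map (J : Ideal B) (b : B) (h : q b ∈ J.map q) :
    b ∈ J ⊔ RingHom.ker q := by
  have : b ∈ (J.map q).comap q := h
  rwa [Ideal.comap_map_of_surjective' q hq] at this

/-- If a quotient by an ideal of elements of order at least two is regular of dimension one, then
the maximal ideal is principal. -/
theorem exists_maximalIdeal_eq_span (hker : RingHom.ker q ≤ maximalIdeal B ^ 2)
    (hdim : ringKrullDim R = 1) (hreg : IsRegularLocalRing R) :
    ∃ z, maximalIdeal B = Ideal.span {z} := by
  have h1 : (maximalIdeal R).spanFinrank = 1 := by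
    have := hreg.spanFinrank_maximalIdeal
    rw [hdim] at this
    exact_mod_cast this
  obtain ⟨⟨z', hz'⟩⟩ := ((maximalIdeal R).spanFinrank_eq_one_iff.mp h1).1
  obtain ⟨z, rfl⟩ := hq z'
  have hzm : z ∈ maximalIdeal B := (mem_maximalIdeal _).mpr fun hu ↦ by
    have : q z ∈ maximalIdeal R := hz' ▸ Submodule.mem_span_singleton_self _
    exact this (hu.map q)
  refine ⟨z, le_antisymm (maximalIdeal_le_of_le_sup_sq _ fun b hb ↦ ?_)
    ((Ideal.span_singleton_le_iff_mem _).mpr hzm)⟩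
  refine sup_le_sup_left hker _ (mem_sup_ker_of_mem_map q hq _ b ?_)
  rw [Ideal.map_span, Set.image_singleton]
  have : q b ∈ maximalIdeal R :=
    map_maximalIdeal_of_surjective q hq ▸ Ideal.mem_map_of_mem q hb
  rw [hz'] at this
  exact this

/-- If a quotient by an ideal of elements of order at least two is a node, then the maximal ideal
is generated by two elements whose product is small. -/
theorem exists_generators_of_isNode {t : B} (hker : RingHom.ker q ≤ Ideal.span {t})
    (ht : t ∈ maximalIdeal B ^ 2) (h : IsNode R) :
    ∃ ξ ∈ maximalIdeal B, ∃ η ∈ maximalIdeal B, maximalIdeal B = Ideal.span {ξ, η} ∧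
      ξ * η ∈ maximalIdeal B ^ 3 ⊔ Ideal.span {t} := by
  obtain ⟨ξ', hξ', η', hη', hspan, hmul⟩ := h.exists_generators
  obtain ⟨ξ, rfl⟩ := hq ξ'
  obtain ⟨η, rfl⟩ := hq η'
  have hm : ∀ b, q b ∈ maximalIdeal R → b ∈ maximalIdeal B := fun b hb ↦
    (mem_maximalIdeal _).mpr fun hu ↦ hb (hu.map q)
  refine ⟨ξ, hm _ hξ', η, hm _ hη', le_antisymm (maximalIdeal_le_of_le_sup_sq _ fun b hb ↦ ?_) ?_,
    ?_⟩
  · have h1 : q b ∈ (Ideal.span {ξ, η} ⊔ maximalIdeal B ^ 3).map q := by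
      rw [Ideal.map_sup, Ideal.map_span, Set.image_pair, Ideal.map_pow,
        map_maximalIdeal_of_surjective q hq]
      refine hspan ?_
      rw [← map_maximalIdeal_of_surjective q hq]
      exact Ideal.mem_map_of_mem q hb
    refine (?_ : _ ≤ Ideal.span {ξ, η} ⊔ maximalIdeal B ^ 2) (mem_sup_ker_of_mem_map q hq _ b h1)
    refine sup_le (sup_le_sup_left (Ideal.pow_le_pow_right (by norm_num)) _)
      (hker.trans (le_sup_of_le_right ?_))
    exact (Ideal.span_singleton_le_iff_mem _).mpr ht
  · rw [Ideal.span_le]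
    rintro _ (rfl | rfl)
    exacts [hm _ hξ', hm _ hη']
  · refine sup_le_sup_left hker _ (mem_sup_ker_of_mem_map q hq _ _ ?_)
    rw [Ideal.map_pow, map_maximalIdeal_of_surjective q hq, map_mul]
    exact hmul

end Quotient

variable {k : Type*} [Field k] [Algebra k B] {x : Fin 2 → B} {D : Fin 2 → Derivation k B B}

-- If `x 0 = a z` and `x 1 = b z` with `z` a generator, then modulo the maximal ideal the identity
-- matrix of derivatives of the coordinates would be the product of `(a, b)` and `(D 0 z, D 1 z)`,
-- of rank at most one.
omit [IsNoetherianRing B] in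
theorem IsCoordinates.not_maximalIdeal_eq_span_singleton (h : IsCoordinates k x D) (z : B) :
    maximalIdeal B ≠ Ideal.span {z} := by
  intro hz
  have hzm : z ∈ maximalIdeal B := hz ▸ Ideal.mem_span_singleton_self z
  obtain ⟨a, ha⟩ := Ideal.mem_span_singleton'.mp (hz ▸ h.mem 0)
  obtain ⟨b, hb⟩ := Ideal.mem_span_singleton'.mp (hz ▸ h.mem 1)
  have key : ∀ (i : Fin 2) (c : B), D i (c * z) - c * D i z ∈ maximalIdeal B := fun i c ↦ by
    rw [Derivation.leibniz, smul_eq_mul, smul_eq_mul, add_sub_cancel_left]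
    exact Ideal.mul_mem_right _ _ hzm
  have h00 := key 0 a
  have h10 := key 1 a
  have h01 := key 0 b
  have h11 := key 1 b
  rw [ha] at h00 h10
  rw [hb] at h01 h11
  rw [h.apply_same] at h00 h11
  rw [h.apply_ne _ _ (by decide), zero_sub, neg_mem_iff] at h10 h01
  have hp : (maximalIdeal B).IsPrime := inferInstance
  have h1 : (1 : B) ∉ maximalIdeal B := hp.one_notMem
  rcases hp.mem_or_mem h10 with h2 | h2
  · refine h1 ?_
    have := add_mem h00 (Ideal.mul_mem_right (D 0 z) _ h2)
    rwa [sub_add_cancel] at this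
  · refine h1 ?_
    have := add_mem h11 (Ideal.mul_mem_left _ b h2)
    rwa [sub_add_cancel] at this

-- For `t = ∑ cᵢ xᵢ` one has `D i t ≡ cᵢ` modulo the maximal ideal, so if all derivatives are
-- non-units then `t` has order at least two.
omit [IsNoetherianRing B] in
theorem IsCoordinates.exists_isUnit (h : IsCoordinates k x D)
    (hx : Ideal.span (Set.range x) = maximalIdeal B) {t : B} (ht : t ∈ maximalIdeal B)
    (ht2 : t ∉ maximalIdeal B ^ 2) : ∃ i, IsUnit (D i t) := by
  by_contra! hu
  refine ht2 ?_
  obtain ⟨c, rfl⟩ := (Submodule.mem_span_range_iff_exists_fun B).mp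
    (show t ∈ Submodule.span B (Set.range x) from hx.ge ht)
  rw [pow_two]
  refine sum_mem fun i _ ↦ Ideal.mul_mem_mul ?_ (h.mem i)
  have h1 : D i (∑ j, c j • x j) - c i ∈ maximalIdeal B := by
    have : D i (∑ j, c j • x j) - c i = ∑ j, x j * D i (c j) := by
      simp only [map_sum, smul_eq_mul, Derivation.leibniz, Finset.sum_add_distrib]
      rw [add_sub_right_comm, add_eq_right, sub_eq_zero, Finset.sum_eq_single i]
      · rw [h.apply_same, mul_one]
      · intro j _ hj
        rw [h.apply_ne _ _ hj.symm, mul_zero]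
      · simp
    rw [this]
    exact sum_mem fun j _ ↦ Ideal.mul_mem_right _ _ (h.mem j)
  have := sub_mem ((mem_maximalIdeal _).mpr (hu i)) h1
  rwa [sub_sub_cancel] at this

omit [IsNoetherianRing B] in
theorem residue_derivation_mul (D : Derivation k B B) (a b : B) (hb : b ∈ maximalIdeal B) :
    residue B (D (a * b)) = residue B a * residue B (D b) := by
  rw [Derivation.leibniz, smul_eq_mul, smul_eq_mul, map_add, map_mul, map_mul,
    (residue_eq_zero_iff b).mpr hb, zero_mul, add_zero]

omit [IsNoetherianRing B] in
/-- The derivatives of a pair of generators of the maximal ideal form a matrix that is invertible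
modulo the maximal ideal. -/
theorem IsCoordinates.exists_matrix (h : IsCoordinates k x D) {ξ : Fin 2 → B}
    (hξ : ∀ i, ξ i ∈ maximalIdeal B) (hspan : maximalIdeal B = Ideal.span (Set.range ξ)) :
    ∃ c : Fin 2 → Fin 2 → B, ∀ i j, (∑ l, c i l * D l (ξ j)) - (if i = j then 1 else 0) ∈
      maximalIdeal B := by
  have hc : ∀ j, ∃ c : Fin 2 → B, ∑ i, c i * ξ i = x j := fun j ↦
    (Submodule.mem_span_range_iff_exists_fun B).mp
      (show x j ∈ Submodule.span B (Set.range ξ) from hspan.le (h.mem j))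
  choose c hc using hc
  let P : Matrix (Fin 2) (Fin 2) (ResidueField B) := Matrix.of fun l j ↦ residue B (D l (ξ j))
  let Q : Matrix (Fin 2) (Fin 2) (ResidueField B) := Matrix.of fun i l ↦ residue B (c l i)
  -- Differentiating the expressions of the coordinates in terms of the `ξ i` gives, over the
  -- residue field, a one-sided inverse of the Jacobian matrix; for square matrices it is two-sided.
  have hPQ : P * Q = 1 := by
    ext l m
    have h1 := congr_arg (fun b ↦ residue B (D l b)) (hc m)
    simp only [map_sum, residue_derivation_mul _ _ _ (hξ _)] at h1
    have h2 : residue B (D l (x m)) = (1 : Matrix (Fin 2) (Fin 2) (ResidueField B)) l m := by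
      rcases eq_or_ne l m with rfl | hne
      · rw [h.apply_same, map_one, Matrix.one_apply_eq]
      · rw [h.apply_ne _ _ hne, map_zero, Matrix.one_apply_ne hne]
    rw [← h2, ← h1, Matrix.mul_apply]
    exact Finset.sum_congr rfl fun i _ ↦ mul_comm _ _
  have hQP : Q * P = 1 := mul_eq_one_comm.mp hPQ
  refine ⟨fun i l ↦ c l i, fun i j ↦ ?_⟩
  have h3 := congr_fun (congr_fun hQP i) j
  rw [Matrix.mul_apply, Matrix.one_apply] at h3
  rw [← residue_eq_zero_iff, map_sub, map_sum, sub_eq_zero]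
  simp only [map_mul]
  refine h3.trans ?_
  split_ifs <;> simp

/-- The Jacobian ideal of a function on a smooth surface whose zero set is smooth or has a node
contains the maximal ideal. -/
theorem IsCoordinates.maximalIdeal_le_jacobian (h : IsCoordinates k x D)
    (hx : Ideal.span (Set.range x) = maximalIdeal B) {R : Type*} [CommRing R] [IsLocalRing R]
    (q : B →+* R) (hq : Function.Surjective q) {t : B} (ht : t ∈ maximalIdeal B)
    (hker : RingHom.ker q ≤ Ideal.span {t}) (hdim : ringKrullDim R = 1)
    (hnode : ¬ IsRegularLocalRing R → IsNode R) :
    maximalIdeal B ≤ Ideal.span (Set.range fun i ↦ D i t) := by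
  by_cases ht2 : t ∈ maximalIdeal B ^ 2
  swap
  -- For `t` of order one the Jacobian ideal is the unit ideal.
  · obtain ⟨i, hi⟩ := h.exists_isUnit hx ht ht2
    rw [Ideal.eq_top_of_isUnit_mem _ (Ideal.subset_span (Set.mem_range_self i)) hi]
    exact le_top
  by_cases hreg : IsRegularLocalRing R
  -- A regular fibre is impossible for `t` of order at least two: the maximal ideal of the surface
  -- would be principal.
  · obtain ⟨z, hz⟩ := exists_maximalIdeal_eq_span q hq
      (hker.trans ((Ideal.span_singleton_le_iff_mem _).mpr ht2)) hdim hreg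
    exact absurd hz (h.not_maximalIdeal_eq_span_singleton z)
  obtain ⟨ξ, hξ, η, hη, hspan, hmul⟩ := exists_generators_of_isNode q hq hker ht2 (hnode hreg)
  set J := Ideal.span (Set.range fun i ↦ D i t)
  apply maximalIdeal_le_of_le_sup_sq
  have hDt : ∀ i, D i t ∈ J := fun i ↦ Ideal.subset_span (Set.mem_range_self i)
  -- `ξ η` is a multiple `a t` up to order three; in `D i (a t)` the term `t D i a` has order two,
  -- and `a D i t` lies in `J`.
  have hD : ∀ i, D i (ξ * η) ∈ J ⊔ maximalIdeal B ^ 2 := by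
    intro i
    obtain ⟨w, hw, y, hy, e⟩ := Submodule.mem_sup.mp hmul
    obtain ⟨a, rfl⟩ := Ideal.mem_span_singleton'.mp hy
    rw [← e, map_add]
    refine add_mem (Ideal.mem_sup_right (derivation_mem_pow _ _ 2 hw)) ?_
    rw [Derivation.leibniz]
    exact add_mem (Ideal.mem_sup_left (Ideal.mul_mem_left _ _ (hDt i)))
      (Ideal.mem_sup_right (Ideal.mul_mem_right _ _ ht2))
  obtain ⟨c, hc⟩ := h.exists_matrix (ξ := ![ξ, η]) (Fin.forall_fin_two.mpr ⟨hξ, hη⟩) (by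
    rw [hspan, Matrix.range_cons, Matrix.range_cons, Matrix.range_empty, Set.union_empty,
      Set.singleton_union])
  have hsq : ∀ {a b : B}, a ∈ maximalIdeal B → b ∈ maximalIdeal B →
      a * b ∈ J ⊔ maximalIdeal B ^ 2 := fun ha hb ↦
    Ideal.mem_sup_right (pow_two (maximalIdeal B) ▸ Ideal.mul_mem_mul ha hb)
  -- With `c` inverse to the Jacobian matrix of `(ξ, η)`, these combinations are derivatives along
  -- `ξ` and `η` modulo the maximal ideal. Applied to `ξ η`, row `0` yields `η` and row `1` yields
  -- `ξ`, up to order two.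
  have hlin : ∀ i, c i 0 * D 0 (ξ * η) + c i 1 * D 1 (ξ * η) ∈ J ⊔ maximalIdeal B ^ 2 := fun i ↦
    add_mem (Ideal.mul_mem_left _ _ (hD 0)) (Ideal.mul_mem_left _ _ (hD 1))
  simp only [Derivation.leibniz, smul_eq_mul] at hlin
  have h00 := hc 0 0
  have h01 := hc 0 1
  have h10 := hc 1 0
  have h11 := hc 1 1
  simp only [Fin.sum_univ_two, Matrix.cons_val_zero, Matrix.cons_val_one, if_true, zero_ne_one,
    one_ne_zero, if_false, sub_zero] at h00 h01 h10 h11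
  refine hspan.le.trans (Ideal.span_le.mpr (Set.insert_subset_iff.mpr
    ⟨?_, Set.singleton_subset_iff.mpr ?_⟩))
  · have e := sub_mem (sub_mem (hlin 1) (hsq hξ h11)) (hsq hη h10)
    convert! e using 1
    ring
  · have e := sub_mem (sub_mem (hlin 0) (hsq hξ h01)) (hsq hη h00)
    convert! e using 1
    ring

end Jacobian

end
end LocallyExact

namespace LocallyExact
noncomputable section

/-! ### Functions whose differential is proportional to `dt` -/

section ClosedForms

open IsLocalRing

/-- If `(x₀, x₁)` is a regular sequence contained in the ideal `(t₀, t₁)` of a domain, then the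
Koszul relation is the only relation between `t₀` and `t₁`. -/
theorem exists_eq_mul_of_mul_eq_mul {B : Type*} [CommRing B] [IsDomain B] {x₀ x₁ t₀ t₁ a b : B}
    (h₀ : x₀ ∈ Ideal.span {t₀, t₁}) (h₁ : x₁ ∈ Ideal.span {t₀, t₁}) (hx : x₀ ≠ 0)
    (hreg : ∀ a b : B, a * x₁ = b * x₀ → x₀ ∣ a) (hab : a * t₁ = b * t₀) :
    ∃ h, a = h * t₀ ∧ b = h * t₁ := by
  obtain ⟨α, β, e₀⟩ := Ideal.mem_span_pair.mp h₀
  obtain ⟨γ, δ, e₁⟩ := Ideal.mem_span_pair.mp h₁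
  have hu₀ : (α * a + β * b) * t₀ = a * x₀ := by
    rw [← e₀]
    linear_combination (-β) * hab
  have hu₁ : (α * a + β * b) * t₁ = b * x₀ := by
    rw [← e₀]
    linear_combination α * hab
  have hv₀ : (γ * a + δ * b) * t₀ = a * x₁ := by
    rw [← e₁]
    linear_combination (-δ) * hab
  have hv₁ : (γ * a + δ * b) * t₁ = b * x₁ := by
    rw [← e₁]
    linear_combination γ * hab
  -- The pair `(α a + β b, γ a + δ b)` is proportional to `(x₀, x₁)`, since each is proportional to
  -- the relation; regularity then gives a common factor `h`. The cases are needed because one of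
  -- `t₀`, `t₁` may vanish.
  have key : (α * a + β * b) * x₁ = (γ * a + δ * b) * x₀ := by
    by_cases ht₀ : t₀ = 0
    · have ht₁ : t₁ ≠ 0 := by
        rintro rfl
        rw [ht₀, mul_zero, mul_zero, add_zero] at e₀
        exact hx e₀.symm
      refine mul_right_cancel₀ ht₁ ?_
      linear_combination x₁ * hu₁ - x₀ * hv₁
    · refine mul_right_cancel₀ ht₀ ?_
      linear_combination x₁ * hu₀ - x₀ * hv₀
  obtain ⟨h, hh⟩ := hreg _ _ key
  rw [hh] at hu₀ hu₁
  exact ⟨h, mul_right_cancel₀ hx (by linear_combination -hu₀),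
    mul_right_cancel₀ hx (by linear_combination -hu₁)⟩

variable (p : ℕ) [hp : Fact p.Prime] {k B : Type*} [Field k] [CommRing B] [Algebra k B]
  [CharP B p]

/-- Frobenius fixes the image of the integers, so the inverse of `n` is its own `p`-th power. This
keeps coefficients in the ring of `p`-th powers when polynomials are integrated. -/
theorem isUnit_inv_natCast_mem_powSubring {n : ℕ} (h0 : n ≠ 0) (hn : n < p) :
    ∃ u ∈ powSubring p B, (n : B) * u = 1 := by
  obtain ⟨u, hu⟩ := isUnit_natCast_of_lt (p := p) (R := B) h0 hn
  refine ⟨↑u⁻¹, (mem_powSubring p).mpr ⟨↑u⁻¹, ?_⟩, by rw [← hu, Units.mul_inv]⟩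
  have h1 : u ^ p = u := by
    ext
    rw [Units.val_pow_eq_pow_val, hu]
    exact map_natCast (frobenius B p) n
  rw [← Units.val_pow_eq_pow_val, inv_pow, h1]

variable [IsDomain B] [IsLocalRing B] {x : Fin 2 → B} {D : Fin 2 → Derivation k B B}

/-- If `dr` is proportional to `dt ≠ 0`, then `r` is generically a polynomial in `t` whose
coefficients are `p`-th powers. -/
theorem IsCoordinates.exists_pow_mul_eq_sum [Algebra.EssFiniteType k B] [IsAlgClosed k]
    (h : IsCoordinates k x D) {t r : B} {i j : Fin 2} (hij : i ≠ j) (ht : D i t ≠ 0)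
    (hr : D i t * D j r = D j t * D i r) :
    ∃ e ≠ 0, ∃ c : ℕ → B, (∀ i, c i ∈ powSubring p B) ∧
      e ^ p * r = ∑ i ∈ Finset.range p, c i * t ^ i := by
  let K := FractionRing B
  have : CharP K p := charP_of_injective_algebraMap (IsFractionRing.injective B K) p
  have : Algebra.EssFiniteType B K := Algebra.EssFiniteType.of_isLocalization K (nonZeroDivisors B)
  have : Algebra.EssFiniteType k K := Algebra.EssFiniteType.comp k B K
  have hD : ∀ b : B, KaehlerDifferential.D k B b = D i b • KaehlerDifferential.D k B (x i) +
      D j b • KaehlerDifferential.D k B (x j) := by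
    intro b
    rw [h.D_eq_sum, Fin.sum_univ_two]
    fin_cases i <;> fin_cases j <;> simp_all [add_comm]
  -- Since `D i t` is invertible in `K`, the differential of `x i` is a combination of those of `t`
  -- and `x j`; thus `t` and `x j` generate `K` over its `p`-th powers.
  have hspan : Submodule.span K (KaehlerDifferential.D k K ''
      {algebraMap B K t, algebraMap B K (x j)}) = ⊤ := by
    set N := Submodule.span K (KaehlerDifferential.D k K ''
      {algebraMap B K t, algebraMap B K (x j)}) with hN
    have hD' : ∀ b : B, KaehlerDifferential.D k K (algebraMap B K b) =
        algebraMap B K (D i b) • KaehlerDifferential.D k K (algebraMap B K (x i)) +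
        algebraMap B K (D j b) • KaehlerDifferential.D k K (algebraMap B K (x j)) := by
      intro b
      have := congr_arg (KaehlerDifferential.map k k B K) (hD b)
      simpa only [map_add, map_smul, KaehlerDifferential.map_D, algebraMap_smul] using this
    have h1 : KaehlerDifferential.D k K (algebraMap B K (x j)) ∈ N :=
      Submodule.subset_span ⟨_, Or.inr rfl, rfl⟩
    have h2 : KaehlerDifferential.D k K (algebraMap B K t) ∈ N :=
      Submodule.subset_span ⟨_, Or.inl rfl, rfl⟩
    have h3 : KaehlerDifferential.D k K (algebraMap B K (x i)) ∈ N := by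
      rw [hD' t] at h2
      refine (N.smul_mem_iff (s := algebraMap B K (D i t)) ?_).mp
        ((Submodule.add_mem_iff_left _ (N.smul_mem _ h1)).mp h2)
      exact (map_ne_zero_iff _ (IsFractionRing.injective B K)).mpr ht
    rw [eq_top_iff, ← KaehlerDifferential.span_range_map_derivation_of_isLocalization k B K
      (nonZeroDivisors B), Submodule.span_le]
    rintro _ ⟨b, rfl⟩
    rw [SetLike.mem_coe, Function.comp_apply, hD b, map_add, map_smul, map_smul, KaehlerDifferential.map_D,
      KaehlerDifferential.map_D, ← algebraMap_smul K (D i b), ← algebraMap_smul K (D j b)]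
    exact add_mem (N.smul_mem _ h3) (N.smul_mem _ h1)
  have hcl := closure_pow_union_eq_top p hp.out (CharP.cast_eq_zero K p)
    (fun a : k ↦ IsAlgClosed.exists_pow_nat_eq a hp.out.pos) _ hspan
  obtain ⟨c, hc, e⟩ := exists_eq_sum_of_closure_eq_top₂ p (algebraMap B K t)
    (algebraMap B K (x j)) hcl (algebraMap B K r)
  choose b hb using fun i j ↦ (mem_powSubring p).mp (hc i j)
  -- Denominators are cleared in the `p`-th roots of the coefficients, so multiplying by `m ^ p`
  -- leaves them `p`-th powers.
  obtain ⟨m, hm⟩ := IsLocalization.exist_integer_multiples (nonZeroDivisors B)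
    (Finset.range p ×ˢ Finset.range p) (fun l ↦ b l.1 l.2)
  choose! b' hb' using fun l hl ↦ hm l hl
  have hm0 : (m : B) ≠ 0 := nonZeroDivisors.coe_ne_zero m
  have e' : (m : B) ^ p * r = ∑ j' ∈ Finset.range p,
      (∑ i' ∈ Finset.range p, b' (i', j') ^ p * t ^ i') * x j ^ j' := by
    apply IsFractionRing.injective B K
    simp only [map_mul, map_pow, map_sum]
    rw [e, Finset.mul_sum]
    refine Finset.sum_congr rfl fun j' hj ↦ ?_
    rw [← mul_assoc, Finset.mul_sum]
    congr 1
    refine Finset.sum_congr rfl fun i' hi ↦ ?_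
    rw [hb' (i', j') (Finset.mk_mem_product hi hj), Algebra.smul_def, hb, mul_pow, mul_assoc]
  refine ⟨m, hm0, fun i' ↦ b' (i', 0) ^ p, fun _ ↦ (mem_powSubring p).mpr ⟨_, rfl⟩, ?_⟩
  -- `E` is the derivation `dt ∧ d(-)`. It kills `t`, `p`-th powers and `r`, but not `x j`; hence
  -- only the zeroth power of `x j` occurs.
  let E : Derivation k B B := D i t • D j - D j t • D i
  have hE : ∀ b, E b = D i t * D j b - D j t * D i b := fun b ↦ rfl
  have hEt : E t = 0 := by rw [hE, mul_comm, sub_self]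
  have hEr : E (m ^ p * r) = 0 := by
    rw [Derivation.leibniz, derivation_pow_eq_zero, smul_zero, add_zero, hE, hr, sub_self,
      smul_zero]
  rw [e'] at hEr ⊢
  refine sum_eq_of_derivation_sum_eq_zero E (x j) ?_ _ (fun j' ↦ ?_) hEr
  · rw [hE, h.apply_same, h.apply_ne i j hij, mul_one, mul_zero, sub_zero]
    exact ht
  · rw [map_sum]
    refine Finset.sum_eq_zero fun i' _ ↦ ?_
    rw [Derivation.leibniz, derivation_pow_eq_zero (p := p), Derivation.leibniz_pow _ t, hEt]
    simp

/-- Polynomials in `t` with coefficients `p`-th powers are saturated. -/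
theorem IsCoordinates.exists_eq_sum_of_pow_mul_eq_sum [Algebra.EssFiniteType k B] [IsAlgClosed k]
    (h : IsCoordinates k x D) {t : B} (ht : ∃ i, D i t ≠ 0)
    (hK : ∀ a b : B, a * D 1 t = b * D 0 t → ∃ g, a = g * D 0 t ∧ b = g * D 1 t)
    (n : ℕ) (hn : n ≤ p) {e : B} (he : e ≠ 0) (r : B) (c : ℕ → B)
    (hc : ∀ i, c i ∈ powSubring p B) (hr : e ^ p * r = ∑ i ∈ Finset.range n, c i * t ^ i) :
    ∃ c : ℕ → B, (∀ i, c i ∈ powSubring p B) ∧ r = ∑ i ∈ Finset.range n, c i * t ^ i := by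
  have he' : e ^ p ≠ 0 := pow_ne_zero _ he
  induction n generalizing r c with
  | zero =>
    refine ⟨c, hc, ?_⟩
    simpa [he'] using hr
  | succ n ih =>
    have h1 : ∀ i, e ^ p * D i r =
        (∑ i ∈ Finset.range n, ((i + 1 : ℕ) : B) * c (i + 1) * t ^ i) * D i t := by
      intro i
      rw [← derivation_sum (D i) t c (fun j ↦ derivation_eq_zero_of_mem_powSubring p _ (hc j)) n,
        ← hr, Derivation.leibniz, derivation_pow_eq_zero, smul_zero, add_zero, smul_eq_mul]
    -- The differential of `r` is proportional to `dt` generically, hence everywhere as the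
    -- annihilated factor `e ^ p` is nonzero; `hK` then gives `dr = g dt` without denominators.
    obtain ⟨g, hg0, hg1⟩ := hK (D 0 r) (D 1 r) (mul_left_cancel₀ he' (by
      linear_combination D 1 t * h1 0 - D 0 t * h1 1))
    have hg : ∀ i, D i r = g * D i t := Fin.forall_fin_two.mpr ⟨hg0, hg1⟩
    obtain ⟨i, hi⟩ := ht
    have h2 : e ^ p * g = ∑ i ∈ Finset.range n, ((i + 1 : ℕ) : B) * c (i + 1) * t ^ i :=
      mul_right_cancel₀ hi (by rw [mul_assoc, ← hg, h1])
    obtain ⟨f, hf, rfl⟩ := ih (by omega) g _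
      (fun i ↦ mul_mem (natCast_mem _ _) (hc _)) h2
    have hu : ∀ i, ∃ u ∈ powSubring p B, i < n → ((i + 1 : ℕ) : B) * u = 1 := by
      intro i
      by_cases hi : i < n
      · obtain ⟨u, hu, hu'⟩ := isUnit_inv_natCast_mem_powSubring p (B := B) (Nat.succ_ne_zero i)
          (show i + 1 < p by omega)
        exact ⟨u, hu, fun _ ↦ hu'⟩
      · exact ⟨0, zero_mem _, fun h ↦ absurd h hi⟩
    choose u hu hu' using hu
    -- The antiderivative of `g` in `t`, with constant term `0`. Its difference from `r` is killed
    -- by both derivations, so it is a `p`-th power, which supplies the missing constant term.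
    let c' : ℕ → B := fun i ↦ i.casesOn 0 fun i ↦ u i * f i
    have hc' : ∀ i, c' i ∈ powSubring p B := by
      rintro (_ | i)
      · exact zero_mem _
      · exact mul_mem (hu i) (hf i)
    have h3 : ∀ i, D i (r - ∑ i ∈ Finset.range (n + 1), c' i * t ^ i) = 0 := by
      intro i
      rw [map_sub, hg, derivation_sum (D i) t c'
        (fun j ↦ derivation_eq_zero_of_mem_powSubring p _ (hc' j)) n, sub_eq_zero]
      congr 1
      refine Finset.sum_congr rfl fun j hj ↦ ?_
      change _ = _ * (u j * f j) * _
      rw [← mul_assoc (_ : B) (u j), hu' j (Finset.mem_range.mp hj), one_mul]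
    obtain ⟨s, hs⟩ := h.exists_eq_pow₂ p _ (h3 0) (h3 1)
    refine ⟨fun i ↦ i.casesOn (s ^ p) fun i ↦ u i * f i, ?_, ?_⟩
    · rintro (_ | i)
      · exact (mem_powSubring p).mpr ⟨s, rfl⟩
      · exact hc' (i + 1)
    · rw [sub_eq_iff_eq_add] at hs
      rw [hs, Finset.sum_range_succ', Finset.sum_range_succ']
      change _ ^ p + (_ + 0 * _) = _ + _ ^ p * _
      rw [zero_mul, add_zero, pow_zero, mul_one, add_comm]

/-- If the Jacobian ideal of `t` contains the maximal ideal and `dr` is proportional to `dt`, then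
`r` is a polynomial in `t` whose coefficients are `p`-th powers. -/
theorem IsCoordinates.exists_eq_sum [Algebra.EssFiniteType k B] [IsAlgClosed k]
    (h : IsCoordinates k x D) (hreg : ∀ a b : B, a * x 1 = b * x 0 → x 0 ∣ a)
    {t : B} (ht : maximalIdeal B ≤ Ideal.span (Set.range fun i ↦ D i t)) (r : B)
    (hr : D 0 t * D 1 r = D 1 t * D 0 r) :
    ∃ c : ℕ → B, (∀ i, c i ∈ powSubring p B) ∧ r = ∑ i ∈ Finset.range p, c i * t ^ i := by
  have hx0 : x 0 ≠ 0 := by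
    intro h0
    have := h.apply_same 0
    rw [h0, map_zero] at this
    exact zero_ne_one this
  have hx : ∀ i, x i ∈ Ideal.span {D 0 t, D 1 t} := by
    intro i
    have := ht (h.mem i)
    have e : (Set.range fun i ↦ D i t) = {D 0 t, D 1 t} := by
      ext b
      simp [eq_comm]
    rwa [e] at this
  have hex : ∃ i, D i t ≠ 0 := by
    by_contra! h0
    have := hx 0
    rw [h0, h0, Set.pair_eq_singleton, Ideal.mem_span_singleton, zero_dvd_iff] at this
    exact hx0 this
  have hK : ∀ a b : B, a * D 1 t = b * D 0 t → ∃ g, a = g * D 0 t ∧ b = g * D 1 t :=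
    fun a b hab ↦ exists_eq_mul_of_mul_eq_mul (hx 0) (hx 1) hx0 hreg hab
  have hgen : ∃ e ≠ 0, ∃ c : ℕ → B, (∀ i, c i ∈ powSubring p B) ∧
      e ^ p * r = ∑ i ∈ Finset.range p, c i * t ^ i := by
    obtain ⟨i, hi⟩ := hex
    fin_cases i
    · exact h.exists_pow_mul_eq_sum p zero_ne_one hi hr
    · exact h.exists_pow_mul_eq_sum p one_ne_zero hi hr.symm
  obtain ⟨e, he, c, hc, h1⟩ := hgen
  exact h.exists_eq_sum_of_pow_mul_eq_sum p hex hK p le_rfl he r c hc h1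

end ClosedForms

end
end LocallyExact

namespace LocallyExact
noncomputable section

/-! ### Coordinates from étale maps to affine space -/

section Coordinates

open IsLocalRing TensorProduct

/-- Differentials of a formally étale algebra are base changed from the polynomial ring, so the
differentials of the variables form a basis; the derivations are the dual basis. -/
theorem exists_isCoordinates_of_formallyEtale {k B : Type*} [Field k] [CommRing B] [Algebra k B]
    [IsLocalRing B] {n : ℕ} [Algebra (MvPolynomial (Fin n) k) B]
    [IsScalarTower k (MvPolynomial (Fin n) k) B]
    [Algebra.FormallyEtale (MvPolynomial (Fin n) k) B]
    (h : ∀ i, algebraMap (MvPolynomial (Fin n) k) B (.X i) ∈ maximalIdeal B) :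
    ∃ D : Fin n → Derivation k B B,
      IsCoordinates k (fun i ↦ algebraMap (MvPolynomial (Fin n) k) B (.X i)) D := by
  let b : Module.Basis (Fin n) B (Ω[B⁄k]) :=
    ((KaehlerDifferential.mvPolynomialBasis k (Fin n)).baseChange B).map
      (KaehlerDifferential.tensorKaehlerEquivOfFormallyEtale k (MvPolynomial (Fin n) k) B)
  have hb : ∀ i, b i =
      KaehlerDifferential.D k B (algebraMap (MvPolynomial (Fin n) k) B (.X i)) := by
    intro i
    rw [Module.Basis.map_apply, Module.Basis.baseChange_apply,
      KaehlerDifferential.mvPolynomialBasis_apply, ← LinearEquiv.eq_symm_apply,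
      KaehlerDifferential.tensorKaehlerEquivOfFormallyEtale_symm_D_algebraMap]
  refine ⟨fun i ↦ (b.coord i).compDer (KaehlerDifferential.D k B), h, fun i ↦ ?_, fun i j hij ↦ ?_,
    ?_⟩
  · change b.coord i (KaehlerDifferential.D k B _) = _
    rw [← hb, Module.Basis.coord_apply, Module.Basis.repr_self, Finsupp.single_eq_same]
  · change b.coord i (KaehlerDifferential.D k B _) = _
    rw [← hb, Module.Basis.coord_apply, Module.Basis.repr_self, Finsupp.single_eq_of_ne hij]
  · rw [← b.span_eq, ← Set.range_comp]
    congr 2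
    ext i
    exact (hb i).symm

/-- The images of two variables in a flat algebra over a polynomial ring form a regular
sequence. -/
theorem dvd_of_mul_X_eq_mul_X {k B σ : Type*} [Field k] [CommRing B]
    [Algebra (MvPolynomial σ k) B] [Module.Flat (MvPolynomial σ k) B] {i j : σ} (hij : i ≠ j)
    (a b : B) (h : a * algebraMap (MvPolynomial σ k) B (.X j) =
      b * algebraMap (MvPolynomial σ k) B (.X i)) :
    algebraMap (MvPolynomial σ k) B (.X i) ∣ a := by
  -- By the equational criterion of flatness, the relation comes from relations in the polynomial
  -- ring, where `X i` and `X j` are non-associated primes.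
  obtain ⟨m, c, y, hc, hy⟩ := Module.Flat.isTrivialRelation_of_sum_smul_eq_zero
    (R := MvPolynomial σ k) (M := B) (f := ![.X j, -.X i]) (x := ![a, b]) (by
      simp only [Fin.sum_univ_two, Matrix.cons_val_zero, Matrix.cons_val_one, Algebra.smul_def,
        map_neg]
      linear_combination h)
  have h0 : ∀ l, (MvPolynomial.X i : MvPolynomial σ k) ∣ c 0 l := by
    intro l
    have h1 := hy l
    simp only [Fin.sum_univ_two, Matrix.cons_val_zero, Matrix.cons_val_one] at h1
    refine (MvPolynomial.X_prime.dvd_or_dvd (a := .X j) ⟨c 1 l, ?_⟩).resolve_left ?_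
    · linear_combination h1
    · rwa [MvPolynomial.X_dvd_X]
  have ha := hc 0
  simp only [Matrix.cons_val_zero] at ha
  rw [ha]
  refine Finset.dvd_sum fun l _ ↦ ?_
  obtain ⟨e, he⟩ := h0 l
  rw [he, Algebra.smul_def, map_mul, mul_assoc]
  exact dvd_mul_right _ _

/-- Translation of variables in a polynomial ring is bijective. -/
theorem bijective_aeval_X_sub_C {k σ : Type*} [CommRing k] (a : σ → k) :
    Function.Bijective (MvPolynomial.aeval (R := k)
      (fun i ↦ (MvPolynomial.X i - .C (a i) : MvPolynomial σ k))) := by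
  have h : ∀ (b c : σ → k), (∀ i, b i + c i = 0) →
      (MvPolynomial.aeval (R := k) (fun i ↦ (MvPolynomial.X i - .C (b i) : MvPolynomial σ k))).comp
      (MvPolynomial.aeval (R := k) (fun i ↦ (MvPolynomial.X i - .C (c i) : MvPolynomial σ k))) =
        AlgHom.id k _ := by
    intro b c hbc
    ext1 i
    simp only [AlgHom.comp_apply, MvPolynomial.aeval_X, map_sub, MvPolynomial.aeval_C,
      MvPolynomial.algebraMap_eq, AlgHom.id_apply]
    rw [sub_sub, ← map_add, hbc, map_zero, sub_zero]
  refine Function.bijective_iff_has_inverse.mpr ⟨MvPolynomial.aeval (R := k)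
    (fun i ↦ (MvPolynomial.X i - .C (-a i) : MvPolynomial σ k)), fun x ↦ ?_, fun x ↦ ?_⟩
  · exact DFunLike.congr_fun (h (-a) a (by simp)) x
  · exact DFunLike.congr_fun (h a (-a) (by simp)) x

/-- Local coordinates at a rational point of a smooth algebra. -/
theorem exists_isCoordinates_of_isStandardSmooth {k A : Type u} {B : Type*} [Field k] [CommRing A]
    [CommRing B] [IsLocalRing B] [Algebra k B] [Algebra A B] (φ : k →+* A)
    (hφ : (algebraMap A B).comp φ = algebraMap k B) {n : ℕ}
    (hs : φ.IsStandardSmoothOfRelativeDimension n) (M : Submonoid A) [IsLocalization M B]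
    (hk : ∀ b : B, ∃ a : k, b - algebraMap k B a ∈ maximalIdeal B) :
    Algebra.EssFiniteType k B ∧ ∃ (x : Fin n → B) (D : Fin n → Derivation k B B),
      IsCoordinates k x D ∧
      ∀ i j, i ≠ j → ∀ a b : B, a * x j = b * x i → x i ∣ a := by
  obtain ⟨g, hg, hge⟩ := hs.exists_etale_mvPolynomial
  -- The étale coordinates are translated by their values at the point, so that they vanish there.
  choose a ha using fun i ↦ hk (algebraMap A B (g (.X i)))
  have hσ := bijective_aeval_X_sub_C a
  set σ := MvPolynomial.aeval (R := k)
    (fun i ↦ (MvPolynomial.X i - .C (a i) : MvPolynomial (Fin n) k))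
  have hge' : (g.comp σ.toRingHom).Etale :=
    RingHom.Etale.stableUnderComposition _ g (RingHom.Etale.of_bijective hσ) hge
  have hg' : (g.comp σ.toRingHom).comp
      MvPolynomial.C = φ := by
    rw [← hg, RingHom.comp_assoc]
    exact congr_arg g.comp σ.comp_algebraMap
  set g' := g.comp σ.toRingHom
  let _ : Algebra (MvPolynomial (Fin n) k) A := g'.toAlgebra
  let _ : Algebra (MvPolynomial (Fin n) k) B := ((algebraMap A B).comp g').toAlgebra
  have : IsScalarTower (MvPolynomial (Fin n) k) A B := IsScalarTower.of_algebraMap_eq fun _ ↦ rfl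
  have : IsScalarTower k (MvPolynomial (Fin n) k) B := IsScalarTower.of_algebraMap_eq fun c ↦ by
    rw [← hφ, ← hg']
    rfl
  have : Algebra.Etale (MvPolynomial (Fin n) k) A := hge'
  have : Algebra.FormallyEtale A B := .of_isLocalization M
  have : Algebra.FormallyEtale (MvPolynomial (Fin n) k) B := .comp _ A B
  have : Module.Flat A B := IsLocalization.flat B M
  have : Module.Flat (MvPolynomial (Fin n) k) A := Algebra.Smooth.flat _ _
  have : Module.Flat (MvPolynomial (Fin n) k) B := .trans _ A B
  have : Algebra.EssFiniteType A B := .of_isLocalization B M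
  have : Algebra.EssFiniteType (MvPolynomial (Fin n) k) B := .comp _ A B
  have hX : ∀ i, algebraMap (MvPolynomial (Fin n) k) B (.X i) ∈ maximalIdeal B := by
    intro i
    convert! ha i
    change algebraMap A B (g (σ _)) = _
    simp only [σ, MvPolynomial.aeval_X, map_sub]
    congr 1
    rw [← hφ, ← hg]
    rfl
  refine ⟨.comp _ (MvPolynomial (Fin n) k) B, ?_⟩
  obtain ⟨D, hD⟩ := exists_isCoordinates_of_formallyEtale hX
  exact ⟨_, D, hD, fun i j hij ↦ dvd_of_mul_X_eq_mul_X hij⟩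

end Coordinates

/-! ### Coordinates at closed points of smooth schemes -/

section Stalks

open IsLocalRing

variable {k : Type u} [Field k] {X : Scheme.{u}} (f : X ⟶ Spec (.of k)) (x : X)

/-- The `k`-algebra structure on the local rings of a scheme over `k`. -/
abbrev stalkAlgebra : Algebra k (X.presheaf.stalk x) :=
  ((Scheme.ΓSpecIso (.of k)).inv ≫ f.appTop ≫ X.presheaf.germ ⊤ x trivial).hom.toAlgebra

theorem SpecMap_stalkAlgebra :
    Spec.map ((Scheme.ΓSpecIso (.of k)).inv ≫ f.appTop ≫ X.presheaf.germ ⊤ x trivial) =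
      X.fromSpecStalk x ≫ f := by
  rw [Spec.map_comp, Spec.map_comp, ← Scheme.fromSpecStalk_toSpecΓ, Category.assoc, Category.assoc,
    ← Scheme.toSpecΓ_naturality_assoc, toSpecΓ_SpecMap_ΓSpecIso_inv, Category.comp_id]

/-- By the Nullstellensatz the residue field at a closed point is `k`, and `a` is the value of `b`
there. -/
theorem exists_sub_mem_maximalIdeal [IsAlgClosed k] [LocallyOfFiniteType f] (hx : IsClosed {x})
    (b : X.presheaf.stalk x) :
    letI := stalkAlgebra f x
    ∃ a : k, b - algebraMap k (X.presheaf.stalk x) a ∈ maximalIdeal (X.presheaf.stalk x) := by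
  let _ := stalkAlgebra f x
  have h : (residueFieldIsoBase f x hx).inv =
      ((Scheme.ΓSpecIso (.of k)).inv ≫ f.appTop ≫ X.presheaf.germ ⊤ x trivial) ≫ X.residue x := by
    apply Spec.map_injective
    rw [SpecMap_residueFieldIsoBase_inv, Spec.map_comp, SpecMap_stalkAlgebra, ← Category.assoc]
    rfl
  refine ⟨(residueFieldIsoBase f x hx).hom (X.residue x b), ?_⟩
  rw [← residue_eq_zero_iff, map_sub, sub_eq_zero]
  have h2 := ConcreteCategory.congr_hom h ((residueFieldIsoBase f x hx).hom (X.residue x b))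
  rw [← CommRingCat.comp_apply, Iso.hom_inv_id] at h2
  exact h2

theorem exists_isCoordinates_stalk [IsAlgClosed k] (n : ℕ) [SmoothOfRelativeDimension n f]
    (hx : IsClosed {x}) :
    letI := stalkAlgebra f x
    Algebra.EssFiniteType k (X.presheaf.stalk x) ∧ ∃ (y : Fin n → X.presheaf.stalk x)
      (D : Fin n → Derivation k (X.presheaf.stalk x) (X.presheaf.stalk x)),
      IsCoordinates k y D ∧ ∀ i j, i ≠ j → ∀ a b, a * y j = b * y i → y i ∣ a := by
  let _ := stalkAlgebra f x
  have : Smooth f := SmoothOfRelativeDimension.smooth n f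
  obtain ⟨U, hU, V, hV, hxV, e, hs⟩ :=
    SmoothOfRelativeDimension.exists_isStandardSmoothOfRelativeDimension (n := n) (f := f) x
  obtain rfl : U = ⊤ := by
    ext z
    rw [Subsingleton.elim z (f x)]
    exact iff_of_true (e hxV) trivial
  let φ : k →+* Γ(X, V) := ((Scheme.ΓSpecIso (.of k)).inv ≫ f.appLE ⊤ V e).hom
  have hφ : φ.IsStandardSmoothOfRelativeDimension n :=
    RingHom.isStandardSmoothOfRelativeDimension_respectsIso.2 _
      (Scheme.ΓSpecIso (.of k)).symm.commRingCatIsoToRingEquiv hs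
  have := hV.isLocalization_stalk ⟨x, hxV⟩
  let _ : Algebra Γ(X, V) (X.presheaf.stalk x) := X.presheaf.algebra_section_stalk ⟨x, hxV⟩
  refine exists_isCoordinates_of_isStandardSmooth φ ?_ hφ
    (hV.primeIdealOf ⟨x, hxV⟩).asIdeal.primeCompl (exists_sub_mem_maximalIdeal f x hx)
  change (((Scheme.ΓSpecIso (.of k)).inv ≫ f.appLE ⊤ V e) ≫ X.presheaf.germ V x hxV).hom =
    ((Scheme.ΓSpecIso (.of k)).inv ≫ f.appTop ≫ X.presheaf.germ ⊤ x trivial).hom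
  rw [Category.assoc, Scheme.Hom.appLE, Category.assoc, TopCat.Presheaf.germ_res]
  rfl

end Stalks

end
end LocallyExact

namespace LocallyExact
noncomputable section

/-! ### Local rings of the fibres -/

section Fibre

open IsLocalRing

variable {k : Type u} [Field k] [IsAlgClosed k]

/-- A morphism from the spectrum of a local ring to `C` that maps a uniformizer to zero factors
through the closed point. -/
theorem exists_comp_pointOfClosedPoint_eq {C : Scheme.{u}} (f : C ⟶ Spec (.of k))
    [LocallyOfFiniteType f] {c : C} (hc : IsClosed {c}) {t : C.presheaf.stalk c}
    (ht : maximalIdeal (C.presheaf.stalk c) = Ideal.span {t}) {T : CommRingCat.{u}}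
    (ψ : C.presheaf.stalk c ⟶ T) (hψ : ψ t = 0) :
    ∃ h : Spec T ⟶ Spec (.of k),
      Spec.map ψ ≫ C.fromSpecStalk c = h ≫ pointOfClosedPoint f c hc := by
  let φ : C.residueField c ⟶ T := CommRingCat.ofHom
    (Ideal.Quotient.lift (maximalIdeal (C.presheaf.stalk c)) ψ.hom (by
      intro a ha
      obtain ⟨b, rfl⟩ := Ideal.mem_span_singleton'.mp (ht.le ha)
      rw [map_mul]
      exact (congr_arg _ hψ).trans (mul_zero _)))
  have hφ : C.residue c ≫ φ = ψ := by
    ext a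
    rfl
  refine ⟨Spec.map ((residueFieldIsoBase f c hc).inv ≫ φ), ?_⟩
  rw [pointOfClosedPoint, ← Spec.map_comp_assoc, Iso.hom_inv_id_assoc, Scheme.fromSpecResidueField,
    ← Spec.map_comp_assoc, hφ]

/-- The point `i (l (closedPoint T))` equals `y` only propositionally, so the two maps to `T` are
compared on germs of sections over a common open set. -/
theorem germ_comp_stalkMap_comp_stalkClosedPointTo {X Y : Scheme.{u}} (i : X ⟶ Y)
    {T : CommRingCat.{u}} [IsLocalRing T] (l : Spec T ⟶ X) {y : Y} (ψ : Y.presheaf.stalk y ⟶ T)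
    [IsLocalHom ψ.hom] (hl : l ≫ i = Spec.map ψ ≫ Y.fromSpecStalk y) (U : Y.Opens)
    (hU : i (l (closedPoint T)) ∈ U) (hyU : y ∈ U) :
    Y.presheaf.germ U _ hU ≫ i.stalkMap (l (closedPoint T)) ≫ Scheme.stalkClosedPointTo l =
      Y.presheaf.germ U y hyU ≫ ψ := by
  have h1 : ∀ (g : Spec T ⟶ Y) (hg : g (closedPoint T) ∈ U), g = Spec.map ψ ≫ Y.fromSpecStalk y →
      Y.presheaf.germ U _ hg ≫ Scheme.stalkClosedPointTo g = Y.presheaf.germ U y hyU ≫ ψ := by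
    rintro g hg rfl
    exact Scheme.germ_stalkClosedPointTo_Spec_fromSpecStalk ψ U hg
  rw [← Scheme.stalkClosedPointTo_comp]
  exact h1 _ hU hl

/-- The local ring of the fibre of a nodal fibration at a closed point, as a quotient of the local
ring of the total space. -/
theorem IsNodalFibration.exists_quotient {S C : Scheme.{u}} (f : C ⟶ Spec (.of k))
    [LocallyOfFiniteType f] {π : S ⟶ C} (hπ : IsNodalFibration π) (s : S) (hs : IsClosed {s})
    (hc : IsClosed {π s}) {t : C.presheaf.stalk (π s)}
    (ht : maximalIdeal (C.presheaf.stalk (π s)) = Ideal.span {t}) :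
    ∃ (R : CommRingCat.{u}) (_ : IsLocalRing R) (q : S.presheaf.stalk s →+* R),
      Function.Surjective q ∧ RingHom.ker q ≤ Ideal.span {π.stalkMap s t} ∧
      ringKrullDim R = 1 ∧ (¬ IsRegularLocalRing R → IsNode R) := by
  let y := pointOfClosedPoint f (π s) hc
  have : IsClosedImmersion y := isClosedImmersion_of_comp_eq_id f y (pointOfClosedPoint_comp ..)
  let i := pullback.fst π y
  let t' := π.stalkMap s t
  have ht' : t' ∈ maximalIdeal (S.presheaf.stalk s) := by
    rw [mem_maximalIdeal, mem_nonunits_iff]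
    intro h
    exact (mem_maximalIdeal t).mp (ht.ge (Ideal.mem_span_singleton_self t))
      ((isUnit_map_iff (π.stalkMap s).hom t).mp h)
  let I : Ideal (S.presheaf.stalk s) := Ideal.span {t'}
  let T : CommRingCat.{u} := .of (S.presheaf.stalk s ⧸ I)
  have : Nontrivial T := Ideal.Quotient.nontrivial_iff.mpr fun h ↦
    (maximalIdeal.isMaximal (S.presheaf.stalk s)).ne_top
      (top_le_iff.mp (h.ge.trans ((Ideal.span_singleton_le_iff_mem _).mpr ht')))
  let ψ : S.presheaf.stalk s ⟶ T := CommRingCat.ofHom (Ideal.Quotient.mk I)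
  have hψ : Function.Surjective ψ.hom := Ideal.Quotient.mk_surjective
  have : IsLocalRing T := IsLocalRing.of_surjective' ψ.hom hψ
  have : IsLocalHom ψ.hom := hψ.isLocalHom
  obtain ⟨h, hh⟩ := exists_comp_pointOfClosedPoint_eq f hc ht (π.stalkMap s ≫ ψ) (by
    change Ideal.Quotient.mk I t' = 0
    exact Ideal.Quotient.eq_zero_iff_mem.mpr (Ideal.mem_span_singleton_self t'))
  -- The spectrum of the local ring modulo `t` maps to the fibre, by the universal property of the
  -- fibre product; this controls the kernel of the map to the local ring of the fibre.
  let l : Spec T ⟶ pullback π y := pullback.lift (Spec.map ψ ≫ S.fromSpecStalk s) h (by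
    rw [Category.assoc, ← Scheme.SpecMap_stalkMap_fromSpecStalk, ← Spec.map_comp_assoc]
    exact hh)
  have hl : l ≫ i = Spec.map ψ ≫ S.fromSpecStalk s := pullback.lift_fst _ _ _
  let z := l (closedPoint T)
  have hz : i z = s := by
    have h1 : (Spec.map ψ ≫ S.fromSpecStalk s) (closedPoint T) = s :=
      (congr_arg (S.fromSpecStalk s) (Spec_closedPoint (f := ψ))).trans
        Scheme.fromSpecStalk_closedPoint
    rw [← hl] at h1
    exact h1
  have hzc : IsClosed {z} := by
    have : {z} = i ⁻¹' {s} := by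
      ext w
      rw [Set.mem_singleton_iff, Set.mem_preimage, Set.mem_singleton_iff, ← hz]
      exact i.isClosedEmbedding.injective.eq_iff.symm
    rw [this]
    exact hs.preimage i.continuous
  have hnodal := hπ.nodal k y
  let e := S.presheaf.stalkSpecializes (specializes_of_eq hz)
  have he : Function.Surjective e := by
    have : IsIso e := (S.presheaf.stalkCongr (.of_eq hz.symm)).isIso_hom
    exact (ConcreteCategory.bijective_of_isIso e).2
  refine ⟨(pullback π y).presheaf.stalk z, inferInstance, (e ≫ i.stalkMap z).hom, ?_, ?_,
    hnodal.dim_eq_one z hzc, hnodal.node z hzc⟩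
  · exact (i.stalkMap_surjective z).comp he
  -- Composing with the map induced by `l` gives the quotient map modulo `t`, so what vanishes in
  -- the local ring of the fibre is a multiple of `t`.
  · intro b hb
    obtain ⟨U, hU, b, rfl⟩ := S.presheaf.exists_germ_eq b
    have hzU : i z ∈ U := by rwa [hz]
    have h1 := ConcreteCategory.congr_hom
      (germ_comp_stalkMap_comp_stalkClosedPointTo i l ψ hl U hzU hU) b
    have h2 : i.stalkMap z (S.presheaf.germ U (i z) hzU b) = 0 := by
      have h3 := ConcreteCategory.congr_hom
        (S.presheaf.germ_stalkSpecializes hU (specializes_of_eq hz)) b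
      rw [← h3]
      exact hb
    refine Ideal.Quotient.eq_zero_iff_mem.mp (h1.symm.trans ?_)
    exact (congr_arg (Scheme.stalkClosedPointTo l) h2).trans (map_zero _)

end Fibre

end
end LocallyExact

namespace LocallyExact
noncomputable section

/-! ### Closed and relatively closed functions at closed points -/

section Germs

open IsLocalRing

/-- A parameter of a discrete valuation ring of characteristic `p` over which the ring is generated
by its `p`-th powers. -/
structure IsParameter (p : ℕ) {A : Type*} [CommRing A] [IsLocalRing A] (t : A) : Prop where
  span_eq : maximalIdeal A = Ideal.span {t}
  exists_eq_sum : ∀ a, ∃ c : ℕ → A, a = ∑ i ∈ Finset.range p, c i ^ p * t ^ i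

theorem charP_stalk (p : ℕ) {k : Type u} [Field k] [CharP k p] {X : Scheme.{u}}
    (f : X ⟶ Spec (.of k)) (x : X) : CharP (X.presheaf.stalk x) p := by
  let _ := stalkAlgebra f x
  exact charP_of_injective_algebraMap (algebraMap k (X.presheaf.stalk x)).injective p

theorem exists_stalkMap_eq_algebraMap {k : Type u} [Field k] {X : Scheme.{u}}
    (f : X ⟶ Spec (.of k)) (x : X) (a : (Spec (.of k)).presheaf.stalk (f x)) :
    letI := stalkAlgebra f x
    ∃ c : k, f.stalkMap x a = algebraMap k (X.presheaf.stalk x) c := by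
  obtain ⟨U, hU, a, rfl⟩ := (Spec (.of k)).presheaf.exists_germ_eq a
  obtain rfl : U = ⊤ := by
    ext z
    rw [Subsingleton.elim z (f x)]
    exact iff_of_true hU trivial
  refine ⟨(Scheme.ΓSpecIso (.of k)).hom a, ?_⟩
  refine (Scheme.Hom.germ_stalkMap_apply f ⊤ x hU a).trans ?_
  have h := ConcreteCategory.congr_hom (Scheme.ΓSpecIso (.of k)).hom_inv_id a
  exact congr_arg (fun b ↦ X.presheaf.germ ⊤ x trivial (f.appTop b)) h.symm

/-- Derivations of the local ring kill the germs of closed functions. -/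
theorem derivation_germ_eq_zero {k : Type u} [Field k] {X : Scheme.{u}} (f : X ⟶ Spec (.of k))
    (U : X.Opens) (r : Γ(X, U)) (h : d f U r = 0) (x : X) (hx : x ∈ U) :
    letI := stalkAlgebra f x
    ∀ D : Derivation k (X.presheaf.stalk x) (X.presheaf.stalk x),
      D (X.presheaf.germ U x hx r) = 0 := by
  let _ := stalkAlgebra f x
  intro D
  refine stalk_derivation_eq_zero f U r h x hx D.toLinearMap.toAddMonoidHom D.leibniz fun a ↦ ?_
  obtain ⟨c, hc⟩ := exists_stalkMap_eq_algebraMap f x a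
  rw [hc]
  exact D.map_algebraMap c

variable (p : ℕ) [hp : Fact p.Prime] {k : Type u} [Field k] [IsAlgClosed k] [CharP k p]

theorem exists_germ_eq_pow₁ {X : Scheme.{u}} [IsIntegral X] (f : X ⟶ Spec (.of k))
    [SmoothOfRelativeDimension 1 f] (U : X.Opens) (r : Γ(X, U)) (h : d f U r = 0) (x : X)
    (hx : x ∈ U) (hxc : IsClosed {x}) : ∃ b, X.presheaf.germ U x hx r = b ^ p := by
  let _ := stalkAlgebra f x
  have := charP_stalk p f x
  obtain ⟨_, y, D, hD, -⟩ := exists_isCoordinates_stalk f x 1 hxc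
  exact hD.exists_eq_pow₁ p _ (derivation_germ_eq_zero f U r h x hx _)

theorem exists_germ_eq_pow₂ {X : Scheme.{u}} [IsIntegral X] (f : X ⟶ Spec (.of k))
    [SmoothOfRelativeDimension 2 f] (U : X.Opens) (r : Γ(X, U)) (h : d f U r = 0) (x : X)
    (hx : x ∈ U) (hxc : IsClosed {x}) : ∃ b, X.presheaf.germ U x hx r = b ^ p := by
  let _ := stalkAlgebra f x
  have := charP_stalk p f x
  obtain ⟨_, y, D, hD, -⟩ := exists_isCoordinates_stalk f x 2 hxc
  exact hD.exists_eq_pow₂ p _ (derivation_germ_eq_zero f U r h x hx _)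
    (derivation_germ_eq_zero f U r h x hx _)

theorem exists_isParameter {C : Scheme.{u}} (f : C ⟶ Spec (.of k))
    [SmoothOfRelativeDimension 1 f] (c : C) (hc : IsClosed {c}) :
    ∃ t : C.presheaf.stalk c, IsParameter p t := by
  let _ := stalkAlgebra f c
  have := charP_stalk p f c
  obtain ⟨_, y, D, hD, -⟩ := exists_isCoordinates_stalk f c 1 hc
  have : IsNoetherianRing (C.presheaf.stalk c) := Algebra.EssFiniteType.isNoetherianRing k _
  refine ⟨y 0, ?_, fun a ↦ ?_⟩
  · rw [← hD.span_eq_maximalIdeal p]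
    congr 1
    ext b
    simp [eq_comm]
  · obtain ⟨e, he, h⟩ := exists_eq_sum_of_closure_eq_top p (hD.closure_eq_top p) a
    choose e' he' using fun i ↦ (mem_powSubring p).mp (he i)
    exact ⟨e', by simp_rw [← he', ← h]⟩

variable {S C : Scheme.{u}} [IsIntegral S] (f : C ⟶ Spec (.of k)) [LocallyOfFiniteType f]
  (π : S ⟶ C) [SmoothOfRelativeDimension 2 (π ≫ f)]

omit [IsIntegral S] in
include f in
/-- On a nodal fibration, the Jacobian ideal of a parameter of the base contains the maximal
ideal. -/
theorem exists_isCoordinates_le_jacobian (hπ : IsNodalFibration π) (s : S) (hs : IsClosed {s})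
    (hc : IsClosed {π s}) {t : C.presheaf.stalk (π s)} (ht : IsParameter p t) :
    letI := stalkAlgebra (π ≫ f) s
    Algebra.EssFiniteType k (S.presheaf.stalk s) ∧ ∃ (x : Fin 2 → S.presheaf.stalk s)
      (D : Fin 2 → Derivation k (S.presheaf.stalk s) (S.presheaf.stalk s)),
      IsCoordinates k x D ∧ (∀ a b, a * x 1 = b * x 0 → x 0 ∣ a) ∧
      maximalIdeal (S.presheaf.stalk s) ≤ Ideal.span (Set.range fun i ↦ D i (π.stalkMap s t)) := by
  let _ := stalkAlgebra (π ≫ f) s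
  have := charP_stalk p (π ≫ f) s
  obtain ⟨h, x, D, hD, hreg⟩ := exists_isCoordinates_stalk (π ≫ f) s 2 hs
  have : IsNoetherianRing (S.presheaf.stalk s) := Algebra.EssFiniteType.isNoetherianRing k _
  obtain ⟨R, _, q, hq, hker, hdim, hnode⟩ := hπ.exists_quotient f s hs hc ht.span_eq
  refine ⟨h, x, D, hD, hreg 0 1 zero_ne_one, ?_⟩
  refine hD.maximalIdeal_le_jacobian (hD.span_eq_maximalIdeal p) q hq ?_ hker hdim hnode
  rw [mem_maximalIdeal, mem_nonunits_iff]
  intro h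
  exact (mem_maximalIdeal t).mp (ht.span_eq.ge (Ideal.mem_span_singleton_self t))
    ((isUnit_map_iff (π.stalkMap s).hom t).mp h)

include f in
/-- The germ of a relatively closed function is a polynomial in a parameter of the base whose
coefficients are `p`-th powers. -/
theorem exists_germ_eq_sum (hπ : IsNodalFibration π) (U : S.Opens) (r : Γ(S, U))
    (h : d π U r = 0) (s : S) (hsU : s ∈ U) (hs : IsClosed {s})
    (hc : IsClosed {π s}) {t : C.presheaf.stalk (π s)} (ht : IsParameter p t) :
    ∃ c : ℕ → S.presheaf.stalk s,
      S.presheaf.germ U s hsU r = ∑ i ∈ Finset.range p, c i ^ p * (π.stalkMap s t) ^ i := by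
  let _ := stalkAlgebra (π ≫ f) s
  have := charP_stalk p (π ≫ f) s
  obtain ⟨_, x, D, hD, hreg, hJ⟩ := exists_isCoordinates_le_jacobian p f π hπ s hs hc ht
  set t' := π.stalkMap s t
  -- `E` kills `p`-th powers and the parameter, hence all germs from the base; it therefore kills
  -- `r`, which says that `dr` is proportional to `dt`.
  let E : Derivation k (S.presheaf.stalk s) (S.presheaf.stalk s) := D 0 t' • D 1 - D 1 t' • D 0
  have hE : ∀ b, E b = D 0 t' * D 1 b - D 1 t' * D 0 b := fun b ↦ rfl
  have hEt : E t' = 0 := by rw [hE, mul_comm, sub_self]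
  have hr := stalk_derivation_eq_zero π U r h s hsU E.toLinearMap.toAddMonoidHom E.leibniz (by
    intro a
    obtain ⟨c, rfl⟩ := ht.exists_eq_sum a
    rw [map_sum, map_sum]
    refine Finset.sum_eq_zero fun i _ ↦ ?_
    rw [map_mul, map_pow, map_pow]
    change E _ = 0
    rw [Derivation.leibniz, derivation_pow_eq_zero (p := p), Derivation.leibniz_pow E t', hEt]
    simp)
  obtain ⟨e, he, h⟩ := hD.exists_eq_sum p hreg hJ _ (sub_eq_zero.mp hr)
  choose e' he' using fun i ↦ (mem_powSubring p).mp (he i)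
  exact ⟨e', by simp_rw [← he', ← h]⟩

include f in
/-- A closed function whose germ is a polynomial in a parameter of the base with coefficients
`p`-th powers is a `p`-th power. -/
theorem coeff_eq_zero_of_d_eq_zero (hπ : IsNodalFibration π) (U : S.Opens) (r : Γ(S, U))
    (h : d (π ≫ f) U r = 0) (s : S) (hsU : s ∈ U) (hs : IsClosed {s})
    (hc : IsClosed {π s}) {t : C.presheaf.stalk (π s)} (ht : IsParameter p t)
    (c : ℕ → S.presheaf.stalk s)
    (hr : S.presheaf.germ U s hsU r = ∑ i ∈ Finset.range p, c i ^ p * (π.stalkMap s t) ^ i) :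
    ∀ i < p, i ≠ 0 → c i = 0 := by
  let _ := stalkAlgebra (π ≫ f) s
  have := charP_stalk p (π ≫ f) s
  obtain ⟨_, x, D, hD, hreg, hJ⟩ := exists_isCoordinates_le_jacobian p f π hπ s hs hc ht
  -- The Jacobian ideal contains the nonzero element `x 0`, so `dt` is nonzero.
  obtain ⟨j, hj⟩ : ∃ j, D j (π.stalkMap s t) ≠ 0 := by
    by_contra! h0
    simp only [h0, Set.range_const, Ideal.span_singleton_eq_bot.mpr] at hJ
    have h1 := hJ (hD.mem 0)
    have h2 := hD.apply_same 0
    rw [Ideal.mem_bot.mp h1, map_zero] at h2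
    exact zero_ne_one h2
  intro i hi h0
  refine eq_zero_of_pow_eq_zero (n := p) (coeff_eq_zero_of_derivation_sum_eq_zero (D j) _ hj
    (fun i ↦ c i ^ p) (fun i ↦ derivation_pow_eq_zero _ _) ?_ i hi h0)
  rw [← hr]
  exact derivation_germ_eq_zero (π ≫ f) U r h s hsU (D j)

end Germs

end
end LocallyExact

namespace LocallyExact
noncomputable section

/-! ### From germs at closed points to neighbourhoods -/

section Spread

theorem map_map_apply {X : Scheme.{u}} {U V W : X.Opens} (i : V ⟶ U) (j : W ⟶ V) (a : Γ(X, U)) :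
    X.presheaf.map j.op (X.presheaf.map i.op a) = X.presheaf.map (j ≫ i).op a := by
  rw [op_comp, Functor.map_comp]
  rfl

/-- A finite family of germs comes from sections over a common neighbourhood. -/
theorem exists_germ_eq_forall_lt {X : Scheme.{u}} {x : X} (c : ℕ → X.presheaf.stalk x) (n : ℕ) :
    ∃ (V : X.Opens) (hx : x ∈ V) (c' : ℕ → Γ(X, V)),
      ∀ i < n, X.presheaf.germ V x hx (c' i) = c i := by
  induction n with
  | zero => exact ⟨⊤, trivial, 0, by simp⟩
  | succ n ih =>
    obtain ⟨V, hx, c', h⟩ := ih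
    obtain ⟨W, hW, b, hb⟩ := X.presheaf.exists_germ_eq (c n)
    refine ⟨V ⊓ W, ⟨hx, hW⟩, fun i ↦ if i < n then X.presheaf.map (homOfLE inf_le_left).op (c' i)
      else X.presheaf.map (homOfLE inf_le_right).op b, fun i hi ↦ ?_⟩
    dsimp only
    split_ifs with hin
    · exact (X.presheaf.germ_res_apply (homOfLE inf_le_left) x ⟨hx, hW⟩ (c' i)).trans (h i hin)
    · obtain rfl : i = n := by omega
      exact (X.presheaf.germ_res_apply (homOfLE inf_le_right) x ⟨hx, hW⟩ b).trans hb

/-- An expression of a germ as a polynomial with coefficients `p`-th powers spreads out. -/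
theorem exists_map_eq_sum_of_germ_eq {X : Scheme.{u}} (p : ℕ) {U U' : X.Opens} {x : X} (hx : x ∈ U)
    (hx' : x ∈ U') (r : Γ(X, U)) (t : Γ(X, U')) (c : ℕ → X.presheaf.stalk x) (n : ℕ)
    (h : X.presheaf.germ U x hx r =
      ∑ i ∈ Finset.range n, c i ^ p * X.presheaf.germ U' x hx' t ^ i) :
    ∃ (V : X.Opens) (i : V ⟶ U) (j : V ⟶ U') (c' : ℕ → Γ(X, V)), x ∈ V ∧
      X.presheaf.map i.op r = ∑ l ∈ Finset.range n, c' l ^ p * X.presheaf.map j.op t ^ l := by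
  obtain ⟨V, hV, c', hc'⟩ := exists_germ_eq_forall_lt c n
  let W := V ⊓ (U ⊓ U')
  have hW : x ∈ W := ⟨hV, hx, hx'⟩
  let a : W ⟶ V := homOfLE inf_le_left
  let b : W ⟶ U := homOfLE (inf_le_right.trans inf_le_left)
  let e : W ⟶ U' := homOfLE (inf_le_right.trans inf_le_right)
  have h1 : X.presheaf.germ W x hW (X.presheaf.map b.op r) = X.presheaf.germ W x hW
      (∑ l ∈ Finset.range n, X.presheaf.map a.op (c' l) ^ p * X.presheaf.map e.op t ^ l) := by
    rw [map_sum, TopCat.Presheaf.germ_res_apply, h]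
    refine Finset.sum_congr rfl fun l hl ↦ ?_
    rw [map_mul, map_pow, map_pow, TopCat.Presheaf.germ_res_apply, TopCat.Presheaf.germ_res_apply,
      hc' l (Finset.mem_range.mp hl)]
  obtain ⟨W', hxW', i, i', h2⟩ := X.presheaf.germ_eq x hW hW _ _ h1
  obtain rfl := Subsingleton.elim i i'
  refine ⟨W', i ≫ b, i ≫ e, fun l ↦ X.presheaf.map (i ≫ a).op (c' l), hxW', ?_⟩
  rw [← map_map_apply, h2]
  simp only [map_sum, map_mul, map_pow, map_map_apply]

theorem exists_map_eq_pow_of_germ_eq {X : Scheme.{u}} (p : ℕ) {U : X.Opens} {x : X} (hx : x ∈ U)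
    (r : Γ(X, U)) (c : X.presheaf.stalk x) (h : X.presheaf.germ U x hx r = c ^ p) :
    ∃ (V : X.Opens) (i : V ⟶ U) (b : Γ(X, V)), x ∈ V ∧ X.presheaf.map i.op r = b ^ p := by
  -- A one-term sum: the auxiliary function `0` enters only through its zeroth power.
  obtain ⟨V, i, j, c', hxV, e⟩ := exists_map_eq_sum_of_germ_eq p hx (U' := ⊤) trivial r 0
    (fun _ ↦ c) 1 (by simpa using h)
  exact ⟨V, i, c' 0, hxV, by simpa using e⟩

/-- In a Jacobson space, every point of an open subset specializes to a closed point in it. -/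
theorem exists_isClosed_singleton_specializes {X : Type*} [TopologicalSpace X] [JacobsonSpace X]
    {U : Set X} (hU : IsOpen U) {x : X} (hx : x ∈ U) : ∃ s ∈ U, IsClosed {s} ∧ x ⤳ s := by
  obtain ⟨s, ⟨hs, hsU⟩, hsc⟩ := nonempty_inter_closedPoints (Z := closure {x} ∩ U)
    ⟨x, subset_closure rfl, hx⟩ (isClosed_closure.isLocallyClosed.inter hU.isLocallyClosed)
  exact ⟨s, hsU, hsc, specializes_iff_mem_closure.mpr hs⟩

theorem jacobsonSpace {k : Type u} [Field k] {X : Scheme.{u}} (f : X ⟶ Spec (.of k))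
    [LocallyOfFiniteType f] : JacobsonSpace X :=
  LocallyOfFiniteType.jacobsonSpace f

variable (p : ℕ) [hp : Fact p.Prime] {k : Type u} [Field k] [IsAlgClosed k] [CharP k p]

omit hp [IsAlgClosed k] in
theorem d_pow_eq_zero {X Y : Scheme.{u}} (f : X ⟶ Y) (g : X ⟶ Spec (.of k)) (U : X.Opens)
    (a : Γ(X, U)) : d f U (a ^ p) = 0 := by
  rw [d_pow, natCast_eq_zero p g U, zero_mul, zero_smul]

include p in
/-- On a smooth surface, functions with vanishing differential are killed by all differentials. -/
theorem d_eq_zero_of_d_eq_zero {S C : Scheme.{u}} [IsIntegral S] (g : S ⟶ Spec (.of k))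
    [SmoothOfRelativeDimension 2 g] (π : S ⟶ C) (U : S.Opens) (r : Γ(S, U)) (h : d g U r = 0) :
    d π U r = 0 := by
  have : Smooth g := SmoothOfRelativeDimension.smooth 2 g
  have := jacobsonSpace g
  refine eq_zero_of_locally _ _ _ fun x hx ↦ ?_
  -- Roots are available at closed points only; a neighbourhood of the specialization `s` also
  -- contains `x`.
  obtain ⟨s, hsU, hs, hxs⟩ := exists_isClosed_singleton_specializes U.isOpen hx
  obtain ⟨b, hb⟩ := exists_germ_eq_pow₂ p g U r h s hsU hs
  obtain ⟨V, i, c, hsV, e⟩ := exists_map_eq_pow_of_germ_eq p hsU r b hb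
  exact ⟨V, i, hxs.mem_open V.isOpen hsV, by rw [← d_map, e, d_pow_eq_zero p π g]⟩

include p in
/-- Pullbacks of functions with vanishing differential on a smooth curve have vanishing
differential. -/
theorem d_app_eq_zero_of_d_eq_zero {S C : Scheme.{u}} [IsIntegral C] (f : C ⟶ Spec (.of k))
    [SmoothOfRelativeDimension 1 f] (π : S ⟶ C) (U : C.Opens) (a : Γ(C, U)) (h : d f U a = 0) :
    d (π ≫ f) (π ⁻¹ᵁ U) (π.app U a) = 0 := by
  have : Smooth f := SmoothOfRelativeDimension.smooth 1 f
  have := jacobsonSpace f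
  refine eq_zero_of_locally _ _ _ fun x hx ↦ ?_
  obtain ⟨s, hsU, hs, hxs⟩ := exists_isClosed_singleton_specializes U.isOpen hx
  obtain ⟨b, hb⟩ := exists_germ_eq_pow₁ p f U a h s hsU hs
  obtain ⟨V, i, c, hsV, e⟩ := exists_map_eq_pow_of_germ_eq p hsU a b hb
  refine ⟨π ⁻¹ᵁ V, (Opens.map π.base).map i, hxs.mem_open V.isOpen hsV, ?_⟩
  rw [← d_map]
  have h1 : S.presheaf.map ((Opens.map π.base).map i).op (π.app U a) =
      π.app V (C.presheaf.map i.op a) :=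
    (ConcreteCategory.congr_hom (π.naturality i.op) a).symm
  rw [h1, e, map_pow, d_pow_eq_zero p (π ≫ f) (π ≫ f)]

theorem exists_map_eq_sum_of_d_eq_zero {S C : Scheme.{u}} [IsIntegral S] (f : C ⟶ Spec (.of k))
    [LocallyOfFiniteType f] (π : S ⟶ C) [SmoothOfRelativeDimension 2 (π ≫ f)]
    (hπ : IsNodalFibration π) (U : S.Opens) (r : Γ(S, U))
    (h : d π U r = 0) (s : S) (hsU : s ∈ U) (hs : IsClosed {s})
    (hc : IsClosed {π s}) (W : C.Opens) (hsW : π s ∈ W) (t : Γ(C, W))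
    (ht : IsParameter p (C.presheaf.germ W (π s) hsW t)) :
    ∃ (V : S.Opens) (i : V ⟶ U) (j : V ⟶ π ⁻¹ᵁ W) (c : ℕ → Γ(S, V)), s ∈ V ∧
      S.presheaf.map i.op r =
        ∑ l ∈ Finset.range p, c l ^ p * S.presheaf.map j.op (π.app W t) ^ l := by
  obtain ⟨c, hc⟩ := exists_germ_eq_sum p f π hπ U r h s hsU hs hc ht
  rw [Scheme.Hom.germ_stalkMap_apply] at hc
  exact exists_map_eq_sum_of_germ_eq p hsU hsW r _ c p hc

/-- On an integral scheme, sections over `V` embed in the stalk at `s`, so the statement about germs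
suffices. -/
theorem coeff_eq_zero_of_d_sum_eq_zero {S C : Scheme.{u}} [IsIntegral S] (f : C ⟶ Spec (.of k))
    [LocallyOfFiniteType f] (π : S ⟶ C) [SmoothOfRelativeDimension 2 (π ≫ f)]
    (hπ : IsNodalFibration π) (W : C.Opens) (t : Γ(C, W)) (V : S.Opens) (j : V ⟶ π ⁻¹ᵁ W)
    (s : S) (hsV : s ∈ V) (hs : IsClosed {s}) (hc : IsClosed {π s}) (hsW : π s ∈ W)
    (ht : IsParameter p (C.presheaf.germ W (π s) hsW t)) (c : ℕ → Γ(S, V))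
    (h : d (π ≫ f) V (∑ l ∈ Finset.range p, c l ^ p * S.presheaf.map j.op (π.app W t) ^ l) = 0) :
    ∀ i < p, i ≠ 0 → c i = 0 := by
  intro i hi h0
  have : Nonempty V := ⟨⟨s, hsV⟩⟩
  refine germ_injective_of_isIntegral S s hsV ?_
  rw [map_zero]
  refine coeff_eq_zero_of_d_eq_zero p f π hπ V _ h s hsV hs hc ht
    (fun i ↦ S.presheaf.germ V s hsV (c i)) ?_ i hi h0
  rw [map_sum]
  refine Finset.sum_congr rfl fun l _ ↦ ?_
  rw [map_mul, map_pow, map_pow, Scheme.Hom.germ_stalkMap_apply, TopCat.Presheaf.germ_res_apply]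

end Spread

end
end LocallyExact

namespace LocallyExact
noncomputable section

/-! ### Sections of the sheaves of exact forms, and the twist -/

section ExactForms

/-- A morphism descends along an epimorphism if it kills the sections killed by it. -/
theorem exists_comp_eq_of_app_eq_zero {X : Scheme.{u}} {A B T : X.Modules} (e : A ⟶ B) [Epi e]
    (g : A ⟶ T) (h : ∀ (U : X.Opens) (a : Γ(A, U)), e.app U a = 0 → g.app U a = 0) :
    ∃ v : B ⟶ T, e ≫ v = g := by
  refine ⟨Abelian.epiDesc e g ?_, Abelian.comp_epiDesc _ _ _⟩
  refine Scheme.Modules.hom_ext _ _ fun U ↦ ?_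
  ext a
  refine h U ((kernel.ι e).app U a) ?_
  rw [← Modules.comp_app_apply, kernel.condition]
  rfl

variable (p : ℕ) [hp : Fact p.Prime] {k : Type u} [Field k] [CharP k p]

section Absolute

variable {X : Scheme.{u}} (f : X ⟶ Spec (.of k))

/-- The differential of a function, as a section of the sheaf of locally exact differentials. -/
def exactForm (U : X.Opens) : Γ(X, U) →+ Γ(exactForms p f, U) :=
  ((toExactForms p f).app U).hom

theorem exactForm_eq_zero_iff (U : X.Opens) (r : Γ(X, U)) :
    exactForm p f U r = 0 ↔ d f U r = 0 := by
  have h : (image.ι (absoluteD p f)).app U (exactForm p f U r) = d f U r :=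
    congr(Scheme.Modules.Hom.app $(image.fac (absoluteD p f)) U r)
  rw [← h]
  exact (map_eq_zero_iff _ (Modules.app_injective (image.ι (absoluteD p f)) U)).symm

theorem map_exactForm {U V : X.Opens} (i : V ⟶ U) (r : Γ(X, U)) :
    (exactForms p f).presheaf.map i.op (exactForm p f U r) =
      exactForm p f V (X.presheaf.map i.op r) :=
  (Modules.app_map (toExactForms p f) i r).symm

/-- Scalars act on `F_* 𝒪_X` through Frobenius and `F_* d` is linear. This turns `p`-th power
coefficients of functions into coefficients of forms. -/
theorem exactForm_pow_mul (U : X.Opens) (c r : Γ(X, U)) :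
    exactForm p f U (c ^ p * r) = c • exactForm p f U r :=
  Scheme.Modules.Hom.app_smul (toExactForms p f) c r

instance : Epi (toExactForms p f) :=
  inferInstanceAs (Epi (factorThruImage (absoluteD p f)))

theorem exists_exactForm_eq_map (U : X.Opens) (b : Γ(exactForms p f, U)) (x : X) (hx : x ∈ U) :
    ∃ (V : X.Opens) (i : V ⟶ U) (r : Γ(X, V)), x ∈ V ∧
      exactForm p f V r = (exactForms p f).presheaf.map i.op b :=
  isLocallySurjective_of_epi (toExactForms p f) U b x hx

end Absolute

variable {S C : Scheme.{u}} (π : S ⟶ C) (f : C ⟶ Spec (.of k))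

theorem toRelativeExactForms_app_eq_zero_iff (W : (frobeniusTwist p π f).Opens)
    (r : Γ(S, relativeFrobenius p π f ⁻¹ᵁ W)) :
    (toRelativeExactForms p π f).app W r = 0 ↔ d π (relativeFrobenius p π f ⁻¹ᵁ W) r = 0 := by
  have h : (image.ι (relativeD p π f)).app W ((toRelativeExactForms p π f).app W r) =
      d π (relativeFrobenius p π f ⁻¹ᵁ W) r :=
    congr(Scheme.Modules.Hom.app $(image.fac (relativeD p π f)) W r)
  rw [← h]
  exact (map_eq_zero_iff _ (Modules.app_injective (image.ι (relativeD p π f)) W)).symm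

instance : Epi (toRelativeExactForms p π f) :=
  inferInstanceAs (Epi (factorThruImage (relativeD p π f)))

theorem relativeFrobenius_preimage_preimage (U : S.Opens) :
    relativeFrobenius p π f ⁻¹ᵁ arithmeticFrobenius p π f ⁻¹ᵁ U = U := by
  rw [← Scheme.Hom.comp_preimage, relativeFrobenius_comp]
  rfl

theorem frobeniusStructureHom_app_apply (U : C.Opens) (a : Γ(C, U)) :
    (frobeniusStructureHom p π f).app U a = π.app U a := by
  refine Eq.trans (b := S.presheaf.map (𝟙 _) (π.app U a)) rfl ?_
  rw [CategoryTheory.Functor.map_id]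
  rfl

theorem arithmeticFrobenius_comp_relativeFrobenius :
    arithmeticFrobenius p π f ≫ relativeFrobenius p π f =
      absoluteFrobenius p (pullback.snd π (absoluteFrobenius p f) ≫ f) := by
  apply pullback.hom_ext
  · rw [Category.assoc, relativeFrobenius, pullback.lift_fst]
    exact absoluteFrobenius_comm p (π ≫ f) (pullback.fst π (absoluteFrobenius p f))
  · rw [Category.assoc, relativeFrobenius, pullback.lift_snd, pullback.condition]
    exact absoluteFrobenius_comm p f (pullback.snd π (absoluteFrobenius p f))

/-- The two composites of `W` with the relative Frobenius are absolute Frobenius morphisms, which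
are the identity on points. -/
theorem isHomeomorph_arithmeticFrobenius : IsHomeomorph (arithmeticFrobenius p π f) := by
  refine isHomeomorph_iff_exists_inverse.mpr ⟨(arithmeticFrobenius p π f).continuous,
    relativeFrobenius p π f, fun x ↦ ?_, fun x ↦ ?_, (relativeFrobenius p π f).continuous⟩
  · have h := arithmeticFrobenius_comp_relativeFrobenius p π f
    exact congr($h x)
  · have h := relativeFrobenius_comp p π f
    exact congr($h x)

end ExactForms

end
end LocallyExact

namespace LocallyExact
noncomputable section

/-! ### The short exact sequence -/

section Sequence

variable (p : ℕ) [hp : Fact p.Prime] {k : Type u} [Field k] [CharP k p] {S C : Scheme.{u}}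
  {f : C ⟶ Spec (.of k)} {π : S ⟶ C}

theorem IsPullbackOfForms.app_pullbackSection
    {u : (Scheme.Modules.pullback π).obj (exactForms p f) ⟶ exactForms p (π ≫ f)}
    (hu : IsPullbackOfForms p π f u) (W : C.Opens) (a : Γ(C, W)) :
    u.app (π ⁻¹ᵁ W) (pullbackSection π (exactForms p f) W (exactForm p f W a)) =
      exactForm p (π ≫ f) (π ⁻¹ᵁ W) (π.app W a) := by
  have h := congr(Scheme.Modules.Hom.app $hu W a)
  rw [Adjunction.homEquiv_unit] at h
  refine Eq.trans h ?_
  exact congr_arg (exactForm p (π ≫ f) (π ⁻¹ᵁ W)) (frobeniusStructureHom_app_apply p π f W a)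

theorem toRelativeExactForms_app_map_eq_zero_iff (U : S.Opens) (r : Γ(S, U)) :
    (toRelativeExactForms p π f).app (arithmeticFrobenius p π f ⁻¹ᵁ U)
      (S.presheaf.map (eqToHom (relativeFrobenius_preimage_preimage p π f U)).op r) = 0 ↔
        d π U r = 0 := by
  refine (toRelativeExactForms_app_eq_zero_iff p π f _ _).trans ?_
  rw [d_map]
  refine map_eq_zero_iff _ ?_
  exact (ConcreteCategory.bijective_of_isIso ((differentials π).presheaf.map
    (eqToHom (relativeFrobenius_preimage_preimage p π f U)).op)).1

theorem IsPassageToRelativeForms.app_exactForm_eq_zero_iff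
    {v : exactForms p (π ≫ f) ⟶ (Scheme.Modules.pushforward (arithmeticFrobenius p π f)).obj
      (relativeExactForms p π f)}
    (hv : IsPassageToRelativeForms p π f v) (U : S.Opens) (r : Γ(S, U)) :
    v.app U (exactForm p (π ≫ f) U r) = 0 ↔ d π U r = 0 := by
  have h : v.app U (exactForm p (π ≫ f) U r) =
      (toRelativeExactForms p π f).app (arithmeticFrobenius p π f ⁻¹ᵁ U)
        (S.presheaf.map (eqToHom (relativeFrobenius_preimage_preimage p π f U)).op r) :=
    congr(Scheme.Modules.Hom.app $hv U r)
  rw [h]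
  exact toRelativeExactForms_app_map_eq_zero_iff p U r

theorem IsPassageToRelativeForms.epi
    {v : exactForms p (π ≫ f) ⟶ (Scheme.Modules.pushforward (arithmeticFrobenius p π f)).obj
      (relativeExactForms p π f)}
    (hv : IsPassageToRelativeForms p π f v) : Epi v := by
  have h1 := epi_pushforward_map (arithmeticFrobenius p π f)
    (isHomeomorph_arithmeticFrobenius p π f) (toRelativeExactForms p π f)
  have h2 : Epi (toExactForms p (π ≫ f) ≫ v) := by
    rw [hv]
    exact epi_comp _ _
  exact epi_of_epi (toExactForms p (π ≫ f)) v

/-- By adjunction, and since the differential is epi onto exact forms, this reduces to the vanishing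
of the relative differential on functions from `C`. -/
theorem IsPullbackOfForms.comp_eq_zero
    {u : (Scheme.Modules.pullback π).obj (exactForms p f) ⟶ exactForms p (π ≫ f)}
    {v : exactForms p (π ≫ f) ⟶ (Scheme.Modules.pushforward (arithmeticFrobenius p π f)).obj
      (relativeExactForms p π f)}
    (hu : IsPullbackOfForms p π f u) (hv : IsPassageToRelativeForms p π f v) : u ≫ v = 0 := by
  apply ((Scheme.Modules.pullbackPushforwardAdjunction π).homEquiv _ _).injective
  have h0 : (Scheme.Modules.pullbackPushforwardAdjunction π).homEquiv (exactForms p f)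
      ((Scheme.Modules.pushforward (arithmeticFrobenius p π f)).obj (relativeExactForms p π f)) 0 =
      0 := by
    rw [Adjunction.homEquiv_unit]
    exact Scheme.Modules.hom_ext _ _ fun U ↦ rfl
  rw [h0, Adjunction.homEquiv_naturality_right, ← cancel_epi (toExactForms p f), comp_zero,
    ← Category.assoc, hu]
  refine Scheme.Modules.hom_ext _ _ fun U ↦ ?_
  ext a
  refine (congr_arg (fun y ↦ v.app (π ⁻¹ᵁ U) (exactForm p (π ≫ f) (π ⁻¹ᵁ U) y))
    (frobeniusStructureHom_app_apply p π f U a)).trans ?_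
  exact (hv.app_exactForm_eq_zero_iff p (π ⁻¹ᵁ U) (π.app U a)).mpr (d_app π U a)

variable [IsAlgClosed k]

/-- If `da = 0` on the curve, then `a` is locally a `p`-th power and so is its pullback; hence `a ↦
d(π^♯ a)` descends along the differential of `C`. -/
theorem exists_isPullbackOfForms [IsIntegral C] [SmoothOfRelativeDimension 1 f] :
    ∃ u, IsPullbackOfForms p π f u := by
  obtain ⟨u', hu'⟩ := exists_comp_eq_of_app_eq_zero (toExactForms p f)
    (frobeniusStructureHom p π f ≫ (Scheme.Modules.pushforward π).map (toExactForms p (π ≫ f)))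
    (by
      intro U a ha
      have h := d_app_eq_zero_of_d_eq_zero p f π U a ((exactForm_eq_zero_iff p f U a).mp ha)
      rw [← exactForm_eq_zero_iff p] at h
      exact (congr_arg (exactForm p (π ≫ f) (π ⁻¹ᵁ U))
        (frobeniusStructureHom_app_apply p π f U a)).trans h)
  refine ⟨((Scheme.Modules.pullbackPushforwardAdjunction π).homEquiv _ _).symm u', ?_⟩
  rw [IsPullbackOfForms, Equiv.apply_symm_apply]
  exact hu'

theorem exists_isPassageToRelativeForms [IsIntegral S] [SmoothOfRelativeDimension 2 (π ≫ f)] :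
    ∃ v, IsPassageToRelativeForms p π f v := by
  refine exists_comp_eq_of_app_eq_zero _ _ fun U r hr ↦ ?_
  have h := d_eq_zero_of_d_eq_zero p (π ≫ f) π U r ((exactForm_eq_zero_iff p (π ≫ f) U r).mp hr)
  change (toRelativeExactForms p π f).app (arithmeticFrobenius p π f ⁻¹ᵁ U)
    (S.presheaf.map (eqToHom (relativeFrobenius_preimage_preimage p π f U)).op r) = 0
  exact (toRelativeExactForms_app_map_eq_zero_iff p U r).mpr h

section Exact

variable [IsIntegral S] [SmoothOfRelativeDimension 1 f] [LocallyOfFiniteType f] [IsProper π]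
  [SmoothOfRelativeDimension 2 (π ≫ f)]

omit [IsIntegral S] [SmoothOfRelativeDimension 1 f] [LocallyOfFiniteType f]
  [SmoothOfRelativeDimension 2 (π ≫ f)] in
theorem isClosed_singleton_apply (s : S) (hs : IsClosed {s}) : IsClosed {π s} := by
  rw [← Set.image_singleton]
  exact π.isClosedMap _ hs

theorem exact_of_isNodalFibration (hπ : IsNodalFibration π)
    {u : (Scheme.Modules.pullback π).obj (exactForms p f) ⟶ exactForms p (π ≫ f)}
    {v : exactForms p (π ≫ f) ⟶ (Scheme.Modules.pushforward (arithmeticFrobenius p π f)).obj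
      (relativeExactForms p π f)}
    (hu : IsPullbackOfForms p π f u) (hv : IsPassageToRelativeForms p π f v) (w : u ≫ v = 0) :
    (ShortComplex.mk u v w).Exact := by
  have : Smooth (π ≫ f) := SmoothOfRelativeDimension.smooth 2 (π ≫ f)
  have := jacobsonSpace (π ≫ f)
  refine exact_of_locally fun U m hm x hx ↦ ?_
  obtain ⟨s, hsU, hs, hxs⟩ := exists_isClosed_singleton_specializes U.isOpen hx
  have hc : IsClosed {π s} := isClosed_singleton_apply s hs
  obtain ⟨V, i, r, hsV, hr⟩ := exists_exactForm_eq_map p (π ≫ f) U m s hsU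
  have hr' : d π V r = 0 := by
    rw [← hv.app_exactForm_eq_zero_iff p, hr, Modules.app_map]
    exact (congr_arg _ hm).trans (map_zero _)
  obtain ⟨t, ht⟩ := exists_isParameter p f (π s) hc
  obtain ⟨W, hsW, t, rfl⟩ := C.presheaf.exists_germ_eq t
  obtain ⟨V', i', j, c, hsV', e⟩ := exists_map_eq_sum_of_d_eq_zero p f π hπ V r hr' s hsV hs hc W
    hsW t ht
  -- The expression `r = ∑ c l ^ p t ^ l` suggests the preimage: `u` sends `c l` times the pullback
  -- of `d(t ^ l)` to `d(c l ^ p t ^ l)`.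
  refine ⟨V', i' ≫ i, ∑ l ∈ Finset.range p, c l • ((Scheme.Modules.pullback π).obj _).presheaf.map
    j.op (pullbackSection π (exactForms p f) W (exactForm p f W (t ^ l))),
    hxs.mem_open V'.isOpen hsV', ?_⟩
  refine Eq.trans ?_ (Modules.map_map _ _ _ _)
  refine Eq.trans ?_ (congr_arg _ hr)
  rw [map_exactForm, e, map_sum, map_sum]
  refine Finset.sum_congr rfl fun l _ ↦ ?_
  refine (Scheme.Modules.Hom.app_smul u _ _).trans ?_
  rw [Modules.app_map, hu.app_pullbackSection, map_exactForm, exactForm_pow_mul, map_pow, map_pow]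

theorem mono_of_isNodalFibration (hπ : IsNodalFibration π)
    {u : (Scheme.Modules.pullback π).obj (exactForms p f) ⟶ exactForms p (π ≫ f)}
    (hu : IsPullbackOfForms p π f u) : Mono u := by
  have : Smooth (π ≫ f) := SmoothOfRelativeDimension.smooth 2 (π ≫ f)
  have := jacobsonSpace (π ≫ f)
  refine Modules.mono_of_app_injective _ fun U ↦ (injective_iff_map_eq_zero _).mpr fun m hm ↦ ?_
  refine eq_zero_of_locally _ _ _ fun x hx ↦ ?_
  obtain ⟨s, hsU, hs, hxs⟩ := exists_isClosed_singleton_specializes U.isOpen hx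
  have hc : IsClosed {π s} := isClosed_singleton_apply s hs
  obtain ⟨t, ht⟩ := exists_isParameter p f (π s) hc
  obtain ⟨W, hsW, t, rfl⟩ := C.presheaf.exists_germ_eq t
  -- Near `π s` every function is a polynomial in `t` with `p`-th power coefficients, so the forms
  -- `d(t ^ l)` with `l < p` generate the exact forms of `C`, and their pullbacks generate the
  -- source of `u`.
  obtain ⟨V, i, j, c, hsV, e⟩ := exists_map_eq_sum π (exactForms p f) W
    (fun l : Fin p ↦ exactForm p f W (t ^ (l : ℕ))) s hsW (by
      intro W' b hsW'
      obtain ⟨W₁, i₁, a, hs₁, ha⟩ := exists_exactForm_eq_map p f W' b (π s) hsW'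
      obtain ⟨c, hc⟩ := ht.exists_eq_sum (C.presheaf.germ W₁ (π s) hs₁ a)
      obtain ⟨W₂, i₂, j₂, c', hs₂, e⟩ := exists_map_eq_sum_of_germ_eq p hs₁ hsW a t c p hc
      refine ⟨W₂, j₂, i₂ ≫ i₁, fun l ↦ c' l, hs₂, ?_⟩
      rw [← Modules.map_map, ← ha, map_exactForm, e, map_sum, Finset.sum_range]
      refine Finset.sum_congr rfl fun l _ ↦ ?_
      rw [exactForm_pow_mul, map_exactForm]
      exact congr_arg (fun y ↦ c' l • exactForm p f W₂ y)
        (map_pow (C.presheaf.map j₂.op).hom t l).symm) U m hsU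
  refine ⟨V, i, hxs.mem_open V.isOpen hsV, ?_⟩
  obtain ⟨c', hc'⟩ : ∃ c' : ℕ → Γ(S, V), ∀ l : Fin p, c l = c' l :=
    ⟨fun l ↦ if h : l < p then c ⟨l, h⟩ else 0, fun l ↦ by simp⟩
  have h0 : u.app V
      (((Scheme.Modules.pullback π).obj (exactForms p f)).presheaf.map i.op m) = 0 := by
    rw [Modules.app_map]
    exact (congr_arg _ hm).trans (map_zero _)
  have h1 : u.app V (((Scheme.Modules.pullback π).obj (exactForms p f)).presheaf.map i.op m) =
      exactForm p (π ≫ f) V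
        (∑ l ∈ Finset.range p, c' l ^ p * S.presheaf.map j.op (π.app W t) ^ l) := by
    rw [e, map_sum, Finset.sum_range, map_sum]
    refine Finset.sum_congr rfl fun l _ ↦ ?_
    refine (Scheme.Modules.Hom.app_smul u _ _).trans ?_
    rw [Modules.app_map, hu.app_pullbackSection, map_exactForm, exactForm_pow_mul, map_pow, map_pow,
      hc']
  rw [h1, exactForm_eq_zero_iff] at h0
  have h2 := coeff_eq_zero_of_d_sum_eq_zero p f π hπ W t V j s hsV hs hc hsW ht c' h0
  rw [e]
  refine Finset.sum_eq_zero fun l _ ↦ ?_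
  rw [hc']
  -- The coefficient at `l = 0` is unconstrained, but there the generator `d(t ^ 0)` vanishes.
  by_cases hl : (l : ℕ) = 0
  · have h3 : exactForm p f W (t ^ (l : ℕ)) = 0 := by
      rw [exactForm_eq_zero_iff, d_pow, hl, Nat.cast_zero, zero_mul, zero_smul]
    rw [h3, pullbackSection_zero, map_zero, smul_zero]
  · rw [h2 l l.2 hl, zero_smul]

end Exact

end Sequence

end
end LocallyExact

/-- For a smooth proper surface `S` and a smooth proper curve `C` over an algebraically closed field
`k` of characteristic `p`, and a nodal fibration `π : S ⟶ C`, the canonical maps form a short exact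
sequence of `𝒪_S`-modules `0 ⟶ π^* B¹_{C/k} ⟶ B¹_{S/k} ⟶ W_* B¹_{S/C} ⟶ 0`. -/
theorem mainTheorem3 (p : ℕ) [Fact p.Prime] {k : Type u} [Field k] [IsAlgClosed k] [CharP k p]
    {S C : Scheme.{u}} [IsIntegral S] [IsIntegral C] (f : C ⟶ Spec (.of k)) (π : S ⟶ C)
    [IsProper f] [SmoothOfRelativeDimension 1 f]
    [IsProper (π ≫ f)] [SmoothOfRelativeDimension 2 (π ≫ f)]
    (hπ : LocallyExact.IsNodalFibration π) :
    ∃ (u : (Scheme.Modules.pullback π).obj (LocallyExact.exactForms p f) ⟶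
          LocallyExact.exactForms p (π ≫ f))
      (v : LocallyExact.exactForms p (π ≫ f) ⟶
          (Scheme.Modules.pushforward (LocallyExact.arithmeticFrobenius p π f)).obj
            (LocallyExact.relativeExactForms p π f)),
      LocallyExact.IsPullbackOfForms p π f u ∧
      LocallyExact.IsPassageToRelativeForms p π f v ∧
      ∃ w : u ≫ v = 0, (ShortComplex.mk u v w).ShortExact := by
  have := hπ.proper
  obtain ⟨u, hu⟩ := LocallyExact.exists_isPullbackOfForms p (f := f) (π := π)
  obtain ⟨v, hv⟩ := LocallyExact.exists_isPassageToRelativeForms p (f := f) (π := π)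
  have w := hu.comp_eq_zero p hv
  have hmono := LocallyExact.mono_of_isNodalFibration p hπ hu
  have hepi := hv.epi p
  exact ⟨u, v, hu, hv, w, ⟨LocallyExact.exact_of_isNodalFibration p hπ hu hv w⟩⟩
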